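/- **Conventions.** All Hilbert spaces are complex, separable and infinite dimensional. For a bounded operator $T$ on $H$ let $\mu(k,T)$, $k\ge 0$, be its $k$-th singular value (the distance from $T$ to the operators of rank at most $k$), put $\mu(s,T)=\mu(\lfloor s\rfloor,T)$ for real $s\ge0$, and let $\mathcal{L}_{1,\infty}=\{T:\ \mu(k,T)=O(\tfrac1{k+1})\}$. $\mathrm{Tr}$ is the standard operator trace. A spectral triple $(\mathcal{A},H,D)$ consists of a $*$-algebra $\mathcal{A}$ of bounded operators on $H$ and a self-adjoint operator $D$ on $H$ with compact resolvent, such that the elements $a\in\mathcal{A}$ that preserve the domain of $D$ and have bounded commutator $[D,a]$ are dense in $\mathcal{A}$ in the weak operator topology (in particular, this holds if all $a \in \mathcal{A}$ are such). For real $p>0$ it is called $(p,\infty)$-summable if $(1+D^2)^{-p/2}\in\mathcal{L}_{1,\infty}$. A $(p,\infty)$-summable spectral triple is said to satisfy the theta-convergence condition if for every $T\in\mathcal{A}$ there is $c(T)\in\mathbb{C}$ such that $$t^p\,\mathrm{Tr}\big(Te^{-(tD)^2}\big)\to c(T),\qquad t\to0+ .$$ On $L_\infty(0,\infty)$ let $$(Mx)(t)=\frac1{\log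 t}\int_1^t x(s)\frac{ds}{s},\qquad (P_ux)(t)=x(t^u),\quad u,t>0.$$ Let $\omega$ be a state on $L_\infty(0,\infty)$ that vanishes on all $x$ with $x(t)\to0$ as $t\to\infty$ and satisfies $\omega=\omega\circ M$. The Dixmier trace $\mathrm{Tr}_\omega:\mathcal{L}_{1,\infty}\to\mathbb{C}$ is the linear extension of the functional $$\mathrm{Tr}_\omega(A)=\omega\Big(t\mapsto\frac1{\log(1+t)}\int_0^t\mu(s,A)\,ds\Big),\qquad 0\le A\in\mathcal{L}_{1,\infty};$$ explicitly, $\mathrm{Tr}_\omega(A)=\mathrm{Tr}_\omega((\Re A)_+)-\mathrm{Tr}_\omega((\Re A)_-)+i\,\mathrm{Tr}_\omega((\Im A)_+)-i\,\mathrm{Tr}_\omega((\Im A)_-)$, where $\Re A=\frac12(A+A^*)$ and $\Im A=\frac1{2i}(A-A^*)$. (The same $\omega$ defines $\mathrm{Tr}_\omega$ on every Hilbert space.) Let $\mathfrak{M}$ be the class of those $\mathrm{Tr}_\omega$ for which, in addition, $\omega=\omega\circ P_u$ for every $u>0$. **Theorem.** Let $p_1,p_2>0$, let $(\mathcal{A}_1,H_1,D_1)$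 be a $(p_1,\infty)$-summable spectral triple and $(\mathcal{A}_2,H_2,D_2)$ a $(p_2,\infty)$-summable spectral triple, and suppose that at least one of them satisfies the theta-convergence condition. Then for every $T_1\in\mathcal{A}_1$, every $T_2\in\mathcal{A}_2$ and every $\mathrm{Tr}_\omega\in\mathfrak{M}$, the operators $T_1(1+D_1^2)^{-p_1/2}$, $T_2(1+D_2^2)^{-p_2/2}$ and $(T_1\otimes T_2)(1+D_1^2\otimes1+1\otimes D_2^2)^{-(p_1+p_2)/2}$ (the last one on the Hilbert space tensor product of $H_1$ and $H_2$) belong to $\mathcal{L}_{1,\infty}$, and $$\Gamma\Big(1+\frac{p_1+p_2}2\Big)\mathrm{Tr}_\omega\Big((T_1\otimes T_2)(1+D_1^2\otimes1+1\otimes D_2^2)^{-\frac{p_1+p_2}2}\Big)$$ $$=\Gamma\Big(1+\frac{p_1}2\Big)\mathrm{Tr}_\omega\Big(T_1(1+D_1^2)^{-\frac{p_1}2}\Big)\cdot\Gamma\Big(1+\frac{p_2}2\Big)\mathrm{Tr}_\omega\Big(T_2(1+D_2^2)^{-\frac{p_2}2}\Big).$$ -/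

import Mathlib

open scoped TensorProduct Topology ENNReal InnerProductSpace

namespace NCFubini

noncomputable section

/-! ### Compact operators: singular values, the ideal `L_{1,∞}`, the trace -/

section Operators

variable {H : Type*} [NormedAddCommGroup H] [InnerProductSpace ℂ H]

/-- The `k`-th singular value `μ(k, T)`, `k ≥ 0`, of a bounded operator `T`: the distance from `T`
to the operators of rank at most `k`. For a compact operator this is the `k`-th eigenvalue of `|T|`,
in non-increasing order and counted with multiplicity. -/
def singularValue (k : ℕ) (T : H →L[ℂ] H) : ℝ :=
  sInf {d : ℝ | ∃ F : H →L[ℂ] H, LinearMap.rank (F : H →ₗ[ℂ] H) ≤ (k : Cardinal) ∧ d = ‖T - F‖}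

/-- `T ∈ L_{1,∞}`, that is, `μ(k, T) = O(1 / (k + 1))`. -/
def MemWeakL1 (T : H →L[ℂ] H) : Prop :=
  ∃ C : ℝ, ∀ k : ℕ, singularValue k T ≤ C / ((k : ℝ) + 1)

/-- The standard trace `Tr T = ∑ i, ⟪e i, T (e i)⟫`, computed in a fixed orthonormal (Hilbert) basis
of `H`. For trace class `T`, the only case of interest, the basis is inessential. -/
def opTrace [CompleteSpace H] (T : H →L[ℂ] H) : ℂ :=
  ∑' i, ⟪(exists_hilbertBasis ℂ H).choose_spec.choose i,
    T ((exists_hilbertBasis ℂ H).choose_spec.choose i)⟫_ℂ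

end Operators

/-! ### Functions of an unbounded operator with an orthonormal eigenbasis -/

section FunctionalCalculus

variable {H : Type*} [NormedAddCommGroup H] [InnerProductSpace ℂ H]

/-- The eigenspace `{x ∈ dom A | A x = r x}` of an unbounded operator, for real `r`. -/
def eigenspace (A : H →ₗ.[ℂ] H) (r : ℝ) : Submodule ℂ H :=
  A.graph.comap (LinearMap.prod LinearMap.id ((r : ℂ) • LinearMap.id))

/-- The orthogonal projection onto the eigenspace of `A` for the real number `r`. The eigenspaces of
a closed operator are closed, so that taking the closure changes nothing there. -/
def eigenprojection [CompleteSpace H] (A : H →ₗ.[ℂ] H) (r : ℝ) : H →L[ℂ] H :=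
  (eigenspace A r).topologicalClosure.starProjection

/-- The bounded operator `f(A) = ∑ f(r) P_r` (strongly convergent sum over the real numbers `r`,
where `P_r` is the projection onto the eigenspace of `A` for `r`). For a self-adjoint operator `A`
with an orthonormal eigenbasis, for instance one with compact resolvent, this is the usual Borel
functional calculus. The sum converges for every symmetric `A` and bounded `f`:
see `exists_hasSum_eigenprojection`. -/
def funCalc [CompleteSpace H] (A : H →ₗ.[ℂ] H) (f : ℝ → ℝ) : H →L[ℂ] H :=
  open Classical in
  if h : ∃ B : H →L[ℂ] H, ∀ x : H, HasSum (fun r : ℝ => (f r : ℂ) • eigenprojection A r x) (B x)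
  then h.choose else 0

theorem orthogonalFamily_eigenspace (A : H →ₗ.[ℂ] H) (hA : A.IsFormalAdjoint A) :
    OrthogonalFamily ℂ (fun r : ℝ => (eigenspace A r).topologicalClosure)
      (fun r => (eigenspace A r).topologicalClosure.subtypeₗᵢ) := by
  apply OrthogonalFamily.of_pairwise
  intro r s hrs
  rw [Function.onFun, Submodule.isOrtho_iff_le]
  apply Submodule.topologicalClosure_minimal _ _ (Submodule.isClosed_orthogonal _)
  rw [Submodule.orthogonal_closure]
  intro x hx
  rw [Submodule.mem_orthogonal]
  intro y hy
  have hx' : (x, (r : ℂ) • x) ∈ A.graph := hx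
  have hy' : (y, (s : ℂ) • y) ∈ A.graph := hy
  obtain ⟨x', hx1, hx2⟩ := (LinearPMap.mem_graph_iff A).1 hx'
  obtain ⟨y', hy1, hy2⟩ := (LinearPMap.mem_graph_iff A).1 hy'
  have h := hA y' x'
  simp only at hx1 hx2 hy1 hy2
  rw [hx1, hx2, hy1, hy2, inner_smul_left, inner_smul_right] at h
  have h2 : ((s : ℂ) - r) * ⟪y, x⟫_ℂ = 0 := by
    rw [sub_mul, ← h]; simp
  rcases mul_eq_zero.1 h2 with h3 | h3
  · exact absurd (by exact_mod_cast (sub_eq_zero.1 h3).symm) hrs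
  · exact h3

theorem exists_hasSum_eigenprojection [CompleteSpace H] (A : H →ₗ.[ℂ] H)
    (hA : A.IsFormalAdjoint A) (f : ℝ → ℝ) (C : ℝ) (hf : ∀ r, |f r| ≤ C) :
    ∃ B : H →L[ℂ] H, ∀ x : H,
      HasSum (fun r : ℝ => (f r : ℂ) • eigenprojection A r x) (B x) := by
  classical
  have hO := orthogonalFamily_eigenspace A hA
  have hC : 0 ≤ C := (abs_nonneg _).trans (hf 0)
  let v : H → (r : ℝ) → (eigenspace A r).topologicalClosure := fun x r =>
    ⟨eigenprojection A r x, Submodule.starProjection_apply_mem _ x⟩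
  have bessel : ∀ (x : H) (s : Finset ℝ), ∑ r ∈ s, ‖v x r‖ ^ 2 ≤ ‖x‖ ^ 2 := by
    intro x s
    have h1 := hO.norm_sum (v x) s
    set y := ∑ r ∈ s, (eigenspace A r).topologicalClosure.subtypeₗᵢ (v x r) with hy
    have h2 : (⟪y, x⟫_ℂ).re = ∑ r ∈ s, ‖v x r‖ ^ 2 := by
      rw [hy, sum_inner, Complex.re_sum]
      refine Finset.sum_congr rfl fun r _ => ?_
      exact Submodule.re_inner_starProjection_eq_normSq
        (K := (eigenspace A r).topologicalClosure) x
    have h3 : (⟪y, x⟫_ℂ).re ≤ ‖y‖ * ‖x‖ :=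
      (Complex.re_le_norm _).trans (norm_inner_le_norm y x)
    nlinarith [norm_nonneg x, norm_nonneg y, sq_nonneg (‖y‖ - ‖x‖)]
  have hsq : ∀ (x : H) (r : ℝ), ‖(f r : ℂ) • v x r‖ ^ 2 ≤ C ^ 2 * ‖v x r‖ ^ 2 := by
    intro x r
    rw [norm_smul, mul_pow, Complex.norm_real, Real.norm_eq_abs]
    gcongr
    exact hf r
  have hsum : ∀ x : H, Summable (fun r : ℝ => (f r : ℂ) • eigenprojection A r x) := by
    intro x
    have := (hO.summable_iff_norm_sq_summable (fun r => (f r : ℂ) • v x r)).2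
      (Summable.of_nonneg_of_le (fun _ => sq_nonneg _) (hsq x)
        ((summable_of_sum_le (fun _ => sq_nonneg _) (bessel x)).mul_left _))
    exact this
  have hbound : ∀ x : H, ‖∑' r : ℝ, (f r : ℂ) • eigenprojection A r x‖ ≤ C * ‖x‖ := by
    intro x
    refine le_of_tendsto (hsum x).hasSum.norm (Filter.Eventually.of_forall fun s => ?_)
    have h1 := hO.norm_sum (fun r => (f r : ℂ) • v x r) s
    have h2 : ‖∑ r ∈ s, (f r : ℂ) • eigenprojection A r x‖ ^ 2 ≤ (C * ‖x‖) ^ 2 := by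
      calc _ = ∑ r ∈ s, ‖(f r : ℂ) • v x r‖ ^ 2 := h1
        _ ≤ ∑ r ∈ s, C ^ 2 * ‖v x r‖ ^ 2 := Finset.sum_le_sum fun r _ => hsq x r
        _ ≤ (C * ‖x‖) ^ 2 := by
          rw [← Finset.mul_sum, mul_pow]
          gcongr
          exact bessel x s
    exact le_of_sq_le_sq h2 (by positivity)
  let L : H →ₗ[ℂ] H :=
    { toFun := fun x => ∑' r : ℝ, (f r : ℂ) • eigenprojection A r x
      map_add' := fun x y => by
        rw [← (hsum x).tsum_add (hsum y)]
        exact tsum_congr fun r => by rw [map_add, smul_add]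
      map_smul' := fun c x => by
        rw [RingHom.id_apply, ← (hsum x).tsum_const_smul]
        exact tsum_congr fun r => by rw [map_smul, smul_comm] }
  exact ⟨L.mkContinuous C hbound, fun x => (hsum x).hasSum⟩

end FunctionalCalculus

/-! ### Spectral triples -/

section SpectralTriples

variable {H : Type*} [NormedAddCommGroup H] [InnerProductSpace ℂ H]

/-- The bounded operator `a` preserves the domain of `D`, and the commutator `[D, a]` extends to a
bounded operator `B`: one has `D (a x) = a (D x) + B x` for all `x` in the domain of `D`. -/
def HasBoundedCommutator (D : H →ₗ.[ℂ] H) (a : H →L[ℂ] H) : Prop :=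
  ∃ B : H →L[ℂ] H, ∀ x y : H, (x, y) ∈ D.graph → (a x, a y + B x) ∈ D.graph

variable (H) in
/-- A spectral triple `(𝒜, H, D)`: an algebra `𝒜` of bounded operators on `H` closed under adjoints,
and an (unbounded) self-adjoint operator `D` with compact resolvent, such that the elements of `𝒜`
with bounded commutator with `D` are dense in `𝒜` in the weak operator topology. (The case that all
commutators are bounded is included; so is that of a von Neumann algebra `𝒜` with a weakly dense
subalgebra of smooth elements.) -/
structure SpectralTriple [CompleteSpace H] where
  /-- the algebra `𝒜` -/
  algebra : NonUnitalStarSubalgebra ℂ (H →L[ℂ] H)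
  /-- the operator `D` -/
  D : H →ₗ.[ℂ] H
  isSelfAdjoint : IsSelfAdjoint D
  /-- `R` is the resolvent `(D + i)⁻¹`. -/
  compact_resolvent : ∃ R : H →L[ℂ] H, IsCompactOperator R ∧
    ∀ x : H, (R x, x - Complex.I • R x) ∈ D.graph
  dense_smooth : ∀ T ∈ algebra,
    (ContinuousLinearMapWOT.ofCLM T : H →WOT[ℂ] H) ∈
      closure (ContinuousLinearMapWOT.ofCLM '' {a | a ∈ algebra ∧ HasBoundedCommutator D a})

variable [CompleteSpace H]

/-- The heat operator `e^{-(tD)^2}`. -/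
def SpectralTriple.heat (S : SpectralTriple H) (t : ℝ) : H →L[ℂ] H :=
  funCalc S.D fun r => Real.exp (-(t * r) ^ 2)

/-- The operator `(1 + D^2)^{-p/2}`. -/
def SpectralTriple.bessel (S : SpectralTriple H) (p : ℝ) : H →L[ℂ] H :=
  funCalc S.D fun r => (1 + r ^ 2) ^ (-p / 2)

/-- The spectral triple is `(p, ∞)`-summable: `(1 + D^2)^{-p/2} ∈ L_{1,∞}`. -/
def SpectralTriple.IsSummable (S : SpectralTriple H) (p : ℝ) : Prop :=
  MemWeakL1 (S.bessel p)

/-- Theta convergence: for every `T ∈ 𝒜`, the limit of `t^p Tr(T e^{-(tD)^2})` as `t → 0+` exists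
in `ℂ`. -/
def SpectralTriple.ThetaConverges (S : SpectralTriple H) (p : ℝ) : Prop :=
  ∀ T ∈ S.algebra, ∃ c : ℂ,
    Filter.Tendsto (fun t : ℝ => ((t ^ p : ℝ) : ℂ) * opTrace (T * S.heat t)) (𝓝[>] 0) (𝓝 c)

end SpectralTriples

/-! ### Hilbert space tensor products -/

section Tensor

variable {H₁ H₂ : Type*} [NormedAddCommGroup H₁] [InnerProductSpace ℂ H₁]
  [NormedAddCommGroup H₂] [InnerProductSpace ℂ H₂]

variable (H₁ H₂) in
/-- The Hilbert space tensor product of `H₁` and `H₂`. -/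
abbrev HTensor : Type _ := UniformSpace.Completion (H₁ ⊗[ℂ] H₂)

/-- The elementary tensor `x ⊗ y` in the Hilbert space tensor product. -/
def htmul (x : H₁) (y : H₂) : HTensor H₁ H₂ := ((x ⊗ₜ[ℂ] y : H₁ ⊗[ℂ] H₂) : HTensor H₁ H₂)

/-- The bounded operator `T₁ ⊗ T₂` on the Hilbert space tensor product. -/
def opTensor (T₁ : H₁ →L[ℂ] H₁) (T₂ : H₂ →L[ℂ] H₂) : HTensor H₁ H₂ →L[ℂ] HTensor H₁ H₂ :=
  (TensorProduct.mapL T₁ T₂).completion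

/-- The unbounded operator `D₁² ⊗ 1 + 1 ⊗ D₂²`: the closure of the operator that is given by
`x₁ ⊗ x₂ ↦ D₁² x₁ ⊗ x₂ + x₁ ⊗ D₂² x₂` on the span of all `x₁ ⊗ x₂` with `x₁` in the domain of `D₁²`
and `x₂` in the domain of `D₂²`. -/
def sqTensorSum (D₁ : H₁ →ₗ.[ℂ] H₁) (D₂ : H₂ →ₗ.[ℂ] H₂) : HTensor H₁ H₂ →ₗ.[ℂ] HTensor H₁ H₂ :=
  (Submodule.span ℂ {q : HTensor H₁ H₂ × HTensor H₁ H₂ | ∃ x₁ y₁ z₁ : H₁, ∃ x₂ y₂ z₂ : H₂,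
      (x₁, y₁) ∈ D₁.graph ∧ (y₁, z₁) ∈ D₁.graph ∧ (x₂, y₂) ∈ D₂.graph ∧ (y₂, z₂) ∈ D₂.graph ∧
      q = (htmul x₁ x₂, htmul z₁ x₂ + htmul x₁ z₂)}).topologicalClosure.toLinearPMap

/-- The operator `(1 + D₁² ⊗ 1 + 1 ⊗ D₂²)^{-p/2}`. -/
def prodBessel (D₁ : H₁ →ₗ.[ℂ] H₁) (D₂ : H₂ →ₗ.[ℂ] H₂) (p : ℝ) :
    HTensor H₁ H₂ →L[ℂ] HTensor H₁ H₂ :=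
  funCalc (sqTensorSum D₁ D₂) fun r => (1 + r) ^ (-p / 2)

end Tensor

/-! ### States on `L_∞(0, ∞)` and Dixmier traces -/

section States

/-- Lebesgue measure on `(0, ∞)`. -/
abbrev halfLine : MeasureTheory.Measure ℝ := MeasureTheory.volume.restrict (Set.Ioi 0)

/-- A state on the algebra `L_∞(0, ∞)`: a positive linear functional `ω` with `ω(1) = 1`. -/
structure LinftyState where
  toLinearMap : MeasureTheory.Lp ℂ ∞ halfLine →ₗ[ℂ] ℂ
  nonneg : ∀ f : MeasureTheory.Lp ℂ ∞ halfLine,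
    (∀ᵐ t ∂halfLine, 0 ≤ (f t).re ∧ (f t).im = 0) →
      0 ≤ (toLinearMap f).re ∧ (toLinearMap f).im = 0
  map_one : toLinearMap ((MeasureTheory.memLp_top_const (1 : ℂ)).toLp _) = 1

/-- The value `ω(x)` of a state at (the class of) an essentially bounded function `x`; it is set to
`0` at the functions that do not represent an element of `L_∞(0, ∞)`. -/
def LinftyState.eval (ω : LinftyState) (x : ℝ → ℂ) : ℂ :=
  open Classical in
  if h : MeasureTheory.MemLp x ∞ halfLine then ω.toLinearMap (h.toLp x) else 0

/-- `(M x)(t) = (1 / log t) ∫_1^t x(s) ds / s`. -/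
def logMean (x : ℝ → ℂ) (t : ℝ) : ℂ :=
  (1 / (Real.log t : ℂ)) * ∫ s in (1 : ℝ)..t, x s / (s : ℂ)

/-- `ω = ω ∘ M`. -/
def LinftyState.IsMeanInvariant (ω : LinftyState) : Prop :=
  ∀ x : ℝ → ℂ, MeasureTheory.MemLp x ∞ halfLine → ω.eval (logMean x) = ω.eval x

/-- `ω = ω ∘ P_u` for all `u > 0`, where `(P_u x)(t) = x(t^u)`. -/
def LinftyState.IsPowerInvariant (ω : LinftyState) : Prop :=
  ∀ u : ℝ, 0 < u → ∀ x : ℝ → ℂ, MeasureTheory.MemLp x ∞ halfLine →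
    ω.eval (fun t => x (t ^ u)) = ω.eval x

/-- `ω` is a limiting process at infinity: it vanishes on the functions that tend to `0` at `∞`. -/
def LinftyState.IsLimitAtInfinity (ω : LinftyState) : Prop :=
  ∀ x : ℝ → ℂ, MeasureTheory.MemLp x ∞ halfLine → Filter.Tendsto x Filter.atTop (𝓝 0) →
    ω.eval x = 0

variable {H : Type*} [NormedAddCommGroup H] [InnerProductSpace ℂ H]

/-- The function `t ↦ (1 / log (1 + t)) ∫_0^t μ(s, A) ds`, where `μ(s, A) = μ(k, A)` for
`k ≤ s < k + 1`. -/
def dixmierMean (A : H →L[ℂ] H) (t : ℝ) : ℝ :=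
  (1 / Real.log (1 + t)) * ∫ s in (0 : ℝ)..t, singularValue ⌊s⌋₊ A

/-- `Tr_ω` on the positive cone of `L_{1,∞}`. -/
def dixmierPos (ω : LinftyState) (A : H →L[ℂ] H) : ℂ :=
  ω.eval fun t => (dixmierMean A t : ℂ)

/-- `Tr_ω` on `L_{1,∞}`: the linear extension from the positive cone, through the decomposition
`A = (Re A)₊ - (Re A)₋ + i ((Im A)₊ - (Im A)₋)`. -/
def dixmierTrace [CompleteSpace H] (ω : LinftyState) (A : H →L[ℂ] H) : ℂ :=
  (dixmierPos ω (realPart A : H →L[ℂ] H)⁺ - dixmierPos ω (realPart A : H →L[ℂ] H)⁻) +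
    Complex.I *
      (dixmierPos ω (imaginaryPart A : H →L[ℂ] H)⁺ - dixmierPos ω (imaginaryPart A : H →L[ℂ] H)⁻)

end States

end

end NCFubini

/-!
Write `V` for a positive operator in `L_{1,∞}` with eigenbasis `b i` and eigenvalues `v i`, such as
`(1 + D²)^(-p/2)`, and let `T` be bounded. The proof rests on the heat kernel formula
`dixmierTrace_eq_eval_heatSum`: with `F(t) = t⁻¹ Tr(T exp(-(t V)^(-q)))` (`heatSum`) one has
`Γ(1 + 1/q) Tr_ω(T V) = ω(F)` for every `M`-invariant limiting process `ω`. It combines two facts.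

* The functions on which `ω` is evaluated to give `Tr_ω(T V)` are, up to `O(1)` before the division
  by `log (1 + t)`, the real and imaginary parts of the partial traces
  `∑_{v i > 1/t} v i ⟪b i, T b i⟫` (`exists_abs_integral_realPart_sub_le`). The linearity of `Tr_ω`
  is not needed for this. Up to a bounded error, the integrals over `[0, t]` of the singular values
  of the positive and of the negative part of `Re (T V)` differ by the trace of the compression of
  `Re (T V)` to the span of its eigenvectors with eigenvalue above `1/t` in modulus. Both this span
  and that of the `b i` with `v i > 1/t` have dimension `O(t)`, and on their orthogonal complements
  `Re (T V)`, respectively `T V`, has norm `O(1/t)`. Each compression can therefore be enlarged to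
  the sum of the two spans at the cost of a bounded error (`norm_compressionTrace_sub_le`).
* The logarithmic mean `M F` is `Γ(1 + 1/q)` times the same partial traces divided by `log t`, again
  up to `O(1 / log t)` (`exists_norm_integral_heatSum_sub_le`); it follows, term by term, from the
  formula `∫ exp(-r^(-q)) dr / r² = Γ(1 + 1/q)` and the bound `O(s)` on the number of `v i` above
  `1/s`.

For `q = 2/p` and `V = (1 + D²)^(-p/2)`, the operator `exp(-(t V)^(-q))` is `exp(-τ (1 + D²))` with
`τ = t^(-2/p)`. Products of eigenvectors of `D₁` and `D₂` are an eigenbasis for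
`D₁² ⊗ 1 + 1 ⊗ D₂²` (`sqTensorSum_eigenbasis`), so that the exponentials multiply: the heat sum of
the product triple at `t` is `exp(τ) F₁(t^(p₁/(p₁+p₂))) F₂(t^(p₂/(p₁+p₂)))` (`heatSum_prod`), and
`exp(τ) → 1`. Theta convergence of one factor means that its `F` converges at infinity. Then
`ω` is multiplicative on this product, and its invariance under the `P_u` removes the powers of `t`
(`LinftyState.eval_prod_of_tendsto`).
-/

namespace NCFubini

noncomputable section

/-! ### Singular values -/

section SingularValues

variable {H : Type*} [NormedAddCommGroup H] [InnerProductSpace ℂ H]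

theorem singularValue_le_norm_sub {k : ℕ} {T F : H →L[ℂ] H}
    (hF : LinearMap.rank (F : H →ₗ[ℂ] H) ≤ (k : Cardinal)) : singularValue k T ≤ ‖T - F‖ :=
  csInf_le ⟨0, by rintro d ⟨F, -, rfl⟩; exact norm_nonneg _⟩ ⟨F, hF, rfl⟩

theorem singularValue_set_nonempty (k : ℕ) (T : H →L[ℂ] H) :
    {d : ℝ | ∃ F : H →L[ℂ] H, LinearMap.rank (F : H →ₗ[ℂ] H) ≤ (k : Cardinal) ∧
      d = ‖T - F‖}.Nonempty :=
  ⟨_, 0, by simp [LinearMap.rank_zero], rfl⟩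

theorem exists_rank_le_of_singularValue_lt {k : ℕ} {T : H →L[ℂ] H} {d : ℝ}
    (h : singularValue k T < d) :
    ∃ F : H →L[ℂ] H, LinearMap.rank (F : H →ₗ[ℂ] H) ≤ (k : Cardinal) ∧ ‖T - F‖ < d := by
  obtain ⟨_, ⟨F, hF, rfl⟩, hd⟩ := exists_lt_of_csInf_lt (singularValue_set_nonempty k T) h
  exact ⟨F, hF, hd⟩

theorem le_singularValue {k : ℕ} {T : H →L[ℂ] H} {d : ℝ}
    (h : ∀ F : H →L[ℂ] H, LinearMap.rank (F : H →ₗ[ℂ] H) ≤ (k : Cardinal) → d ≤ ‖T - F‖) :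
    d ≤ singularValue k T :=
  le_csInf (singularValue_set_nonempty k T) (by rintro _ ⟨F, hF, rfl⟩; exact h F hF)

theorem singularValue_nonneg (k : ℕ) (T : H →L[ℂ] H) : 0 ≤ singularValue k T :=
  le_singularValue fun _ _ => norm_nonneg _

theorem singularValue_antitone (T : H →L[ℂ] H) : Antitone fun k => singularValue k T := by
  intro k l hkl
  refine le_singularValue fun F hF => singularValue_le_norm_sub (hF.trans ?_)
  exact_mod_cast hkl

theorem singularValue_add_le (k l : ℕ) (A B : H →L[ℂ] H) :
    singularValue (k + l) (A + B) ≤ singularValue k A + singularValue l B := by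
  refine le_of_forall_pos_le_add fun ε hε => ?_
  obtain ⟨F, hF, hF'⟩ := exists_rank_le_of_singularValue_lt
    (show singularValue k A < singularValue k A + ε / 2 by linarith)
  obtain ⟨G, hG, hG'⟩ := exists_rank_le_of_singularValue_lt
    (show singularValue l B < singularValue l B + ε / 2 by linarith)
  have h1 : singularValue (k + l) (A + B) ≤ ‖(A + B) - (F + G)‖ := by
    apply singularValue_le_norm_sub
    push_cast
    exact (LinearMap.rank_add_le _ _).trans (add_le_add hF hG)
  have h2 : ‖(A + B) - (F + G)‖ ≤ ‖A - F‖ + ‖B - G‖ := by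
    rw [add_sub_add_comm]; exact norm_add_le _ _
  linarith

theorem singularValue_mul_le_left (k : ℕ) (T A : H →L[ℂ] H) :
    singularValue k (T * A) ≤ ‖T‖ * singularValue k A := by
  refine le_of_forall_pos_le_add fun ε hε => ?_
  obtain ⟨F, hF, hF'⟩ := exists_rank_le_of_singularValue_lt
    (show singularValue k A < singularValue k A + ε / (‖T‖ + 1) by
      have := norm_nonneg T
      have : 0 < ε / (‖T‖ + 1) := by positivity
      linarith)
  have h1 : singularValue k (T * A) ≤ ‖T * A - T * F‖ := by
    apply singularValue_le_norm_sub
    have := LinearMap.lift_rank_comp_le_right (F : H →ₗ[ℂ] H) (T : H →ₗ[ℂ] H)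
    simp only [Cardinal.lift_id] at this
    exact le_trans this hF
  rw [← mul_sub] at h1
  have h2 : ‖T‖ * ‖A - F‖ ≤ ‖T‖ * (singularValue k A + ε / (‖T‖ + 1)) := by gcongr
  have h3 : ‖T‖ * (ε / (‖T‖ + 1)) ≤ ε := by
    rw [mul_div_assoc', div_le_iff₀ (by have := norm_nonneg T; positivity)]
    nlinarith
  linarith [norm_mul_le T (A - F)]

theorem singularValue_mul_le_right (k : ℕ) (A T : H →L[ℂ] H) :
    singularValue k (A * T) ≤ ‖T‖ * singularValue k A := by
  refine le_of_forall_pos_le_add fun ε hε => ?_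
  obtain ⟨F, hF, hF'⟩ := exists_rank_le_of_singularValue_lt
    (show singularValue k A < singularValue k A + ε / (‖T‖ + 1) by
      have := norm_nonneg T
      have : 0 < ε / (‖T‖ + 1) := by positivity
      linarith)
  have h1 : singularValue k (A * T) ≤ ‖A * T - F * T‖ := by
    apply singularValue_le_norm_sub
    exact le_trans (LinearMap.rank_comp_le_left (T : H →ₗ[ℂ] H) (F : H →ₗ[ℂ] H)) hF
  rw [← sub_mul] at h1
  have h2 : ‖T‖ * ‖A - F‖ ≤ ‖T‖ * (singularValue k A + ε / (‖T‖ + 1)) := by gcongr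
  have h3 : ‖T‖ * (ε / (‖T‖ + 1)) ≤ ε := by
    rw [mul_div_assoc', div_le_iff₀ (by have := norm_nonneg T; positivity)]
    nlinarith
  linarith [norm_mul_le (A - F) T]

theorem MemWeakL1.mul_left {A : H →L[ℂ] H} (hA : MemWeakL1 A) (T : H →L[ℂ] H) :
    MemWeakL1 (T * A) := by
  obtain ⟨C, hC⟩ := hA
  refine ⟨‖T‖ * C, fun k => (singularValue_mul_le_left k T A).trans ?_⟩
  rw [mul_div_assoc]
  exact mul_le_mul_of_nonneg_left (hC k) (norm_nonneg _)

theorem MemWeakL1.mul_right {A : H →L[ℂ] H} (hA : MemWeakL1 A) (T : H →L[ℂ] H) :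
    MemWeakL1 (A * T) := by
  obtain ⟨C, hC⟩ := hA
  refine ⟨‖T‖ * C, fun k => (singularValue_mul_le_right k A T).trans ?_⟩
  rw [mul_div_assoc]
  exact mul_le_mul_of_nonneg_left (hC k) (norm_nonneg _)

theorem MemWeakL1.add {A B : H →L[ℂ] H} (hA : MemWeakL1 A) (hB : MemWeakL1 B) :
    MemWeakL1 (A + B) := by
  obtain ⟨C, hC⟩ := hA
  obtain ⟨C', hC'⟩ := hB
  have key : ∀ k, singularValue k (A + B) ≤ (C + C') / ((k / 2 : ℕ) + 1 : ℝ) := fun k => by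
    calc singularValue k (A + B) ≤ singularValue (k / 2 + k / 2) (A + B) :=
          singularValue_antitone _ (by lia)
      _ ≤ _ := singularValue_add_le _ _ _ _
      _ ≤ _ := by rw [add_div]; exact add_le_add (hC _) (hC' _)
  have h0 : 0 ≤ C + C' := by
    have := (singularValue_nonneg 0 (A + B)).trans (key 0)
    simpa using this
  refine ⟨2 * (C + C'), fun k => (key k).trans ?_⟩
  have h1 : (k : ℝ) + 1 ≤ 2 * ((k / 2 : ℕ) + 1 : ℝ) := by
    have : k + 1 ≤ 2 * (k / 2 + 1) := by lia
    exact_mod_cast this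
  rw [div_le_div_iff₀ (by positivity) (by positivity)]
  nlinarith

/-- If more than `k` orthonormal eigenvectors of `T` have eigenvalues of modulus at least `s`, then
`μ(k, T) ≥ s`: an operator of rank at most `k` annihilates a nonzero vector of their span. -/
theorem le_singularValue_of_orthonormal {κ : Type*} [Fintype κ] {k : ℕ} {T : H →L[ℂ] H}
    {g : κ → H} (hg : Orthonormal ℂ g) (hk : k < Fintype.card κ) {α : κ → ℂ}
    (hT : ∀ i, T (g i) = α i • g i) {s : ℝ} (hs : 0 ≤ s) (hα : ∀ i, s ≤ ‖α i‖) :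
    s ≤ singularValue k T := by
  refine le_singularValue fun F hF => ?_
  have hfin : Module.Finite ℂ (LinearMap.range (F : H →ₗ[ℂ] H)) :=
    Module.rank_lt_aleph0_iff.1 (hF.trans_lt (Cardinal.natCast_lt_aleph0))
  have hrank : Module.finrank ℂ (LinearMap.range (F : H →ₗ[ℂ] H)) ≤ k :=
    Module.finrank_le_of_rank_le hF
  let L : (κ → ℂ) →ₗ[ℂ] LinearMap.range (F : H →ₗ[ℂ] H) :=
    (LinearMap.rangeRestrict (F : H →ₗ[ℂ] H)).comp (Fintype.linearCombination ℂ g)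
  have hker : LinearMap.ker L ≠ ⊥ := by
    apply LinearMap.ker_ne_bot_of_finrank_lt
    rw [Module.finrank_fintype_fun_eq_card]
    lia
  obtain ⟨c, hc, hc0⟩ := Submodule.exists_mem_ne_zero_of_ne_bot hker
  set x := ∑ i, c i • g i with hx
  have hFx : F x = 0 := by
    have : ((L c : LinearMap.range (F : H →ₗ[ℂ] H)) : H) = 0 := by
      rw [LinearMap.mem_ker.1 hc]; rfl
    simpa [L, Fintype.linearCombination_apply, hx] using this
  have hnorm : ∀ d : κ → ℂ, ‖∑ i, d i • g i‖ ^ 2 = ∑ i, ‖d i‖ ^ 2 := by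
    intro d
    have := hg.inner_sum d d Finset.univ
    rw [inner_self_eq_norm_sq_to_K] at this
    have h2 : ((‖∑ i, d i • g i‖ ^ 2 : ℝ) : ℂ) = ((∑ i, ‖d i‖ ^ 2 : ℝ) : ℂ) := by
      push_cast
      refine this.trans (Finset.sum_congr rfl fun i _ => ?_)
      rw [mul_comm, Complex.mul_conj, Complex.normSq_eq_norm_sq]; push_cast; rfl
    exact_mod_cast h2
  have hx0 : 0 < ‖x‖ := by
    have h1 : 0 < ‖x‖ ^ 2 := by
      rw [hnorm]
      obtain ⟨i, hi⟩ := Function.ne_iff.1 hc0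
      refine Finset.sum_pos' (fun _ _ => sq_nonneg _) ⟨i, Finset.mem_univ _, ?_⟩
      have : 0 < ‖c i‖ := norm_pos_iff.2 hi
      positivity
    exact lt_of_le_of_ne (norm_nonneg x) fun h => by simp [← h] at h1
  have hTx : T x = ∑ i, (c i * α i) • g i := by
    rw [hx, map_sum]
    exact Finset.sum_congr rfl fun i _ => by rw [map_smul, hT, smul_smul]
  have h1 : s * ‖x‖ ≤ ‖T x‖ := by
    refine le_of_sq_le_sq ?_ (norm_nonneg _)
    rw [hTx, mul_pow, hnorm, hnorm, Finset.mul_sum]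
    refine Finset.sum_le_sum fun i _ => ?_
    rw [norm_mul, mul_pow, mul_comm]
    gcongr
    exact hα i
  have h2 : ‖T x‖ ≤ ‖T - F‖ * ‖x‖ := by
    have := (T - F).le_opNorm x
    rwa [sub_apply, hFx, sub_zero] at this
  exact le_of_mul_le_mul_right (h1.trans h2) hx0

end SingularValues

/-! ### Diagonal operators and weak `ℓ₁` families of eigenvalues -/

section Diagonal

variable {H : Type*} [NormedAddCommGroup H] [InnerProductSpace ℂ H]
variable {ι : Type*}

theorem inner_diagonal_apply (b : HilbertBasis ι ℂ H) {A : H →L[ℂ] H} {α : ι → ℂ}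
    (hA : ∀ i, A (b i) = α i • b i) (i : ι) (x : H) : ⟪b i, A x⟫_ℂ = α i * ⟪b i, x⟫_ℂ := by
  have h : (innerSL ℂ (b i)).comp A = α i • innerSL ℂ (b i) := by
    refine ContinuousLinearMap.ext_on
      (Submodule.dense_iff_topologicalClosure_eq_top.2 b.dense_span) ?_
    rintro _ ⟨j, rfl⟩
    classical
    have := orthonormal_iff_ite.1 b.orthonormal i j
    simp only [ContinuousLinearMap.comp_apply, hA, map_smul, innerSL_apply_apply, this,
      smul_apply, smul_eq_mul]
    by_cases hij : i = j
    · subst hij; simp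
    · simp [hij]
  exact congrArg (fun f => f x) h

theorem hasSum_norm_inner_sq (b : HilbertBasis ι ℂ H) (x : H) :
    HasSum (fun i => ‖⟪b i, x⟫_ℂ‖ ^ 2) (‖x‖ ^ 2) := by
  have h := b.hasSum_inner_mul_inner x x
  have h2 := Complex.hasSum_re h
  have h3 : (⟪x, x⟫_ℂ).re = ‖x‖ ^ 2 := inner_self_eq_norm_sq (𝕜 := ℂ) x
  rw [h3] at h2
  refine h2.congr_fun fun i => ?_
  rw [← inner_conj_symm x (b i), mul_comm, Complex.mul_conj, Complex.normSq_eq_norm_sq,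
    Complex.ofReal_re]

theorem norm_diagonal_apply_le (b : HilbertBasis ι ℂ H) {A : H →L[ℂ] H} {α : ι → ℂ}
    (hA : ∀ i, A (b i) = α i • b i) {s : ℝ} (hs : 0 ≤ s) {x : H}
    (hx : ∀ i, ‖α i‖ ≤ s ∨ ⟪b i, x⟫_ℂ = 0) : ‖A x‖ ≤ s * ‖x‖ := by
  refine le_of_sq_le_sq ?_ (by positivity)
  rw [mul_pow]
  refine hasSum_le (fun i => ?_) (hasSum_norm_inner_sq b (A x))
    ((hasSum_norm_inner_sq b x).mul_left (s ^ 2))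
  rw [inner_diagonal_apply b hA, norm_mul, mul_pow]
  rcases hx i with h | h
  · gcongr
  · simp [h]

theorem rank_finset_sum_le {κ : Type*} (J : Finset κ) (f : κ → H →L[ℂ] H)
    (hf : ∀ i, LinearMap.rank (f i : H →ₗ[ℂ] H) ≤ 1) :
    LinearMap.rank ((∑ i ∈ J, f i : H →L[ℂ] H) : H →ₗ[ℂ] H) ≤ (J.card : Cardinal) := by
  classical
  induction J using Finset.induction_on with
  | empty => simp [LinearMap.rank_zero]
  | insert a J ha ih =>
    rw [Finset.sum_insert ha, Finset.card_insert_of_notMem ha, add_comm (f a)]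
    rw [Nat.cast_add, Nat.cast_one]
    exact (LinearMap.rank_add_le _ _).trans (add_le_add ih (hf a))

/-- A diagonal operator whose eigenvalues outside a set of `k` indices are at most `s` has
`μ(k, A) ≤ s`. -/
theorem singularValue_diagonal_le (b : HilbertBasis ι ℂ H) {A : H →L[ℂ] H} {α : ι → ℂ}
    (hA : ∀ i, A (b i) = α i • b i) {s : ℝ} (hs : 0 ≤ s) {J : Finset ι} {k : ℕ} (hJ : J.card ≤ k)
    (hα : ∀ i ∉ J, ‖α i‖ ≤ s) : singularValue k A ≤ s := by
  classical
  let f : ι → H →L[ℂ] H := fun i => (innerSL ℂ (b i)).smulRight (α i • b i)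
  have hf : ∀ i, LinearMap.rank (f i : H →ₗ[ℂ] H) ≤ 1 := by
    intro i
    refine (Submodule.rank_mono (t := ℂ ∙ (α i • b i)) ?_).trans (rank_span_le _ |>.trans ?_)
    · rintro _ ⟨x, rfl⟩
      exact Submodule.smul_mem _ _ (Submodule.mem_span_singleton_self _)
    · simp
  have hrank := rank_finset_sum_le J f hf
  refine (singularValue_le_norm_sub (hrank.trans (by exact_mod_cast hJ))).trans ?_
  refine ContinuousLinearMap.opNorm_le_bound _ hs fun x => ?_
  refine norm_diagonal_apply_le b (α := fun i => if i ∈ J then 0 else α i) (fun i => ?_) hs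
    fun i => Or.inl ?_
  · have : ∀ j, f j (b i) = if j = i then α i • b i else 0 := by
      intro j
      have := orthonormal_iff_ite.1 b.orthonormal j i
      simp only [f, ContinuousLinearMap.smulRight_apply, innerSL_apply_apply, this]
      by_cases hij : j = i
      · subst hij; simp
      · simp [hij]
    rw [sub_apply, sum_apply, hA,
      Finset.sum_congr rfl fun j _ => this j, Finset.sum_ite_eq']
    by_cases hi : i ∈ J <;> simp [hi]
  · by_cases hi : i ∈ J
    · simpa [hi] using hs
    · simpa [hi] using hα i hi

/-- The family `v` of real numbers lies in weak `ℓ₁`: for every `s > 0`, at most `C / s` of its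
members exceed `s`. Counting keeps the index set free of an enumeration in decreasing order. -/
def WeakCount (v : ι → ℝ) (C : ℝ) : Prop :=
  ∀ s : ℝ, 0 < s → ∀ J : Finset ι, (∀ i ∈ J, s < v i) → (J.card : ℝ) ≤ C / s

theorem WeakCount.nonneg {v : ι → ℝ} {C : ℝ} (h : WeakCount v C) : 0 ≤ C := by
  simpa using h 1 one_pos ∅ (by simp)

theorem WeakCount.finite {v : ι → ℝ} {C : ℝ} (h : WeakCount v C) {s : ℝ} (hs : 0 < s) :
    {i | s < v i}.Finite := by
  by_contra hinf
  obtain ⟨J, hJ, hc⟩ := Set.Infinite.exists_subset_card_eq hinf (⌊C / s⌋₊ + 1)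
  have := h s hs J fun i hi => hJ hi
  rw [hc] at this
  push_cast at this
  linarith [Nat.lt_floor_add_one (C / s)]

/-- The finite set of indices with `v i > s`. -/
def WeakCount.big {v : ι → ℝ} {C : ℝ} (h : WeakCount v C) {s : ℝ} (hs : 0 < s) : Finset ι :=
  (h.finite hs).toFinset

theorem WeakCount.mem_big {v : ι → ℝ} {C : ℝ} (h : WeakCount v C) {s : ℝ} (hs : 0 < s) {i : ι} :
    i ∈ h.big hs ↔ s < v i := by
  simp [WeakCount.big]

theorem WeakCount.card_big_le {v : ι → ℝ} {C : ℝ} (h : WeakCount v C) {s : ℝ} (hs : 0 < s) :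
    ((h.big hs).card : ℝ) ≤ C / s :=
  h s hs _ fun _ hi => (h.mem_big hs).1 hi

theorem WeakCount.mono {v w : ι → ℝ} {C : ℝ} (h : WeakCount v C) (hw : ∀ i, w i ≤ v i) :
    WeakCount w C :=
  fun s hs J hJ => h s hs J fun i hi => (hJ i hi).trans_le (hw i)

theorem weakCount_of_memWeakL1 {b : ι → H} (hb : Orthonormal ℂ b) {A : H →L[ℂ] H} {α : ι → ℂ}
    (hA : ∀ i, A (b i) = α i • b i) (h : MemWeakL1 A) : ∃ C, WeakCount (fun i => ‖α i‖) C := by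
  obtain ⟨C, hC⟩ := h
  refine ⟨C, fun s hs J hJ => ?_⟩
  have h0 : 0 ≤ C := by simpa using (singularValue_nonneg 0 A).trans (hC 0)
  rcases Nat.eq_zero_or_pos J.card with h1 | h1
  · rw [h1]; simp only [Nat.cast_zero]; positivity
  have h2 : s ≤ singularValue (J.card - 1) A :=
    le_singularValue_of_orthonormal (κ := J) (g := fun i => b i) (α := fun i => α i)
      (hb.comp _ Subtype.val_injective) (by rw [Fintype.card_coe]; lia) (fun i => hA i) hs.le
      (fun i => (hJ i i.2).le)
  have h3 := h2.trans (hC _)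
  rw [Nat.cast_sub h1, Nat.cast_one, sub_add_cancel, le_div_iff₀ (by exact_mod_cast h1)] at h3
  rw [le_div_iff₀ hs]
  linarith

/-- If `k + 1` eigenvalues exceeded `2 (C + 1) / (k + 1)`, this would contradict the count. -/
theorem WeakCount.singularValue_le (b : HilbertBasis ι ℂ H) {A : H →L[ℂ] H} {α : ι → ℂ}
    (hA : ∀ i, A (b i) = α i • b i) {C : ℝ} (h : WeakCount (fun i => ‖α i‖) C) (k : ℕ) :
    singularValue k A ≤ (2 * (C + 1)) / (k + 1) := by
  have hC := h.nonneg
  have hs : (0 : ℝ) < 2 * (C + 1) / (k + 1) := by positivity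
  refine singularValue_diagonal_le b hA hs.le (J := h.big hs) ?_ fun i hi => ?_
  · have h1 := h.card_big_le hs
    have h2 : C / (2 * (C + 1) / (k + 1)) < k + 1 := by
      rw [div_lt_iff₀ hs, mul_div_cancel₀ _ (by positivity)]
      linarith
    have h3 : ((h.big hs).card : ℝ) < k + 1 := h1.trans_lt h2
    exact Nat.lt_succ_iff.1 (by exact_mod_cast h3)
  · exact not_lt.1 fun h' => hi ((h.mem_big hs).2 h')

theorem WeakCount.memWeakL1 (b : HilbertBasis ι ℂ H) {A : H →L[ℂ] H} {α : ι → ℂ}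
    (hA : ∀ i, A (b i) = α i • b i) {C : ℝ} (h : WeakCount (fun i => ‖α i‖) C) : MemWeakL1 A :=
  ⟨_, h.singularValue_le b hA⟩

theorem isCompactOperator_of_rank_le {F : H →L[ℂ] H} {k : ℕ}
    (hF : LinearMap.rank (F : H →ₗ[ℂ] H) ≤ (k : Cardinal)) : IsCompactOperator F := by
  have hfin : Module.Finite ℂ (LinearMap.range (F : H →ₗ[ℂ] H)) :=
    Module.rank_lt_aleph0_iff.1 (hF.trans_lt (Cardinal.natCast_lt_aleph0))
  have : FiniteDimensional ℂ (LinearMap.range (F : H →ₗ[ℂ] H)) := hfin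
  have h1 : IsCompactOperator (_root_.id : LinearMap.range (F : H →ₗ[ℂ] H) → _) :=
    (isCompactOperator_id_iff_finiteDimensional (𝕜 := ℂ)).2 this
  have h2 := h1.comp_clm (F.codRestrict _ fun x => LinearMap.mem_range_self _ x)
  exact h2.clm_comp (LinearMap.range (F : H →ₗ[ℂ] H)).subtypeL

theorem MemWeakL1.isCompactOperator [CompleteSpace H] {A : H →L[ℂ] H} (h : MemWeakL1 A) :
    IsCompactOperator A := by
  obtain ⟨C, hC⟩ := h
  have hlt : ∀ k : ℕ, singularValue k A < (C + 1) / ((k : ℝ) + 1) := fun k => by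
    refine (hC k).trans_lt ?_
    gcongr
    linarith
  choose F hF hF' using fun k => exists_rank_le_of_singularValue_lt (hlt k)
  refine isCompactOperator_of_tendsto (l := Filter.atTop) (F := F) ?_
    (Filter.Eventually.of_forall fun k => isCompactOperator_of_rank_le (hF k))
  rw [tendsto_iff_norm_sub_tendsto_zero]
  have h0 : Filter.Tendsto (fun k : ℕ => (C + 1) / ((k : ℝ) + 1)) Filter.atTop (𝓝 0) :=
    tendsto_const_div_atTop_nhds_zero_nat (C + 1) |>.comp (Filter.tendsto_add_atTop_nat 1)
      |>.congr fun k => by simp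
  refine squeeze_zero (fun _ => norm_nonneg _) (fun k => ?_) h0
  rw [norm_sub_rev]
  exact (hF' k).le

end Diagonal

/-! ### Eigenbases of compact operators, positive and negative parts -/

section EigenBasis

variable {H : Type*} [NormedAddCommGroup H] [InnerProductSpace ℂ H]

/-- Orthonormal bases of the members of a complete orthogonal family of closed subspaces combine to
an orthonormal basis of the whole space. -/
theorem exists_hilbertBasis_mem [CompleteSpace H] {κ : Type*} (V : κ → Submodule ℂ H)
    [∀ k, CompleteSpace (V k)]
    (hV : OrthogonalFamily ℂ (fun k => V k) fun k => (V k).subtypeₗᵢ) (h : (⨆ k, V k)ᗮ = ⊥) :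
    ∃ (w : ∀ k, Set (V k)) (b : HilbertBasis (Σ k, w k) ℂ H), ∀ i, b i ∈ V i.1 := by
  choose w e he using fun k => exists_hilbertBasis ℂ (V k)
  let f : (Σ k, w k) → H := fun i => (V i.1).subtypeₗᵢ (e i.1 i.2)
  have hf : Orthonormal ℂ f := hV.orthonormal_sigma_orthonormal fun k => (e k).orthonormal
  have hsp : (Submodule.span ℂ (Set.range f))ᗮ = ⊥ := by
    rw [eq_bot_iff, ← h]
    intro x hx
    rw [Submodule.mem_orthogonal'] at hx ⊢
    have key : ∀ k, (innerSL ℂ x).comp (V k).subtypeL = 0 := fun k => by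
      refine ContinuousLinearMap.ext_on
        (Submodule.dense_iff_topologicalClosure_eq_top.2 (e k).dense_span) ?_
      rintro _ ⟨i, rfl⟩
      exact hx _ (Submodule.subset_span ⟨⟨k, i⟩, rfl⟩)
    intro y hy
    have hle : (⨆ k, V k) ≤ LinearMap.ker (innerSL ℂ x : H →ₗ[ℂ] ℂ) :=
      iSup_le fun k z hz => LinearMap.mem_ker.2 (congrArg (fun φ => φ ⟨z, hz⟩) (key k))
    exact hle hy
  exact ⟨w, HilbertBasis.mkOfOrthogonalEqBot hf hsp, fun i => by
    rw [HilbertBasis.coe_mkOfOrthogonalEqBot]; exact (e i.1 i.2).2⟩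

variable [CompleteSpace H]

theorem isSelfAdjoint_of_diagonal {ι : Type*} (b : HilbertBasis ι ℂ H) {A : H →L[ℂ] H} {α : ι → ℝ}
    (hA : ∀ i, A (b i) = (α i : ℂ) • b i) : IsSelfAdjoint A := by
  rw [ContinuousLinearMap.isSelfAdjoint_iff_isSymmetric]
  intro x y
  simp only [ContinuousLinearMap.coe_coe]
  rw [← b.tsum_inner_mul_inner, ← b.tsum_inner_mul_inner x]
  refine tsum_congr fun i => ?_
  rw [inner_diagonal_apply b hA, ← inner_conj_symm, inner_diagonal_apply b hA, map_mul,
    inner_conj_symm, Complex.conj_ofReal]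
  ring

/-- A self-adjoint operator in `L_{1,∞}` has an orthonormal eigenbasis. -/
theorem exists_eigenbasis_of_memWeakL1 {A : H →L[ℂ] H} (hA : IsSelfAdjoint A) (h : MemWeakL1 A) :
    ∃ (w : ∀ μ : ℂ, Set (Module.End.eigenspace (A : H →ₗ[ℂ] H) μ))
      (g : HilbertBasis (Σ μ, w μ) ℂ H) (α : (Σ μ, w μ) → ℝ), ∀ j, A (g j) = (α j : ℂ) • g j := by
  have hsym := ContinuousLinearMap.isSelfAdjoint_iff_isSymmetric.1 hA
  have hcl : ∀ μ : ℂ, IsClosed (Module.End.eigenspace (A : H →ₗ[ℂ] H) μ : Set H) := by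
    intro μ
    have : (Module.End.eigenspace (A : H →ₗ[ℂ] H) μ : Set H) = {x | A x = μ • x} := by
      ext x; simp
    rw [this]
    exact isClosed_eq A.continuous (continuous_const_smul μ)
  have : ∀ μ : ℂ, CompleteSpace (Module.End.eigenspace (A : H →ₗ[ℂ] H) μ) := fun μ =>
    (hcl μ).completeSpace_coe
  obtain ⟨w, g, hg⟩ := exists_hilbertBasis_mem _ hsym.orthogonalFamily_eigenspaces
    (ContinuousLinearMap.orthogonalComplement_iSup_eigenspaces_eq_bot h.isCompactOperator hsym)
  refine ⟨w, g, fun j => j.1.re, fun j => ?_⟩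
  have h1 : A (g j) = j.1 • g j := Module.End.mem_eigenspace_iff.1 (hg j)
  have h2 : Module.End.HasEigenvalue (A : H →ₗ[ℂ] H) j.1 :=
    Module.End.hasEigenvalue_of_hasEigenvector ⟨hg j, g.orthonormal.ne_zero j⟩
  rw [h1, Complex.conj_eq_iff_re.1 (hsym.conj_eigenvalue_eq_self h2)]

/-- As `A⁻ A = -(A⁻)²`, the vector `A⁻ x` satisfies `‖A⁻ x‖² = -α ⟪x, A⁻ x⟫ ≤ 0`. -/
theorem negPart_apply_of_nonneg {A : H →L[ℂ] H} (hA : IsSelfAdjoint A) {x : H} {α : ℝ}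
    (hα : 0 ≤ α) (hx : A x = (α : ℂ) • x) : A⁻ x = 0 := by
  have hpos := (ContinuousLinearMap.nonneg_iff_isPositive _).1 (CFC.negPart_nonneg A)
  have h1 : A⁻ (A⁻ x) = -((α : ℂ) • A⁻ x) := by
    have h2 : A⁻ * A = -(A⁻ * A⁻) := by
      calc A⁻ * A = A⁻ * (A⁺ - A⁻) := by rw [CFC.posPart_sub_negPart A hA]
        _ = _ := by rw [mul_sub, CFC.negPart_mul_posPart, zero_sub]
    have h3 := congrArg (fun f => f x) h2
    have h4 : A⁻ (A x) = -(A⁻ (A⁻ x)) := h3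
    rw [hx, map_smul] at h4
    rw [h4, neg_neg]
  have h2 : (‖A⁻ x‖ ^ 2 : ℝ) = -(α * (⟪x, A⁻ x⟫_ℂ).re) := by
    have h3 : ⟪A⁻ x, A⁻ x⟫_ℂ = ⟪x, A⁻ (A⁻ x)⟫_ℂ := hpos.isSymmetric _ _
    have h4 : (⟪A⁻ x, A⁻ x⟫_ℂ).re = ‖A⁻ x‖ ^ 2 := inner_self_eq_norm_sq (𝕜 := ℂ) _
    rw [← h4, h3, h1, inner_neg_right, inner_smul_right, Complex.neg_re, Complex.re_ofReal_mul]
  have h3 : 0 ≤ (⟪x, A⁻ x⟫_ℂ).re := hpos.re_inner_nonneg_right x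
  have h4 : ‖A⁻ x‖ ^ 2 ≤ 0 := by rw [h2]; nlinarith [mul_nonneg hα h3]
  have h5 : ‖A⁻ x‖ = 0 := by
    have := sq_nonneg ‖A⁻ x‖
    exact pow_eq_zero_iff two_ne_zero |>.1 (le_antisymm h4 this)
  exact norm_eq_zero.1 h5

theorem posPart_apply_of_nonneg {A : H →L[ℂ] H} (hA : IsSelfAdjoint A) {x : H} {α : ℝ}
    (hα : 0 ≤ α) (hx : A x = (α : ℂ) • x) : A⁺ x = (α : ℂ) • x := by
  have h := congrArg (fun f => f x) (CFC.posPart_sub_negPart A hA)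
  simp only [sub_apply, negPart_apply_of_nonneg hA hα hx, sub_zero, hx] at h
  exact h

theorem posPart_apply_eigenvector {A : H →L[ℂ] H} (hA : IsSelfAdjoint A) {x : H} {α : ℝ}
    (hx : A x = (α : ℂ) • x) : A⁺ x = ((max α 0 : ℝ) : ℂ) • x := by
  rcases le_total 0 α with hα | hα
  · rw [max_eq_left hα, posPart_apply_of_nonneg hA hα hx]
  · have h := negPart_apply_of_nonneg hA.neg (x := x) (α := -α) (by linarith) (by simp [hx])
    rw [CFC.negPart_neg] at h
    rw [max_eq_right hα, h]; simp

theorem negPart_apply_eigenvector {A : H →L[ℂ] H} (hA : IsSelfAdjoint A) {x : H} {α : ℝ}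
    (hx : A x = (α : ℂ) • x) : A⁻ x = ((max (-α) 0 : ℝ) : ℂ) • x := by
  rw [← CFC.posPart_neg]
  exact posPart_apply_eigenvector hA.neg (by simp [hx])

end EigenBasis

/-! ### Partial sums of singular values -/

section PartialSums

variable {H : Type*} [NormedAddCommGroup H] [InnerProductSpace ℂ H] {ι : Type*}

theorem intervalIntegrable_singularValue (B : H →L[ℂ] H) (a b : ℝ) :
    IntervalIntegrable (fun s : ℝ => singularValue ⌊s⌋₊ B) MeasureTheory.volume a b :=
  Antitone.intervalIntegrable fun _ _ hst => singularValue_antitone B (Nat.floor_mono hst)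

theorem integral_singularValue_natCast (B : H →L[ℂ] H) (m : ℕ) :
    ∫ s in (0 : ℝ)..m, singularValue ⌊s⌋₊ B = ∑ k ∈ Finset.range m, singularValue k B := by
  have h := intervalIntegral.sum_integral_adjacent_intervals (a := fun k : ℕ => (k : ℝ)) (n := m)
    (μ := MeasureTheory.volume) (f := fun s : ℝ => singularValue ⌊s⌋₊ B)
    fun k _ => intervalIntegrable_singularValue B _ _
  rw [Nat.cast_zero] at h
  rw [← h]
  refine Finset.sum_congr rfl fun k _ => ?_
  have h2 : ∫ s in (k : ℝ)..((k + 1 : ℕ) : ℝ), singularValue ⌊s⌋₊ B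
      = ∫ _ in (k : ℝ)..((k + 1 : ℕ) : ℝ), singularValue k B := by
    rw [intervalIntegral.integral_of_le (by simp), intervalIntegral.integral_of_le (by simp),
      ← MeasureTheory.integral_Ico_eq_integral_Ioc, ← MeasureTheory.integral_Ico_eq_integral_Ioc]
    refine MeasureTheory.setIntegral_congr_fun measurableSet_Ico fun s hs => ?_
    have : ⌊s⌋₊ = k := (Nat.floor_eq_iff ((Nat.cast_nonneg k).trans hs.1)).2
      ⟨hs.1, by simpa using hs.2⟩
    simp only [this]
  rw [h2]; simp

/-- The largest `m` eigenvalues of a positive diagonal operator are its first `m` singular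
values. -/
theorem sum_singularValue_eq (b : HilbertBasis ι ℂ H) {B : H →L[ℂ] H} {β : ι → ℝ}
    (hB : ∀ i, B (b i) = (β i : ℂ) • b i) (hβ : ∀ i, 0 ≤ β i) {s : ℝ} {J : Finset ι}
    (hJ : ∀ i, i ∈ J ↔ s < β i) :
    ∑ k ∈ Finset.range J.card, singularValue k B = ∑ i ∈ J, β i := by
  classical
  set m := J.card
  let f : Fin m → ℝ := fun k => -β (J.equivFin.symm k)
  let e : Fin m ≃ J := (Tuple.sort f).trans J.equivFin.symm
  have hanti : ∀ k l : Fin m, k ≤ l → β (e l) ≤ β (e k) := fun k l hkl =>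
    neg_le_neg_iff.1 (Tuple.monotone_sort f hkl)
  have hnorm : ∀ i, ‖(β i : ℂ)‖ = β i := fun i => by
    rw [Complex.norm_real, Real.norm_of_nonneg (hβ i)]
  have key : ∀ k : Fin m, singularValue k B = β (e k) := by
    intro k
    apply le_antisymm
    · refine singularValue_diagonal_le b hB (hβ _)
        (J := (Finset.Iio k).image fun l => (e l : ι)) ?_ fun i hi => ?_
      · exact Finset.card_image_le.trans (by simp)
      · rw [hnorm]
        by_cases hiJ : i ∈ J
        · have h1 : i = e (e.symm ⟨i, hiJ⟩) := by simp
          rw [h1]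
          apply hanti
          by_contra hlt
          exact hi (Finset.mem_image.2 ⟨_, Finset.mem_Iio.2 (not_le.1 hlt), h1.symm⟩)
        · have h1 : β i ≤ s := not_lt.1 fun h => hiJ ((hJ i).2 h)
          exact h1.trans ((hJ _).1 (e k).2).le
    · refine le_singularValue_of_orthonormal (κ := Fin (k + 1))
        (g := fun l => b (e (Fin.castLE k.2 l))) (α := fun l => (β (e (Fin.castLE k.2 l)) : ℂ))
        (b.orthonormal.comp _ ?_) (by simp) (fun l => hB _) (hβ _) (fun l => ?_)
      · intro l l' h
        exact Fin.castLE_injective _ (e.injective (Subtype.val_injective h))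
      · rw [hnorm]
        exact hanti _ _ (Fin.le_def.2 (by simpa using Nat.lt_succ_iff.1 l.2))
  rw [Finset.sum_range]
  simp only [key]
  rw [← Finset.sum_coe_sort J, e.sum_comp (fun i : J => β i)]

/-- The partial sums of the singular values of a positive operator in `L_{1,∞}` agree, up to a
bounded error, with the sums of the eigenvalues above the threshold `1 / t`. -/
theorem WeakCount.abs_integral_singularValue_sub_le (b : HilbertBasis ι ℂ H) {B : H →L[ℂ] H}
    {β : ι → ℝ} (hB : ∀ i, B (b i) = (β i : ℂ) • b i) (hβ : ∀ i, 0 ≤ β i) {C : ℝ}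
    (h : WeakCount β C) {t : ℝ} (ht : 1 ≤ t) (ht' : 0 < t⁻¹) :
    |(∫ s in (0 : ℝ)..t, singularValue ⌊s⌋₊ B) - ∑ i ∈ h.big ht', β i|
      ≤ 1 + C * (2 * (C + 1)) := by
  have hC := h.nonneg
  have ht0 : 0 < t := by linarith
  have hnorm : ∀ i, ‖(β i : ℂ)‖ = β i := fun i => by
    rw [Complex.norm_real, Real.norm_of_nonneg (hβ i)]
  have h' : WeakCount (fun i => ‖(β i : ℂ)‖) C := by simpa only [hnorm] using h
  set m := (h.big ht').card
  have hm : (m : ℝ) ≤ C * t := by simpa using h.card_big_le ht'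
  rw [← sum_singularValue_eq b hB hβ (fun i => h.mem_big ht'), ← integral_singularValue_natCast,
    intervalIntegral.integral_interval_sub_left (intervalIntegrable_singularValue _ _ _)
      (intervalIntegrable_singularValue _ _ _)]
  have hCC : 0 ≤ C * (2 * (C + 1)) := by positivity
  rcases le_total (m : ℝ) t with hmt | hmt
  · have hle : ∀ s ∈ Set.uIoc (m : ℝ) t, ‖singularValue ⌊s⌋₊ B‖ ≤ t⁻¹ := by
      intro s hs
      rw [Set.uIoc_of_le hmt] at hs
      rw [Real.norm_of_nonneg (singularValue_nonneg _ _)]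
      refine singularValue_diagonal_le b hB ht'.le (J := h.big ht') (Nat.le_floor hs.1.le) ?_
      intro i hi
      rw [hnorm]
      exact not_lt.1 fun h' => hi ((h.mem_big ht').2 h')
    have h2 := intervalIntegral.norm_integral_le_of_norm_le_const hle
    rw [Real.norm_eq_abs, abs_of_nonneg (sub_nonneg.2 hmt)] at h2
    refine h2.trans ?_
    have : t⁻¹ * (t - m) ≤ t⁻¹ * t := by gcongr; linarith [(Nat.cast_nonneg m : (0 : ℝ) ≤ m)]
    rw [inv_mul_cancel₀ ht0.ne'] at this
    linarith
  · have hle : ∀ s ∈ Set.uIoc (m : ℝ) t, ‖singularValue ⌊s⌋₊ B‖ ≤ 2 * (C + 1) / t := by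
      intro s hs
      rw [Set.uIoc_of_ge hmt] at hs
      rw [Real.norm_of_nonneg (singularValue_nonneg _ _)]
      refine (h'.singularValue_le b hB _).trans ?_
      have := Nat.lt_floor_add_one s
      gcongr
      linarith [hs.1]
    have h2 := intervalIntegral.norm_integral_le_of_norm_le_const hle
    rw [Real.norm_eq_abs, abs_sub_comm t, abs_of_nonneg (sub_nonneg.2 hmt)] at h2
    refine h2.trans ?_
    have : 2 * (C + 1) / t * (m - t) ≤ 2 * (C + 1) / t * (C * t) := by gcongr; linarith
    have h3 : 2 * (C + 1) / t * (C * t) = C * (2 * (C + 1)) := by field_simp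
    linarith

end PartialSums

/-! ### Traces of compressions -/

section CompressionTrace

variable {H : Type*} [NormedAddCommGroup H] [InnerProductSpace ℂ H]

/-- The trace of the compression of `X` to a subspace `U`. -/
def compressionTrace (U : Submodule ℂ H) [U.HasOrthogonalProjection] (X : H →L[ℂ] H) : ℂ :=
  LinearMap.trace ℂ U
    ((U.orthogonalProjectionOnto : H →ₗ[ℂ] U) ∘ₗ (X : H →ₗ[ℂ] H) ∘ₗ U.subtype)

theorem compressionTrace_eq_sum {U : Submodule ℂ H} [U.HasOrthogonalProjection] {κ : Type*}
    [Fintype κ] (e : OrthonormalBasis κ ℂ U) (X : H →L[ℂ] H) :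
    compressionTrace U X = ∑ i, ⟪(e i : H), X (e i)⟫_ℂ := by
  rw [compressionTrace, LinearMap.trace_eq_sum_inner _ e]
  refine Finset.sum_congr rfl fun i _ => ?_
  simp only [LinearMap.comp_apply, ContinuousLinearMap.coe_coe, Submodule.subtype_apply]
  exact U.inner_orthogonalProjectionOnto_eq_of_mem_left _ _

/-- If `X` is small on the orthogonal complement of `U`, then enlarging `U` changes the trace of the
compression of `X` little: by cyclicity of the trace, the part of `X` that lives on `U` contributes
the same to both. -/
theorem norm_compressionTrace_sub_le {U W : Submodule ℂ H} [FiniteDimensional ℂ U]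
    [FiniteDimensional ℂ W] (hUW : U ≤ W) {X : H →L[ℂ] H} {ε : ℝ} (hε : 0 ≤ ε)
    (hX : ∀ x ∈ Uᗮ, ‖X x‖ ≤ ε * ‖x‖) :
    ‖compressionTrace W X - compressionTrace U X‖ ≤ ε * Module.finrank ℂ W := by
  let f : W →ₗ[ℂ] U := (U.orthogonalProjectionOnto : H →ₗ[ℂ] U) ∘ₗ W.subtype
  let g : U →ₗ[ℂ] W :=
    (W.orthogonalProjectionOnto : H →ₗ[ℂ] W) ∘ₗ (X : H →ₗ[ℂ] H) ∘ₗ U.subtype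
  have h1 : compressionTrace U X = LinearMap.trace ℂ U (f ∘ₗ g) := by
    rw [compressionTrace]
    congr 1
    ext x
    simp only [f, g, LinearMap.comp_apply, ContinuousLinearMap.coe_coe, Submodule.subtype_apply]
    exact congrArg Subtype.val
      (Submodule.orthogonalProjectionOnto_starProjection_of_le hUW (X x)).symm
  have h2 : compressionTrace U X = compressionTrace W (X.comp U.starProjection) := by
    rw [h1, ← LinearMap.trace_comp_comm']
    rfl
  let e := stdOrthonormalBasis ℂ W
  rw [h2, compressionTrace_eq_sum e, compressionTrace_eq_sum e, ← Finset.sum_sub_distrib]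
  refine (norm_sum_le _ _).trans ?_
  refine (Finset.sum_le_card_nsmul _ _ ε fun i _ => ?_).trans ?_
  · rw [← inner_sub_right, ContinuousLinearMap.comp_apply, ← map_sub]
    refine (norm_inner_le_norm _ _).trans ?_
    have he : ‖(e i : H)‖ = 1 := e.orthonormal.1 i
    have h3 := hX ((e i : H) - U.starProjection (e i))
      (Submodule.sub_starProjection_mem_orthogonal _)
    have h4 : ‖(e i : H) - U.starProjection (e i)‖ ≤ 1 := by
      rw [← he]
      have := U.norm_sq_eq_add_norm_sq_starProjection (e i : H)
      rw [Submodule.starProjection_orthogonal_val] at this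
      refine le_of_sq_le_sq ?_ (norm_nonneg _)
      nlinarith [sq_nonneg ‖U.starProjection (e i : H)‖]
    rw [he, one_mul]
    exact h3.trans (by nlinarith)
  · simp [mul_comm]

theorem compressionTrace_span {ι : Type*} {b : ι → H} (hb : Orthonormal ℂ b) (J : Finset ι)
    [DecidableEq H] (X : H →L[ℂ] H) :
    compressionTrace (Submodule.span ℂ (J.image b : Set H)) X = ∑ i ∈ J, ⟪b i, X (b i)⟫_ℂ := by
  rw [compressionTrace_eq_sum (OrthonormalBasis.span hb J)]
  simp only [OrthonormalBasis.span_apply]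
  exact Finset.sum_coe_sort J fun i => ⟪b i, X (b i)⟫_ℂ

end CompressionTrace

/-! ### The partial traces of `T V` -/

section RealPart

variable {H : Type*} [NormedAddCommGroup H] [InnerProductSpace ℂ H] [CompleteSpace H]

/-- A positive part `max (α j) 0` exceeds `s > 0` only where `|α j|` does, and vanishes at the
other indices with `|α j| > s`. -/
theorem sum_max_big {κ : Type*} {α : κ → ℝ} {C : ℝ} (h : WeakCount (fun j => |α j|) C)
    (h' : WeakCount (fun j => max (α j) 0) C) {s : ℝ} (hs : 0 < s) :
    ∑ j ∈ h'.big hs, max (α j) 0 = ∑ j ∈ h.big hs, max (α j) 0 := by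
  refine Finset.sum_subset (fun j hj => ?_) fun j hj hj' => ?_
  · rw [WeakCount.mem_big] at hj ⊢
    exact hj.trans_le (max_le (le_abs_self _) (abs_nonneg _))
  · rw [WeakCount.mem_big] at hj hj'
    rcases le_or_gt (α j) 0 with h0 | h0
    · exact max_eq_right h0
    · rw [max_eq_left h0.le] at hj'
      rw [abs_of_pos h0] at hj
      exact absurd hj hj'

theorem inner_realPart_apply (X : H →L[ℂ] H) (x : H) :
    ⟪x, (realPart X : H →L[ℂ] H) x⟫_ℂ = ((⟪x, X x⟫_ℂ).re : ℂ) := by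
  have h1 : (realPart X : H →L[ℂ] H) x = (2⁻¹ : ℂ) • (X x + (star X) x) := by
    rw [realPart_apply_coe]
    have : ((2 : ℝ)⁻¹ • (X + star X) : H →L[ℂ] H) = (2⁻¹ : ℂ) • (X + star X) := by
      rw [← Complex.coe_smul]; push_cast; rfl
    rw [this]; rfl
  rw [h1, inner_smul_right, inner_add_right, ContinuousLinearMap.star_eq_adjoint,
    ContinuousLinearMap.adjoint_inner_right, ← inner_conj_symm (X x) x, Complex.add_conj]
  push_cast
  ring

theorem MemWeakL1.realPart_mul {ι : Type*} (b : HilbertBasis ι ℂ H) {V : H →L[ℂ] H} {v : ι → ℝ}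
    (hV : ∀ i, V (b i) = (v i : ℂ) • b i) (h : MemWeakL1 V) (T : H →L[ℂ] H) :
    MemWeakL1 (realPart (T * V) : H →L[ℂ] H) := by
  have h1 : star V = V := isSelfAdjoint_of_diagonal b hV
  have h2 : (realPart (T * V) : H →L[ℂ] H)
      = ((2⁻¹ : ℂ) • (1 : H →L[ℂ] H)) * (T * V + V * star T) := by
    rw [realPart_apply_coe, star_mul, h1, smul_mul_assoc, one_mul, ← Complex.coe_smul]
    push_cast
    rfl
  rw [h2]
  exact ((h.mul_left T).add (h.mul_right _)).mul_left _

/-- The difference of the partial sums of the singular values of the positive and the negative part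
of `Re (T V)` is, up to a bounded error, the real part of the trace of `T V` over the span of the
eigenvectors of `V` with eigenvalue above `1 / t`. Both are traces of compressions to spaces of
dimension `O(t)` outside of which `Re (T V)`, respectively `T V`, has norm `O(1 / t)`. -/
theorem exists_abs_integral_realPart_sub_le {ι : Type*} (b : HilbertBasis ι ℂ H) {V : H →L[ℂ] H}
    {v : ι → ℝ} (hV : ∀ i, V (b i) = (v i : ℂ) • b i) (hv : ∀ i, 0 ≤ v i) {C : ℝ}
    (h : WeakCount v C) (T : H →L[ℂ] H) :
    ∃ K : ℝ, ∀ t : ℝ, 1 ≤ t → ∀ ht : 0 < t⁻¹,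
      |((∫ s in (0 : ℝ)..t, singularValue ⌊s⌋₊ (realPart (T * V) : H →L[ℂ] H)⁺)
        - ∫ s in (0 : ℝ)..t, singularValue ⌊s⌋₊ (realPart (T * V) : H →L[ℂ] H)⁻)
        - (∑ i ∈ h.big ht, (v i : ℂ) * ⟪b i, T (b i)⟫_ℂ).re| ≤ K := by
  classical
  have hnorm : ∀ i, ‖(v i : ℂ)‖ = v i := fun i => by
    rw [Complex.norm_real, Real.norm_of_nonneg (hv i)]
  have hVmem : MemWeakL1 V := WeakCount.memWeakL1 b hV (C := C) (by simpa only [hnorm] using h)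
  set A : H →L[ℂ] H := (realPart (T * V) : H →L[ℂ] H) with hAdef
  have hAsa : IsSelfAdjoint A := (realPart (T * V)).2
  have hAmem : MemWeakL1 A := MemWeakL1.realPart_mul b hV hVmem T
  obtain ⟨w, g, α, hg⟩ := exists_eigenbasis_of_memWeakL1 hAsa hAmem
  obtain ⟨C₁, h₁⟩ := weakCount_of_memWeakL1 g.orthonormal hg hAmem
  replace h₁ : WeakCount (fun j => |α j|) C₁ := by
    simpa only [Complex.norm_real, Real.norm_eq_abs] using h₁
  have hp : WeakCount (fun j => max (α j) 0) C₁ :=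
    h₁.mono fun j => max_le (le_abs_self _) (abs_nonneg _)
  have h₁' : WeakCount (fun j => |-α j|) C₁ := by simpa only [abs_neg] using h₁
  have hn : WeakCount (fun j => max (-α j) 0) C₁ :=
    h₁'.mono fun j => max_le (le_abs_self _) (abs_nonneg _)
  set K₁ : ℝ := 1 + C₁ * (2 * (C₁ + 1))
  refine ⟨K₁ + K₁ + ((C₁ + C) + ‖T‖ * (C₁ + C)), fun t ht1 ht => ?_⟩
  have ht0 : 0 < t := by linarith
  have hplus := hp.abs_integral_singularValue_sub_le g
    (fun j => posPart_apply_eigenvector hAsa (hg j)) (fun j => le_max_right _ _) ht1 ht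
  have hminus := hn.abs_integral_singularValue_sub_le g
    (fun j => negPart_apply_eigenvector hAsa (hg j)) (fun j => le_max_right _ _) ht1 ht
  rw [sum_max_big h₁ hp ht] at hplus
  rw [sum_max_big h₁' hn ht] at hminus
  have hbig : h₁'.big ht = h₁.big ht := by
    ext j; rw [WeakCount.mem_big, WeakCount.mem_big, abs_neg]
  rw [hbig] at hminus
  have hsum : ∑ j ∈ h₁.big ht, max (α j) 0 - ∑ j ∈ h₁.big ht, max (-α j) 0
      = ∑ j ∈ h₁.big ht, α j := by
    rw [← Finset.sum_sub_distrib]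
    refine Finset.sum_congr rfl fun j _ => ?_
    rcases le_total (α j) 0 with h0 | h0
    · rw [max_eq_right h0, max_eq_left (by linarith)]; ring
    · rw [max_eq_left h0, max_eq_right (by linarith)]; ring
  set U₁ := Submodule.span ℂ ((h₁.big ht).image g : Set H) with hU₁
  set U₂ := Submodule.span ℂ ((h.big ht).image b : Set H) with hU₂
  have hfin₁ : FiniteDimensional ℂ U₁ := FiniteDimensional.span_finset ℂ _
  have hfin₂ : FiniteDimensional ℂ U₂ := FiniteDimensional.span_finset ℂ _
  have hd₁ : (Module.finrank ℂ U₁ : ℝ) ≤ C₁ * t := by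
    have h2 : Module.finrank ℂ U₁ ≤ (h₁.big ht).card :=
      (finrank_span_finset_le_card _).trans Finset.card_image_le
    calc (Module.finrank ℂ U₁ : ℝ) ≤ (h₁.big ht).card := by exact_mod_cast h2
      _ ≤ _ := by simpa using h₁.card_big_le ht
  have hd₂ : (Module.finrank ℂ U₂ : ℝ) ≤ C * t := by
    have h2 : Module.finrank ℂ U₂ ≤ (h.big ht).card :=
      (finrank_span_finset_le_card _).trans Finset.card_image_le
    calc (Module.finrank ℂ U₂ : ℝ) ≤ (h.big ht).card := by exact_mod_cast h2
      _ ≤ _ := by simpa using h.card_big_le ht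
  have hd : (Module.finrank ℂ ↥(U₁ ⊔ U₂) : ℝ) ≤ (C₁ + C) * t := by
    have h2 := Submodule.finrank_add_le_finrank_add_finrank U₁ U₂
    have h3 : (Module.finrank ℂ ↥(U₁ ⊔ U₂) : ℝ)
        ≤ Module.finrank ℂ U₁ + Module.finrank ℂ U₂ := by exact_mod_cast h2
    linarith
  have hx₁ : ∀ x ∈ U₁ᗮ, ‖A x‖ ≤ t⁻¹ * ‖x‖ := by
    intro x hx
    refine norm_diagonal_apply_le g hg ht.le fun j => ?_
    by_cases hj : j ∈ h₁.big ht
    · exact Or.inr ((Submodule.mem_orthogonal _ _).1 hx _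
        (Submodule.subset_span (Finset.mem_coe.2 (Finset.mem_image_of_mem _ hj))))
    · rw [WeakCount.mem_big, not_lt] at hj
      rw [Complex.norm_real, Real.norm_eq_abs]
      exact Or.inl hj
  have hx₂ : ∀ x ∈ U₂ᗮ, ‖(T * V) x‖ ≤ (‖T‖ * t⁻¹) * ‖x‖ := by
    intro x hx
    have h2 : ‖V x‖ ≤ t⁻¹ * ‖x‖ := by
      refine norm_diagonal_apply_le b hV ht.le fun j => ?_
      by_cases hj : j ∈ h.big ht
      · exact Or.inr ((Submodule.mem_orthogonal _ _).1 hx _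
          (Submodule.subset_span (Finset.mem_coe.2 (Finset.mem_image_of_mem _ hj))))
      · rw [WeakCount.mem_big, not_lt] at hj
        rw [hnorm]
        exact Or.inl hj
    calc ‖T (V x)‖ ≤ ‖T‖ * ‖V x‖ := T.le_opNorm _
      _ ≤ ‖T‖ * (t⁻¹ * ‖x‖) := by gcongr
      _ = _ := by ring
  have hc₁ := norm_compressionTrace_sub_le (W := U₁ ⊔ U₂) le_sup_left ht.le hx₁
  have hc₂ := norm_compressionTrace_sub_le (W := U₁ ⊔ U₂) le_sup_right
    (mul_nonneg (norm_nonneg T) ht.le) hx₂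
  have he₁ : t⁻¹ * (Module.finrank ℂ ↥(U₁ ⊔ U₂) : ℝ) ≤ C₁ + C := by
    rw [inv_mul_le_iff₀ ht0]; linarith
  have he₂ : ‖T‖ * t⁻¹ * (Module.finrank ℂ ↥(U₁ ⊔ U₂) : ℝ) ≤ ‖T‖ * (C₁ + C) := by
    rw [mul_assoc]; gcongr
  have htr₁ : compressionTrace U₁ A = ((∑ j ∈ h₁.big ht, α j : ℝ) : ℂ) := by
    refine (compressionTrace_span g.orthonormal _ A).trans ?_
    push_cast
    refine Finset.sum_congr rfl fun j _ => ?_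
    rw [hg, inner_smul_right, inner_self_eq_norm_sq_to_K, g.orthonormal.1 j]; simp
  have htr₂ : compressionTrace U₂ (T * V) = ∑ i ∈ h.big ht, (v i : ℂ) * ⟪b i, T (b i)⟫_ℂ := by
    refine (compressionTrace_span b.orthonormal _ (T * V)).trans ?_
    refine Finset.sum_congr rfl fun i _ => ?_
    change ⟪b i, T (V (b i))⟫_ℂ = _
    rw [hV, map_smul, inner_smul_right]
  have htrW : compressionTrace (U₁ ⊔ U₂) A = ((compressionTrace (U₁ ⊔ U₂) (T * V)).re : ℂ) := by
    rw [compressionTrace_eq_sum (stdOrthonormalBasis ℂ _),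
      compressionTrace_eq_sum (stdOrthonormalBasis ℂ _), Complex.re_sum]
    push_cast
    exact Finset.sum_congr rfl fun i _ => inner_realPart_apply _ _
  have hre₁ := (Complex.abs_re_le_norm _).trans (hc₁.trans he₁)
  have hre₂ := (Complex.abs_re_le_norm _).trans (hc₂.trans he₂)
  rw [Complex.sub_re, htr₁, htrW, Complex.ofReal_re, Complex.ofReal_re] at hre₁
  rw [Complex.sub_re, htr₂] at hre₂
  rw [abs_le] at *
  constructor <;> linarith [hplus.1, hplus.2, hminus.1, hminus.2, hre₁.1, hre₁.2, hre₂.1, hre₂.2]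

end RealPart

/-! ### Sums over weak `ℓ₁` families -/

section WeakSequences

variable {ι : Type*} {v : ι → ℝ} {C : ℝ}

theorem WeakCount.card_mul_le (h : WeakCount v C) {s : ℝ} {J : Finset ι}
    (hJ : ∀ i ∈ J, s ≤ v i) : (J.card : ℝ) * s ≤ C := by
  refine le_of_forall_lt_imp_le_of_dense fun a ha => ?_
  rcases Nat.eq_zero_or_pos J.card with h0 | h0
  · rw [h0, Nat.cast_zero, zero_mul] at ha
    linarith [h.nonneg]
  have h0' : (0 : ℝ) < J.card := by exact_mod_cast h0
  rcases le_or_gt a 0 with ha0 | ha0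
  · exact ha0.trans h.nonneg
  have hs : a / J.card < s := by rw [div_lt_iff₀ h0']; linarith
  have h1 := h (a / J.card) (by positivity) J fun i hi => hs.trans_le (hJ i hi)
  rw [le_div_iff₀ (by positivity), mul_div_cancel₀ _ h0'.ne'] at h1
  exact h1

/-- The squares of the members of a weak `ℓ₁` family that do not exceed `s` have sum `O(s)`: the sum
is the integral of `2 r` times the number of members above `r`. -/
theorem WeakCount.sum_sq_le (h : WeakCount v C) (hv : ∀ i, 0 ≤ v i) {s : ℝ} (hs : 0 ≤ s)
    {J : Finset ι} (hJ : ∀ i ∈ J, v i ≤ s) : ∑ i ∈ J, v i ^ 2 ≤ 2 * C * s := by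
  classical
  have h1 : ∀ i ∈ J, v i ^ 2 = ∫ r in (0 : ℝ)..s, {r | r ≤ v i}.indicator (fun r => 2 * r) r := by
    intro i hi
    rw [intervalIntegral.integral_indicator ⟨hv i, hJ i hi⟩, intervalIntegral.integral_const_mul,
      integral_id]
    ring
  have hint : ∀ i ∈ J, IntervalIntegrable
      ({r | r ≤ v i}.indicator fun r : ℝ => 2 * r) MeasureTheory.volume 0 s := by
    intro i _
    have : IntervalIntegrable (fun r : ℝ => 2 * r) MeasureTheory.volume 0 s :=
      (continuous_const.mul continuous_id).intervalIntegrable _ _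
    rw [intervalIntegrable_iff] at this ⊢
    exact this.indicator measurableSet_Iic
  rw [Finset.sum_congr rfl h1, ← intervalIntegral.integral_finsetSum hint]
  have h2 : ∫ r in (0 : ℝ)..s, ∑ i ∈ J, {r | r ≤ v i}.indicator (fun r => 2 * r) r
      ≤ ∫ _ in (0 : ℝ)..s, 2 * C := by
    refine intervalIntegral.integral_mono_on hs ?_ (by simp) fun r hr => ?_
    · simpa only [Finset.sum_fn] using IntervalIntegrable.sum J hint
    · have h3 : ∑ i ∈ J, {r | r ≤ v i}.indicator (fun r => 2 * r) r
          = 2 * (((J.filter fun i => r ≤ v i).card : ℝ) * r) := by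
        rw [Finset.card_filter, Nat.cast_sum, Finset.sum_mul, Finset.mul_sum]
        refine Finset.sum_congr rfl fun i _ => ?_
        by_cases hri : r ≤ v i <;> simp [Set.indicator, hri]
      rw [h3]
      gcongr
      exact h.card_mul_le fun i hi => (Finset.mem_filter.1 hi).2
  refine h2.trans (le_of_eq ?_)
  simp; ring

/-- A function of a weak `ℓ₁` family which is at most `A` above the threshold `1 / t` and at most
quadratic below has all its finite sums bounded. -/
theorem WeakCount.sum_le (h : WeakCount v C) (hv : ∀ i, 0 ≤ v i) {t A c : ℝ} (ht : 0 < t)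
    (hA : 0 ≤ A) (hc : 0 ≤ c) {f : ι → ℝ} (h1 : ∀ i, t⁻¹ < v i → f i ≤ A)
    (h2 : ∀ i, v i ≤ t⁻¹ → f i ≤ c * v i ^ 2) (J : Finset ι) :
    ∑ i ∈ J, f i ≤ A * (C * t) + c * (2 * C * t⁻¹) := by
  classical
  rw [← Finset.sum_filter_add_sum_filter_not J fun i => t⁻¹ < v i]
  refine add_le_add ?_ ?_
  · refine (Finset.sum_le_card_nsmul _ _ A fun i hi => h1 i (Finset.mem_filter.1 hi).2).trans ?_
    rw [nsmul_eq_mul, mul_comm]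
    refine mul_le_mul_of_nonneg_left ?_ hA
    simpa using h t⁻¹ (inv_pos.2 ht) _ fun i hi => (Finset.mem_filter.1 hi).2
  · refine (Finset.sum_le_sum fun i hi => h2 i (not_lt.1 (Finset.mem_filter.1 hi).2)).trans ?_
    rw [← Finset.mul_sum]
    refine mul_le_mul_of_nonneg_left ?_ hc
    exact h.sum_sq_le hv (inv_pos.2 ht).le fun i hi => not_lt.1 (Finset.mem_filter.1 hi).2

theorem WeakCount.summable_sq (h : WeakCount v C) (hv : ∀ i, 0 ≤ v i) (hv1 : ∀ i, v i ≤ 1) :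
    Summable fun i => v i ^ 2 :=
  summable_of_sum_le (fun _ => sq_nonneg _) fun _ => h.sum_sq_le hv zero_le_one fun i _ => hv1 i

end WeakSequences

/-! ### The function `exp(-x^(-q))` and the Gamma function -/

section HeatKernel

/-- The function `x ↦ exp(-x^(-q))`, which turns an eigenvalue `x` of `V` into the one of
`exp(-V^(-q))`. -/
def expInv (q x : ℝ) : ℝ := Real.exp (-x ^ (-q))

theorem expInv_pos (q x : ℝ) : 0 < expInv q x := Real.exp_pos _

theorem expInv_le_one (q : ℝ) {x : ℝ} (hx : 0 < x) : expInv q x ≤ 1 := by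
  rw [expInv, Real.exp_le_one_iff, neg_nonpos]
  exact Real.rpow_nonneg hx.le _

/-- Near `0` the function `exp(-x^(-q))` vanishes to any order; the second is enough for sums over
weak `ℓ₁` families to converge. -/
theorem exists_expInv_le {q : ℝ} (hq : 0 < q) :
    ∃ c : ℝ, 0 ≤ c ∧ ∀ x : ℝ, 0 < x → expInv q x ≤ c * x ^ 2 := by
  obtain ⟨n, hn⟩ := exists_nat_ge (2 / q)
  refine ⟨n.factorial, by positivity, fun x hx => ?_⟩
  have hn1 : (1 : ℝ) ≤ n.factorial := by exact_mod_cast n.factorial_pos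
  rcases le_total 1 x with h1 | h1
  · exact (expInv_le_one q hx).trans (one_le_mul_of_one_le_of_one_le hn1 (one_le_pow₀ h1))
  · set y := x ^ (-q) with hy
    have hy0 : 0 < y := Real.rpow_pos_of_pos hx _
    have hy1 : 1 ≤ y := Real.one_le_rpow_of_pos_of_le_one_of_nonpos hx h1 (by linarith)
    have h2 : (x ^ 2)⁻¹ ≤ y ^ n := by
      calc (x ^ 2)⁻¹ = y ^ (2 / q) := by
            rw [hy, ← Real.rpow_mul hx.le, ← Real.rpow_natCast, ← Real.rpow_neg hx.le]
            congr 1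
            field_simp
            norm_num
        _ ≤ y ^ (n : ℝ) := Real.rpow_le_rpow_of_exponent_le hy1 hn
        _ = _ := Real.rpow_natCast _ _
    have h3 := Real.pow_div_factorial_le_exp y hy0.le n
    rw [div_le_iff₀ (by positivity)] at h3
    rw [expInv, Real.exp_neg, inv_le_iff_one_le_mul₀ (Real.exp_pos _)]
    have h4 : 1 ≤ x ^ 2 * y ^ n := by rwa [inv_le_iff_one_le_mul₀' (by positivity)] at h2
    nlinarith [sq_nonneg x]

theorem continuousOn_expInv (q : ℝ) : ContinuousOn (expInv q) (Set.Ioi 0) := by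
  intro x hx
  refine ContinuousAt.continuousWithinAt ?_
  exact (Real.continuousAt_rpow_const x _ (Or.inl (ne_of_gt hx))).neg.rexp

/-- The substitution `r ↦ 1 / r` turns the integral into the one that defines `Γ`. -/
theorem integral_expInv_div_sq {q : ℝ} (hq : 0 < q) :
    ∫ r in Set.Ioi (0 : ℝ), expInv q r / r ^ 2 = Real.Gamma (1 + 1 / q) := by
  rw [add_comm, ← integral_exp_neg_rpow hq,
    ← MeasureTheory.integral_comp_rpow_Ioi _ (show (-1 : ℝ) ≠ 0 by norm_num)]
  refine MeasureTheory.setIntegral_congr_fun measurableSet_Ioi fun r (hr : 0 < r) => ?_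
  have h1 : r ^ (-1 - 1 : ℝ) = (r ^ 2)⁻¹ := by
    rw [← Real.rpow_natCast, ← Real.rpow_neg hr.le]; norm_num
  simp only [expInv, smul_eq_mul, h1, abs_neg, abs_one, one_mul]
  rw [← Real.rpow_mul hr.le, div_eq_inv_mul, Real.rpow_neg_one, neg_mul_neg, one_mul]
  field_simp

theorem integrableOn_expInv_div_sq {q : ℝ} (hq : 0 < q) :
    MeasureTheory.IntegrableOn (fun r => expInv q r / r ^ 2) (Set.Ioi 0) := by
  apply MeasureTheory.Integrable.of_integral_ne_zero
  rw [integral_expInv_div_sq hq]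
  exact (Real.Gamma_pos_of_pos (by positivity)).ne'

theorem expInv_div_sq_le {q c : ℝ} (hc : ∀ x : ℝ, 0 < x → expInv q x ≤ c * x ^ 2) {r : ℝ}
    (hr : 0 < r) : expInv q r / r ^ 2 ≤ c := by
  rw [div_le_iff₀ (by positivity)]; exact hc r hr

theorem integral_expInv_div_sq_nonneg (q : ℝ) {a b : ℝ} (hab : a ≤ b) :
    0 ≤ ∫ r in a..b, expInv q r / r ^ 2 :=
  intervalIntegral.integral_nonneg hab fun r _ =>
    div_nonneg (expInv_pos q r).le (sq_nonneg r)

theorem integral_expInv_div_sq_le {q c : ℝ}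
    (hc : ∀ x : ℝ, 0 < x → expInv q x ≤ c * x ^ 2) {a b : ℝ} (ha : 0 ≤ a) (hab : a ≤ b) :
    ∫ r in a..b, expInv q r / r ^ 2 ≤ c * (b - a) := by
  have h1 : ∀ r ∈ Set.uIoc a b, ‖expInv q r / r ^ 2‖ ≤ c := fun r hr => by
    rw [Set.uIoc_of_le hab] at hr
    rw [Real.norm_of_nonneg (div_nonneg (expInv_pos q r).le (sq_nonneg r))]
    exact expInv_div_sq_le hc (ha.trans_lt hr.1)
  have h2 := intervalIntegral.norm_integral_le_of_norm_le_const h1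
  rw [Real.norm_eq_abs, abs_of_nonneg (sub_nonneg.2 hab)] at h2
  exact (le_abs_self _).trans h2

theorem integral_Ioi_expInv_div_sq_le {q : ℝ} (hq : 0 < q) {a : ℝ} (ha : 0 < a) :
    ∫ r in Set.Ioi a, expInv q r / r ^ 2 ≤ a⁻¹ := by
  have h1 : ∫ r in Set.Ioi a, r ^ (-2 : ℝ) = a⁻¹ := by
    rw [integral_Ioi_rpow_of_lt (by norm_num) ha]
    have : (-2 : ℝ) + 1 = -1 := by norm_num
    rw [this, Real.rpow_neg_one]; ring
  rw [← h1]
  refine MeasureTheory.setIntegral_mono_on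
    ((integrableOn_expInv_div_sq hq).mono_set (Set.Ioi_subset_Ioi ha.le))
    (integrableOn_Ioi_rpow_of_lt (by norm_num) ha) measurableSet_Ioi fun r (hr : a < r) => ?_
  have hr0 : 0 < r := ha.trans hr
  rw [Real.rpow_neg hr0.le, div_eq_mul_inv]
  have : r ^ (2 : ℝ) = r ^ 2 := by rw [← Real.rpow_natCast]; norm_num
  rw [this]
  exact mul_le_of_le_one_left (by positivity) (expInv_le_one q hr0)

theorem integral_expInv_mul_div_sq (q : ℝ) {v : ℝ} (hv : 0 < v) (t : ℝ) :
    ∫ s in (1 : ℝ)..t, expInv q (s * v) / s ^ 2 = v * ∫ r in v..t * v, expInv q r / r ^ 2 := by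
  have h := intervalIntegral.integral_comp_mul_right (a := 1) (b := t)
    (fun r => expInv q r / r ^ 2) hv.ne'
  rw [one_mul, smul_eq_mul] at h
  have h2 : ∀ s : ℝ, expInv q (s * v) / s ^ 2 = v ^ 2 * (expInv q (s * v) / (s * v) ^ 2) := by
    intro s
    rcases eq_or_ne s 0 with rfl | hs
    · simp
    · field_simp
  simp only [h2, intervalIntegral.integral_const_mul, h]
  field_simp

/-- The integral of `exp(-(s v)^(-q)) / s²` over `1 ≤ s ≤ t` compared with its value `Γ(1 + 1/q) v`
over the whole half-line. This estimate is of use for `t v > 1`. -/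
theorem abs_integral_expInv_sub_Gamma_le {q c : ℝ} (hq : 0 < q)
    (hc : ∀ x : ℝ, 0 < x → expInv q x ≤ c * x ^ 2) {v t : ℝ} (hv : 0 < v) (ht : 1 ≤ t) :
    |(∫ s in (1 : ℝ)..t, expInv q (s * v) / s ^ 2) - Real.Gamma (1 + 1 / q) * v|
      ≤ c * v ^ 2 + t⁻¹ := by
  have ht0 : 0 < t := by linarith
  have htv : v ≤ t * v := le_mul_of_one_le_left hv.le ht
  have htv0 : 0 < t * v := by positivity
  have hint := integrableOn_expInv_div_sq hq
  have hI : ∀ a b : ℝ, 0 ≤ a → 0 ≤ b → IntervalIntegrable (fun r => expInv q r / r ^ 2)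
      MeasureTheory.volume a b := fun a b ha hb => by
    rw [intervalIntegrable_iff]
    exact hint.mono_set fun r hr => (le_min ha hb).trans_lt hr.1
  have hsplit : Real.Gamma (1 + 1 / q) = (∫ r in (0 : ℝ)..v, expInv q r / r ^ 2)
      + (∫ r in v..t * v, expInv q r / r ^ 2) + ∫ r in Set.Ioi (t * v), expInv q r / r ^ 2 := by
    rw [← integral_expInv_div_sq hq, intervalIntegral.integral_add_adjacent_intervals
      (hI _ _ le_rfl hv.le) (hI _ _ hv.le htv0.le),
      intervalIntegral.integral_of_le htv0.le, ← MeasureTheory.setIntegral_union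
        (Set.Ioc_disjoint_Ioi le_rfl) measurableSet_Ioi
        (hint.mono_set Set.Ioc_subset_Ioi_self) (hint.mono_set (Set.Ioi_subset_Ioi htv0.le)),
      Set.Ioc_union_Ioi_eq_Ioi htv0.le]
  have h1 := integral_expInv_div_sq_nonneg q hv.le
  have h2 := integral_expInv_div_sq_le hc le_rfl hv.le
  have h3 := integral_Ioi_expInv_div_sq_le hq htv0
  have h4 : 0 ≤ ∫ r in Set.Ioi (t * v), expInv q r / r ^ 2 :=
    MeasureTheory.integral_nonneg fun r => div_nonneg (expInv_pos q r).le (sq_nonneg r)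
  rw [integral_expInv_mul_div_sq q hv, hsplit]
  have h5 : v * (t * v)⁻¹ = t⁻¹ := by field_simp
  have h6 := mul_le_mul_of_nonneg_left h2 hv.le
  have h7 := mul_le_mul_of_nonneg_left h3 hv.le
  have h8 := mul_nonneg hv.le h1
  have h9 := mul_nonneg hv.le h4
  rw [abs_le]
  constructor <;> nlinarith

/-- An estimate of the same integral, of use for `t v ≤ 1`, where it is small. -/
theorem abs_integral_expInv_le {q c : ℝ} (hc0 : 0 ≤ c)
    (hc : ∀ x : ℝ, 0 < x → expInv q x ≤ c * x ^ 2) {v t : ℝ} (hv : 0 < v) (ht : 1 ≤ t) :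
    |∫ s in (1 : ℝ)..t, expInv q (s * v) / s ^ 2| ≤ c * t * v ^ 2 := by
  have htv : v ≤ t * v := le_mul_of_one_le_left hv.le ht
  rw [integral_expInv_mul_div_sq q hv,
    abs_of_nonneg (mul_nonneg hv.le (integral_expInv_div_sq_nonneg q htv))]
  have h1 := integral_expInv_div_sq_le hc hv.le htv
  calc v * ∫ r in v..t * v, expInv q r / r ^ 2 ≤ v * (c * (t * v - v)) := by gcongr
    _ ≤ v * (c * (t * v)) := by gcongr; linarith
    _ = _ := by ring

end HeatKernel

/-! ### Heat sums and their logarithmic means -/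

section HeatSum

variable {ι : Type*} {v : ι → ℝ} {C : ℝ}

/-- The function `t ↦ t⁻¹ Tr(T exp(-(t V)^(-q)))`, for an operator `V` with eigenvalues `v` and an
operator `T` with diagonal `a` in an eigenbasis of `V`. -/
def heatSum (v : ι → ℝ) (a : ι → ℂ) (q t : ℝ) : ℂ :=
  (t : ℂ)⁻¹ * ∑' i, a i * (expInv q (t * v i) : ℂ)

theorem norm_le_of_hasSum {f : ι → ℂ} {x : ℂ} (hf : HasSum f x) {K : ℝ}
    (h : ∀ J : Finset ι, ∑ i ∈ J, ‖f i‖ ≤ K) : ‖x‖ ≤ K :=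
  le_of_tendsto hf.norm (Filter.Eventually.of_forall fun J => (norm_sum_le _ _).trans (h J))

theorem sum_norm_heat_le (h : WeakCount v C) (hv : ∀ i, 0 < v i) {a : ι → ℂ} {M : ℝ}
    (hM : 0 ≤ M) (ha : ∀ i, ‖a i‖ ≤ M) {q c : ℝ} (hc0 : 0 ≤ c)
    (hc : ∀ x : ℝ, 0 < x → expInv q x ≤ c * x ^ 2) {t : ℝ} (ht : 0 < t) (J : Finset ι) :
    ∑ i ∈ J, ‖a i * (expInv q (t * v i) : ℂ)‖ ≤ M * C * (1 + 2 * c) * t := by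
  have hn : ∀ i, ‖a i * (expInv q (t * v i) : ℂ)‖ ≤ M * expInv q (t * v i) := fun i => by
    rw [norm_mul, Complex.norm_real, Real.norm_of_nonneg (expInv_pos _ _).le]
    exact mul_le_mul_of_nonneg_right (ha i) (expInv_pos _ _).le
  refine (h.sum_le (fun i => (hv i).le) ht hM (c := M * (c * t ^ 2)) (by positivity)
    (fun i _ => ?_) (fun i _ => ?_) J).trans (le_of_eq ?_)
  · refine (hn i).trans (mul_le_of_le_one_right hM (expInv_le_one _ (mul_pos ht (hv i))))
  · refine (hn i).trans ?_
    have := mul_le_mul_of_nonneg_left (hc _ (mul_pos ht (hv i))) hM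
    refine this.trans (le_of_eq ?_)
    ring
  · field_simp

theorem summable_heat (h : WeakCount v C) (hv : ∀ i, 0 < v i) {a : ι → ℂ} {M : ℝ}
    (hM : 0 ≤ M) (ha : ∀ i, ‖a i‖ ≤ M) {q : ℝ} (hq : 0 < q) {t : ℝ} (ht : 0 < t) :
    Summable fun i => a i * (expInv q (t * v i) : ℂ) := by
  obtain ⟨c, hc0, hc⟩ := exists_expInv_le hq
  exact (summable_of_sum_le (fun _ => norm_nonneg _)
    (sum_norm_heat_le h hv hM ha hc0 hc ht)).of_norm

theorem exists_norm_heatSum_le (h : WeakCount v C) (hv : ∀ i, 0 < v i) {a : ι → ℂ} {M : ℝ}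
    (hM : 0 ≤ M) (ha : ∀ i, ‖a i‖ ≤ M) {q : ℝ} (hq : 0 < q) :
    ∃ K : ℝ, ∀ t : ℝ, 0 < t → ‖heatSum v a q t‖ ≤ K := by
  obtain ⟨c, hc0, hc⟩ := exists_expInv_le hq
  refine ⟨M * C * (1 + 2 * c), fun t ht => ?_⟩
  have h1 := norm_le_of_hasSum (summable_heat h hv hM ha hq ht).hasSum
    (sum_norm_heat_le h hv hM ha hc0 hc ht)
  rw [heatSum, norm_mul, norm_inv, Complex.norm_real, Real.norm_of_nonneg ht.le,
    inv_mul_le_iff₀ ht]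
  linarith

theorem continuousOn_expInv_mul (q : ℝ) {x : ℝ} (hx : 0 < x) :
    ContinuousOn (fun t => expInv q (t * x)) (Set.Ioi 0) :=
  (continuousOn_expInv q).comp (continuous_mul_const x).continuousOn
    fun _ ht => mul_pos ht hx

theorem continuousOn_heatSum (h : WeakCount v C) (hv : ∀ i, 0 < v i) (hv1 : ∀ i, v i ≤ 1)
    {a : ι → ℂ} {M : ℝ} (hM : 0 ≤ M) (ha : ∀ i, ‖a i‖ ≤ M) {q : ℝ} (hq : 0 < q) :
    ContinuousOn (heatSum v a q) (Set.Ioi 0) := by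
  obtain ⟨c, hc0, hc⟩ := exists_expInv_le hq
  have hcont : ∀ i, ContinuousOn (fun t : ℝ => a i * (expInv q (t * v i) : ℂ)) (Set.Ioi 0) :=
    fun i => continuousOn_const.mul
      (Complex.continuous_ofReal.comp_continuousOn (continuousOn_expInv_mul q (hv i)))
  have hsum : ContinuousOn (fun t : ℝ => ∑' i, a i * (expInv q (t * v i) : ℂ)) (Set.Ioi 0) := by
    intro t ht
    have ht0 : 0 < t := ht
    have h1 : ContinuousOn (fun t : ℝ => ∑' i, a i * (expInv q (t * v i) : ℂ))
        (Set.Ioo 0 (t + 1)) := by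
      refine continuousOn_tsum (u := fun i => M * c * (t + 1) ^ 2 * v i ^ 2)
        (fun i => (hcont i).mono Set.Ioo_subset_Ioi_self)
        ((h.summable_sq (fun i => (hv i).le) hv1).mul_left _) fun i s hs => ?_
      rw [norm_mul, Complex.norm_real, Real.norm_of_nonneg (expInv_pos _ _).le]
      calc ‖a i‖ * expInv q (s * v i) ≤ M * (c * (s * v i) ^ 2) :=
            mul_le_mul (ha i) (hc _ (mul_pos hs.1 (hv i))) (expInv_pos _ _).le hM
        _ = M * c * s ^ 2 * v i ^ 2 := by ring
        _ ≤ _ := by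
          have := hs.1; have := hs.2
          gcongr
    exact (h1.continuousAt (Ioo_mem_nhds ht0 (by linarith))).continuousWithinAt
  exact ((Complex.continuous_ofReal.continuousOn).inv₀ fun t (ht : 0 < t) => by
    exact_mod_cast ht.ne').mul hsum

theorem hasSum_integral_heatSum (h : WeakCount v C) (hv : ∀ i, 0 < v i) (hv1 : ∀ i, v i ≤ 1)
    {a : ι → ℂ} {M : ℝ} (hM : 0 ≤ M) (ha : ∀ i, ‖a i‖ ≤ M) {q : ℝ} (hq : 0 < q) {t : ℝ}
    (ht : 1 ≤ t) :
    HasSum (fun i => a i * ((∫ s in (1 : ℝ)..t, expInv q (s * v i) / s ^ 2 : ℝ) : ℂ))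
      (∫ s in (1 : ℝ)..t, heatSum v a q s / (s : ℂ)) := by
  obtain ⟨c, hc0, hc⟩ := exists_expInv_le hq
  -- the members are positive and square summable
  have hcount : Countable ι := by
    have h1 := (h.summable_sq (fun i => (hv i).le) hv1).countable_support
    rw [Function.support_eq_univ fun i => by have := hv i; positivity] at h1
    exact Set.countable_univ_iff.1 h1
  have hsub : Set.uIoc (1 : ℝ) t ⊆ Set.Ioi 0 := by
    rw [Set.uIoc_of_le ht]
    exact fun s hs => zero_lt_one.trans hs.1
  have h2 : ∀ i, a i * ((∫ s in (1 : ℝ)..t, expInv q (s * v i) / s ^ 2 : ℝ) : ℂ)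
      = ∫ s in (1 : ℝ)..t, a i * ((expInv q (s * v i) / s ^ 2 : ℝ) : ℂ) := fun i => by
    rw [intervalIntegral.integral_const_mul, intervalIntegral.integral_ofReal]
  simp only [h2]
  refine intervalIntegral.hasSum_integral_of_dominated_convergence
    (fun i _ => M * c * v i ^ 2) (fun i => ?_) (fun i => ?_) ?_ ?_ ?_
  · refine ContinuousOn.aestronglyMeasurable ?_ measurableSet_uIoc
    refine continuousOn_const.mul (Complex.continuous_ofReal.comp_continuousOn ?_)
    exact ((continuousOn_expInv_mul q (hv i)).div (continuousOn_pow 2)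
      fun s (hs : 0 < s) => by positivity).mono hsub
  · refine Filter.Eventually.of_forall fun s hs => ?_
    have hs0 : 0 < s := hsub hs
    rw [norm_mul, Complex.norm_real,
      Real.norm_of_nonneg (div_nonneg (expInv_pos _ _).le (sq_nonneg s)), mul_assoc]
    refine mul_le_mul (ha i) ?_ (div_nonneg (expInv_pos _ _).le (sq_nonneg s)) hM
    rw [div_le_iff₀ (by positivity)]
    refine (hc _ (mul_pos hs0 (hv i))).trans (le_of_eq (by ring))
  · exact Filter.Eventually.of_forall fun s _ =>
      (h.summable_sq (fun i => (hv i).le) hv1).mul_left _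
  · simp
  · refine Filter.Eventually.of_forall fun s hs => ?_
    have hs0 : 0 < s := hsub hs
    have h3 := (summable_heat h hv hM ha hq hs0).hasSum.mul_left ((s : ℂ)⁻¹ * (s : ℂ)⁻¹)
    have h4 : heatSum v a q s / (s : ℂ)
        = (s : ℂ)⁻¹ * (s : ℂ)⁻¹ * ∑' i, a i * (expInv q (s * v i) : ℂ) := by
      rw [heatSum]; ring
    rw [h4]
    refine h3.congr_fun fun i => ?_
    push_cast
    ring

/-- The logarithmic mean of the heat sum is `Γ(1 + 1/q)` times the sum of `a i * v i` over the
indices with `v i > 1 / t`, up to a bounded error (before the division by `log t`). Termwise, the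
integral of `exp(-(s v)^(-q)) / s²` over `1 ≤ s ≤ t` is nearly `Γ(1 + 1/q) v` for `v > 1 / t` and
nearly `0` otherwise. -/
theorem exists_norm_integral_heatSum_sub_le (h : WeakCount v C) (hv : ∀ i, 0 < v i)
    (hv1 : ∀ i, v i ≤ 1) {a : ι → ℂ} {M : ℝ} (hM : 0 ≤ M) (ha : ∀ i, ‖a i‖ ≤ M) {q : ℝ}
    (hq : 0 < q) :
    ∃ K : ℝ, ∀ t : ℝ, 1 ≤ t → ∀ ht : 0 < t⁻¹,
      ‖(∫ s in (1 : ℝ)..t, heatSum v a q s / (s : ℂ))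
        - (Real.Gamma (1 + 1 / q) : ℂ) * ∑ i ∈ h.big ht, (v i : ℂ) * a i‖ ≤ K := by
  classical
  obtain ⟨c, hc0, hc⟩ := exists_expInv_le hq
  set G := Real.Gamma (1 + 1 / q) with hG
  refine ⟨M * c * (2 * C * 1) + (M * (C * 1) + M * c * (2 * C)), fun t ht1 ht => ?_⟩
  have ht0 : 0 < t := by linarith
  have hs1 := hasSum_integral_heatSum h hv hv1 hM ha hq ht1
  have hs2 : HasSum (fun i => if i ∈ h.big ht then (G : ℂ) * ((v i : ℂ) * a i) else 0)
      ((G : ℂ) * ∑ i ∈ h.big ht, (v i : ℂ) * a i) := by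
    rw [Finset.mul_sum]
    have h1 : HasSum (fun i => if i ∈ h.big ht then (G : ℂ) * ((v i : ℂ) * a i) else 0)
        (∑ i ∈ h.big ht, if i ∈ h.big ht then (G : ℂ) * ((v i : ℂ) * a i) else 0) :=
      hasSum_sum_of_ne_finset_zero fun i hi => if_neg hi
    rwa [Finset.sum_congr rfl fun i hi => if_pos hi] at h1
  have hC := h.nonneg
  refine norm_le_of_hasSum (hs1.sub hs2) fun J => ?_
  -- the errors are `c v² + 1 / t` above the threshold and `c t v²` below
  have hterm : ∀ i, ‖a i * ((∫ s in (1 : ℝ)..t, expInv q (s * v i) / s ^ 2 : ℝ) : ℂ)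
      - (if i ∈ h.big ht then (G : ℂ) * ((v i : ℂ) * a i) else 0)‖
      ≤ M * c * v i ^ 2 + (if t⁻¹ < v i then M * t⁻¹ else M * c * t * v i ^ 2) := by
    intro i
    simp only [WeakCount.mem_big]
    split_ifs with hi
    · have h1 := abs_integral_expInv_sub_Gamma_le hq hc (hv i) ht1
      have h2 : a i * ((∫ s in (1 : ℝ)..t, expInv q (s * v i) / s ^ 2 : ℝ) : ℂ)
          - (G : ℂ) * ((v i : ℂ) * a i)
          = a i * (((∫ s in (1 : ℝ)..t, expInv q (s * v i) / s ^ 2) - G * v i : ℝ) : ℂ) := by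
        push_cast; ring
      rw [h2, norm_mul, Complex.norm_real, Real.norm_eq_abs]
      calc _ ≤ M * (c * v i ^ 2 + t⁻¹) := mul_le_mul (ha i) h1 (abs_nonneg _) hM
        _ = _ := by ring
    · have h1 := abs_integral_expInv_le hc0 hc (hv i) ht1
      rw [sub_zero, norm_mul, Complex.norm_real, Real.norm_eq_abs]
      calc _ ≤ M * (c * t * v i ^ 2) := mul_le_mul (ha i) h1 (abs_nonneg _) hM
        _ ≤ _ := by
          have : 0 ≤ M * c * v i ^ 2 := by positivity
          linarith
  refine (Finset.sum_le_sum fun i _ => hterm i).trans ?_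
  rw [Finset.sum_add_distrib]
  refine add_le_add ?_ ?_
  · rw [← Finset.mul_sum]
    exact mul_le_mul_of_nonneg_left
      (h.sum_sq_le (fun i => (hv i).le) zero_le_one fun i _ => hv1 i) (by positivity)
  · refine (h.sum_le (fun i => (hv i).le) ht0 (A := M * t⁻¹) (c := M * c * t) (by positivity)
      (by positivity) (fun i hi => by rw [if_pos hi]) (fun i hi => by rw [if_neg (not_lt.2 hi)])
      J).trans (le_of_eq ?_)
    field_simp

end HeatSum

/-! ### States on `L_∞(0, ∞)` -/

section Evaluation

open MeasureTheory

theorem LinftyState.eval_of_memLp (ω : LinftyState) {x : ℝ → ℂ} (hx : MemLp x ∞ halfLine) :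
    ω.eval x = ω.toLinearMap (hx.toLp x) := by
  rw [LinftyState.eval, dif_pos hx]

theorem LinftyState.eval_add (ω : LinftyState) {x y : ℝ → ℂ} (hx : MemLp x ∞ halfLine)
    (hy : MemLp y ∞ halfLine) : ω.eval (x + y) = ω.eval x + ω.eval y := by
  rw [ω.eval_of_memLp hx, ω.eval_of_memLp hy, ω.eval_of_memLp (hx.add hy), MemLp.toLp_add,
    map_add]

theorem LinftyState.eval_smul (ω : LinftyState) (c : ℂ) {x : ℝ → ℂ} (hx : MemLp x ∞ halfLine) :
    ω.eval (c • x) = c * ω.eval x := by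
  rw [ω.eval_of_memLp hx, ω.eval_of_memLp (hx.const_smul c), MemLp.toLp_const_smul,
    map_smul, smul_eq_mul]

theorem LinftyState.eval_sub (ω : LinftyState) {x y : ℝ → ℂ} (hx : MemLp x ∞ halfLine)
    (hy : MemLp y ∞ halfLine) : ω.eval (x - y) = ω.eval x - ω.eval y := by
  have h1 : x - y = x + (-1 : ℂ) • y := by simp [sub_eq_add_neg]
  rw [h1, ω.eval_add hx (hy.const_smul _), ω.eval_smul _ hy]
  ring

theorem LinftyState.IsLimitAtInfinity.eval_congr {ω : LinftyState} (hω : ω.IsLimitAtInfinity)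
    {x y : ℝ → ℂ} (hx : MemLp x ∞ halfLine) (hy : MemLp y ∞ halfLine)
    (h : Filter.Tendsto (x - y) Filter.atTop (𝓝 0)) : ω.eval x = ω.eval y := by
  rw [← sub_eq_zero, ← ω.eval_sub hx hy]
  exact hω _ (hx.sub hy) h

theorem LinftyState.IsLimitAtInfinity.eval_eq_of_tendsto {ω : LinftyState}
    (hω : ω.IsLimitAtInfinity) {x : ℝ → ℂ} (hx : MemLp x ∞ halfLine) {c : ℂ}
    (h : Filter.Tendsto x Filter.atTop (𝓝 c)) : ω.eval x = c := by
  have h1 : ω.eval (fun _ => (1 : ℂ)) = 1 := by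
    rw [ω.eval_of_memLp (memLp_top_const 1), ω.map_one]
  have h2 : ω.eval (c • fun _ => (1 : ℂ)) = c := by
    rw [ω.eval_smul c (memLp_top_const 1), h1, mul_one]
  rw [← h2]
  refine hω.eval_congr hx ((memLp_top_const (1 : ℂ)).const_smul c) ?_
  have h3 := h.sub_const c
  rw [sub_self] at h3
  exact h3.congr fun t => by simp

theorem memLp_halfLine {x : ℝ → ℂ} (hx : AEStronglyMeasurable x halfLine) {K : ℝ}
    (hK : ∀ t : ℝ, 0 < t → ‖x t‖ ≤ K) : MemLp x ∞ halfLine :=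
  memLp_top_of_bound hx K ((ae_restrict_iff' measurableSet_Ioi).2
    (Filter.Eventually.of_forall fun t ht => hK t ht))

theorem uIcc_one_subset_Ioi {t : ℝ} (ht : 0 < t) : Set.uIcc 1 t ⊆ Set.Ioi 0 :=
  fun _ hs => (lt_min zero_lt_one ht).trans_le hs.1

theorem norm_logMean_le {x : ℝ → ℂ} {K : ℝ} (hK : ∀ t : ℝ, 0 < t → ‖x t‖ ≤ K) {t : ℝ}
    (ht : 0 < t) : ‖logMean x t‖ ≤ K := by
  have hK0 : 0 ≤ K := (norm_nonneg _).trans (hK 1 one_pos)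
  have h1 : ‖∫ s in (1 : ℝ)..t, x s / (s : ℂ)‖ ≤ |∫ s in (1 : ℝ)..t, K * s⁻¹| := by
    refine intervalIntegral.norm_integral_le_abs_of_norm_le ?_ ?_
    · refine (ae_restrict_iff' measurableSet_uIoc).2 (Filter.Eventually.of_forall fun s hs => ?_)
      have hs0 : 0 < s := uIcc_one_subset_Ioi ht (Set.uIoc_subset_uIcc hs)
      rw [norm_div, Complex.norm_real, Real.norm_of_nonneg hs0.le, div_eq_mul_inv]
      exact mul_le_mul_of_nonneg_right (hK s hs0) (inv_nonneg.2 hs0.le)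
    · refine ContinuousOn.intervalIntegrable (continuousOn_const.mul ?_)
      exact continuousOn_inv₀.mono fun s hs => (uIcc_one_subset_Ioi ht hs).ne'
  rw [intervalIntegral.integral_const_mul, integral_inv_of_pos one_pos ht, div_one, abs_mul,
    abs_of_nonneg hK0] at h1
  rw [logMean, norm_mul, norm_div, norm_one, Complex.norm_real, Real.norm_eq_abs]
  rcases eq_or_ne (Real.log t) 0 with h0 | h0
  · simpa [h0] using hK0
  · rw [div_mul_eq_mul_div, one_mul, div_le_iff₀ (abs_pos.2 h0)]
    exact h1

theorem memLp_logMean {x : ℝ → ℂ} (hx : ContinuousOn x (Set.Ioi 0)) {K : ℝ}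
    (hK : ∀ t : ℝ, 0 < t → ‖x t‖ ≤ K) : MemLp (logMean x) ∞ halfLine := by
  have hcont : ContinuousOn (fun s : ℝ => x s / (s : ℂ)) (Set.Ioi 0) :=
    hx.div Complex.continuous_ofReal.continuousOn fun s (hs : 0 < s) => by exact_mod_cast hs.ne'
  have hint : ContinuousOn (fun t : ℝ => ∫ s in (1 : ℝ)..t, x s / (s : ℂ)) (Set.Ioi 0) := by
    intro t ht
    exact (intervalIntegral.integral_hasDerivAt_right
      (hcont.mono (uIcc_one_subset_Ioi ht)).intervalIntegrable
      (hcont.stronglyMeasurableAtFilter isOpen_Ioi t ht)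
      (hcont.continuousAt (Ioi_mem_nhds ht))).continuousAt.continuousWithinAt
  refine memLp_halfLine ?_ fun t ht => norm_logMean_le hK ht
  refine AEStronglyMeasurable.mul ?_ (hint.aestronglyMeasurable measurableSet_Ioi)
  exact (Measurable.div measurable_const
    (Complex.measurable_ofReal.comp Real.measurable_log)).aestronglyMeasurable

theorem continuous_integral_singularValue {H : Type*} [NormedAddCommGroup H]
    [InnerProductSpace ℂ H] (A : H →L[ℂ] H) :
    Continuous fun t : ℝ => ∫ s in (0 : ℝ)..t, singularValue ⌊s⌋₊ A :=
  intervalIntegral.continuous_primitive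
    (fun a b => intervalIntegrable_singularValue A a b) 0

/-- The logarithmic means of the singular values of an operator in `L_{1,∞}` are bounded. -/
theorem MemWeakL1.memLp_dixmierMean {H : Type*} [NormedAddCommGroup H] [InnerProductSpace ℂ H]
    {A : H →L[ℂ] H} (hA : MemWeakL1 A) :
    MemLp (fun t => (dixmierMean A t : ℂ)) ∞ halfLine := by
  obtain ⟨C, hC⟩ := hA
  have hC0 : 0 ≤ C := by simpa using (singularValue_nonneg 0 A).trans (hC 0)
  refine memLp_halfLine (K := 2 * C) ?_ fun t ht => ?_
  · refine (Complex.measurable_ofReal.comp ?_).aestronglyMeasurable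
    refine Measurable.mul ?_ (continuous_integral_singularValue A).measurable
    exact measurable_const.div (Real.measurable_log.comp (measurable_const_add 1))
  · have hlog : 0 < Real.log (1 + t) := Real.log_pos (by linarith)
    have h0 : 0 ≤ ∫ s in (0 : ℝ)..t, singularValue ⌊s⌋₊ A :=
      intervalIntegral.integral_nonneg ht.le fun s _ => singularValue_nonneg _ _
    have h1 : ∫ s in (0 : ℝ)..t, singularValue ⌊s⌋₊ A
        ≤ ∫ s in (0 : ℝ)..t, 2 * C * (1 + s)⁻¹ := by
      refine intervalIntegral.integral_mono_on ht.le (intervalIntegrable_singularValue _ _ _)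
        ?_ fun s hs => ?_
      · refine ContinuousOn.intervalIntegrable (continuousOn_const.mul ?_)
        refine ContinuousOn.inv₀ (by fun_prop) fun s hs => ?_
        rw [Set.uIcc_of_le ht.le] at hs
        linarith [hs.1]
      · refine (hC _).trans ?_
        have hs0 := hs.1
        rw [← div_eq_mul_inv, div_le_div_iff₀ (by positivity) (by linarith)]
        have h2 : 1 + s ≤ 2 * ((⌊s⌋₊ : ℝ) + 1) := by
          have := Nat.lt_floor_add_one s
          have : (0 : ℝ) ≤ ⌊s⌋₊ := Nat.cast_nonneg _
          linarith
        nlinarith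
    have h2 : ∫ s in (0 : ℝ)..t, 2 * C * (1 + s)⁻¹ = 2 * C * Real.log (1 + t) := by
      rw [intervalIntegral.integral_const_mul,
        intervalIntegral.integral_comp_add_left (fun s => s⁻¹) 1,
        integral_inv_of_pos (by norm_num) (by linarith)]
      simp
    rw [Complex.norm_real, dixmierMean, Real.norm_of_nonneg (by positivity), one_div,
      inv_mul_le_iff₀ hlog]
    linarith

end Evaluation

/-! ### The heat kernel formula for Dixmier traces -/

section HeatFormula

variable {H : Type*} [NormedAddCommGroup H] [InnerProductSpace ℂ H] [CompleteSpace H] {ι : Type*}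

open MeasureTheory

theorem MemWeakL1.posPart {A : H →L[ℂ] H} (hA : IsSelfAdjoint A) (h : MemWeakL1 A) :
    MemWeakL1 A⁺ := by
  obtain ⟨w, g, α, hg⟩ := exists_eigenbasis_of_memWeakL1 hA h
  obtain ⟨C, hC⟩ := weakCount_of_memWeakL1 g.orthonormal hg h
  refine WeakCount.memWeakL1 g (C := C) (fun j => posPart_apply_eigenvector hA (hg j))
    (hC.mono fun j => ?_)
  rw [Complex.norm_real, Complex.norm_real, Real.norm_eq_abs, Real.norm_eq_abs,
    abs_of_nonneg (le_max_right _ _)]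
  exact max_le (le_abs_self _) (abs_nonneg _)

theorem MemWeakL1.negPart {A : H →L[ℂ] H} (hA : IsSelfAdjoint A) (h : MemWeakL1 A) :
    MemWeakL1 A⁻ := by
  rw [← CFC.posPart_neg]
  refine MemWeakL1.posPart hA.neg ?_
  have := h.mul_left (-1)
  rwa [neg_one_mul] at this

theorem exists_abs_dixmierMean_realPart_sub_le (b : HilbertBasis ι ℂ H) {V : H →L[ℂ] H}
    {v : ι → ℝ} (hV : ∀ i, V (b i) = (v i : ℂ) • b i) (hv : ∀ i, 0 ≤ v i) {C : ℝ}
    (h : WeakCount v C) (T : H →L[ℂ] H) :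
    ∃ K : ℝ, ∀ t : ℝ, 1 ≤ t → ∀ ht : 0 < t⁻¹,
      |Real.log (1 + t) * (dixmierMean (realPart (T * V) : H →L[ℂ] H)⁺ t
        - dixmierMean (realPart (T * V) : H →L[ℂ] H)⁻ t)
        - (∑ i ∈ h.big ht, (v i : ℂ) * ⟪b i, T (b i)⟫_ℂ).re| ≤ K := by
  obtain ⟨K, hK⟩ := exists_abs_integral_realPart_sub_le b hV hv h T
  refine ⟨K, fun t ht1 ht => ?_⟩
  have hlog : Real.log (1 + t) ≠ 0 := (Real.log_pos (by linarith)).ne'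
  have h1 := hK t ht1 ht
  rw [dixmierMean, dixmierMean, ← mul_sub, ← mul_assoc, mul_one_div_cancel hlog, one_mul]
  exact h1

/-- Reduces statements on imaginary parts to ones on real parts, as `-i (T V) = (-i T) V`. -/
theorem imaginaryPart_eq_realPart (X : H →L[ℂ] H) :
    imaginaryPart X = realPart (-Complex.I • X) := by
  rw [neg_smul, map_neg, realPart_I_smul, neg_neg]

theorem norm_inner_apply_le {E κ : Type*} [NormedAddCommGroup E] [InnerProductSpace ℂ E]
    (b : HilbertBasis κ ℂ E) (T : E →L[ℂ] E) (i : κ) : ‖⟪b i, T (b i)⟫_ℂ‖ ≤ ‖T‖ := by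
  refine (norm_inner_le_norm _ _).trans ?_
  rw [b.orthonormal.1 i, one_mul]
  simpa [b.orthonormal.1 i] using T.le_opNorm (b i)

/-- The heat kernel formula for Dixmier traces. The logarithmic mean of the heat sum on the right is
asymptotic to `Γ(1 + 1/q)` times the function on which `ω` is evaluated to give the Dixmier trace,
and `ω` is invariant under the logarithmic mean. -/
theorem dixmierTrace_eq_eval_heatSum (b : HilbertBasis ι ℂ H) {V : H →L[ℂ] H}
    {v : ι → ℝ} (hV : ∀ i, V (b i) = (v i : ℂ) • b i) (hv : ∀ i, 0 < v i) (hv1 : ∀ i, v i ≤ 1)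
    {C : ℝ} (h : WeakCount v C) (T : H →L[ℂ] H) {q : ℝ} (hq : 0 < q) {ω : LinftyState}
    (hω : ω.IsLimitAtInfinity) (hM : ω.IsMeanInvariant) :
    (Real.Gamma (1 + 1 / q) : ℂ) * dixmierTrace ω (T * V)
      = ω.eval (heatSum v (fun i => ⟪b i, T (b i)⟫_ℂ) q) := by
  have hv0 : ∀ i, 0 ≤ v i := fun i => (hv i).le
  have hVmem : MemWeakL1 V := WeakCount.memWeakL1 b hV (C := C) (by
    simpa only [Complex.norm_real, Real.norm_of_nonneg (hv0 _)] using h)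
  have ha : ∀ i, ‖⟪b i, T (b i)⟫_ℂ‖ ≤ ‖T‖ := norm_inner_apply_le b T
  set G := Real.Gamma (1 + 1 / q) with hG
  set F := heatSum v (fun i => ⟪b i, T (b i)⟫_ℂ) q with hF
  have hFcont : ContinuousOn F (Set.Ioi 0) := continuousOn_heatSum h hv hv1 (norm_nonneg T) ha hq
  obtain ⟨K₀, hK₀⟩ := exists_norm_heatSum_le h hv (norm_nonneg T) ha hq
  have hFmem : MemLp F ∞ halfLine :=
    memLp_halfLine (hFcont.aestronglyMeasurable measurableSet_Ioi) hK₀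
  have hLmem : MemLp (logMean F) ∞ halfLine := memLp_logMean hFcont hK₀
  have hiT : -Complex.I • (T * V) = (-Complex.I • T) * V := by rw [smul_mul_assoc]
  set A : H →L[ℂ] H := (realPart (T * V) : H →L[ℂ] H) with hA
  set B : H →L[ℂ] H := (imaginaryPart (T * V) : H →L[ℂ] H) with hB
  have hB' : B = (realPart ((-Complex.I • T) * V) : H →L[ℂ] H) := by
    rw [hB, imaginaryPart_eq_realPart, hiT]
  have hAsa : IsSelfAdjoint A := (realPart (T * V)).2
  have hBsa : IsSelfAdjoint B := (imaginaryPart (T * V)).2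
  have hAmem : MemWeakL1 A := MemWeakL1.realPart_mul b hV hVmem T
  have hBmem : MemWeakL1 B := hB' ▸ MemWeakL1.realPart_mul b hV hVmem _
  have m1 := (hAmem.posPart hAsa).memLp_dixmierMean
  have m2 := (hAmem.negPart hAsa).memLp_dixmierMean
  have m3 := (hBmem.posPart hBsa).memLp_dixmierMean
  have m4 := (hBmem.negPart hBsa).memLp_dixmierMean
  set x1 : ℝ → ℂ := fun t => (dixmierMean A⁺ t : ℂ)
  set x2 : ℝ → ℂ := fun t => (dixmierMean A⁻ t : ℂ)
  set x3 : ℝ → ℂ := fun t => (dixmierMean B⁺ t : ℂ)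
  set x4 : ℝ → ℂ := fun t => (dixmierMean B⁻ t : ℂ)
  set d : ℝ → ℂ := (x1 - x2) + Complex.I • (x3 - x4) with hd
  have hdmem : MemLp d ∞ halfLine := (m1.sub m2).add ((m3.sub m4).const_smul _)
  have htrace : dixmierTrace ω (T * V) = ω.eval d := by
    rw [hd, ω.eval_add (m1.sub m2) ((m3.sub m4).const_smul _), ω.eval_smul _ (m3.sub m4),
      ω.eval_sub m1 m2, ω.eval_sub m3 m4]
    rfl
  rw [htrace, ← ω.eval_smul _ hdmem, ← hM F hFmem]
  refine hω.eval_congr (hdmem.const_smul _) hLmem ?_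
  obtain ⟨K₁, hK₁⟩ := exists_abs_dixmierMean_realPart_sub_le b hV hv0 h T
  obtain ⟨K₂, hK₂⟩ := exists_abs_dixmierMean_realPart_sub_le b hV hv0 h (-Complex.I • T)
  obtain ⟨K₃, hK₃⟩ := exists_norm_integral_heatSum_sub_le h hv hv1 (norm_nonneg T) ha hq
  have hG0 : 0 < G := Real.Gamma_pos_of_pos (by positivity)
  have hG' : ‖(G : ℂ)‖ = G := by rw [Complex.norm_real, Real.norm_of_nonneg hG0.le]
  have hbound : ∀ t : ℝ, 2 ≤ t →
      ‖((G : ℂ) • d - logMean F) t‖ ≤ (G * (K₁ + K₂) + K₃ + K₀) / Real.log (1 + t) := by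
    intro t ht2
    have ht0 : 0 < t := by linarith
    have ht1 : 1 ≤ t := by linarith
    have hti : 0 < t⁻¹ := inv_pos.2 ht0
    have hl0 : 0 < Real.log t := Real.log_pos (by linarith)
    have hl1 : 0 < Real.log (1 + t) := Real.log_pos (by linarith)
    set S : ℂ := ∑ i ∈ h.big hti, (v i : ℂ) * ⟪b i, T (b i)⟫_ℂ with hS
    have e1 : |Real.log (1 + t) * (dixmierMean A⁺ t - dixmierMean A⁻ t) - S.re| ≤ K₁ :=
      hK₁ t ht1 hti
    have e2 := hK₂ t ht1 hti
    have e3 : ‖(∫ s in (1 : ℝ)..t, F s / (s : ℂ)) - (G : ℂ) * S‖ ≤ K₃ := hK₃ t ht1 hti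
    -- the real part of the partial trace of `-i T V` is the imaginary part of that of `T V`
    have hS2 : (∑ i ∈ h.big hti, (v i : ℂ) * ⟪b i, (-Complex.I • T) (b i)⟫_ℂ).re = S.im := by
      have : ∑ i ∈ h.big hti, (v i : ℂ) * ⟪b i, (-Complex.I • T) (b i)⟫_ℂ = -Complex.I * S := by
        rw [hS, Finset.mul_sum]
        refine Finset.sum_congr rfl fun i _ => ?_
        rw [smul_apply, inner_smul_right]
        ring
      rw [this]; simp
    rw [hS2, ← hB'] at e2
    have hdS : ‖(Real.log (1 + t) : ℂ) * d t - S‖ ≤ K₁ + K₂ := by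
      refine (Complex.norm_le_abs_re_add_abs_im _).trans (add_le_add ?_ ?_)
      · refine le_trans (le_of_eq (congrArg _ ?_)) e1
        simp [hd, x1, x2, x3, x4, Complex.mul_re]
      · refine le_trans (le_of_eq (congrArg _ ?_)) e2
        simp [hd, x1, x2, x3, x4, Complex.mul_im]
    have hL : (Real.log t : ℂ) * logMean F t = ∫ s in (1 : ℝ)..t, F s / (s : ℂ) := by
      rw [logMean, ← mul_assoc, mul_one_div_cancel (by exact_mod_cast hl0.ne'), one_mul]
    rw [← hL] at e3
    -- `dixmierMean` divides by `log (1 + t)`, but `logMean` by `log t`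
    have hlog : |Real.log (1 + t) - Real.log t| ≤ 1 := by
      rw [abs_of_nonneg (sub_nonneg.2 (Real.log_le_log ht0 (by linarith))),
        ← Real.log_div (by linarith) ht0.ne']
      refine (Real.log_le_sub_one_of_pos (by positivity)).trans ?_
      rw [sub_le_iff_le_add, div_le_iff₀ ht0]
      linarith
    have hdec : (Real.log (1 + t) : ℂ) * ((G : ℂ) • d - logMean F) t
        = (G : ℂ) * ((Real.log (1 + t) : ℂ) * d t - S)
          - ((Real.log t : ℂ) * logMean F t - (G : ℂ) * S)
          - ((Real.log (1 + t) - Real.log t : ℝ) : ℂ) * logMean F t := by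
      simp only [Pi.sub_apply, Pi.smul_apply, smul_eq_mul, Complex.ofReal_sub]
      ring
    have hnorm : ‖(Real.log (1 + t) : ℂ) * ((G : ℂ) • d - logMean F) t‖
        ≤ G * (K₁ + K₂) + K₃ + K₀ := by
      rw [hdec]
      refine (norm_sub_le _ _).trans (add_le_add ((norm_sub_le _ _).trans (add_le_add ?_ e3)) ?_)
      · rw [norm_mul, hG']
        exact mul_le_mul_of_nonneg_left hdS hG0.le
      · rw [norm_mul, Complex.norm_real, Real.norm_eq_abs]
        exact (mul_le_of_le_one_left (norm_nonneg _) hlog).trans (norm_logMean_le hK₀ ht0)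
    rw [norm_mul, Complex.norm_real, Real.norm_of_nonneg hl1.le] at hnorm
    rw [le_div_iff₀ hl1]
    linarith
  refine squeeze_zero_norm' (Filter.eventually_atTop.2 ⟨2, hbound⟩) ?_
  refine tendsto_const_nhds.div_atTop (Real.tendsto_log_atTop.comp ?_)
  exact Filter.tendsto_atTop_add_const_left _ _ Filter.tendsto_id

end HeatFormula

/-! ### Unbounded operators with compact resolvent -/

section Unbounded

variable {H : Type*} [NormedAddCommGroup H] [InnerProductSpace ℂ H]

theorem inner_graph_symm {A : H →ₗ.[ℂ] H} (hA : A.IsFormalAdjoint A) {x y x' y' : H}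
    (h : (x, y) ∈ A.graph) (h' : (x', y') ∈ A.graph) : ⟪y, x'⟫_ℂ = ⟪x, y'⟫_ℂ := by
  obtain ⟨u, rfl, rfl⟩ := (LinearPMap.mem_graph_iff A).1 h
  obtain ⟨w, rfl, rfl⟩ := (LinearPMap.mem_graph_iff A).1 h'
  exact hA u w

/-- A symmetric operator has no eigenvalue on the imaginary axis except `0`. -/
theorem eq_zero_of_graph_imaginary {D : H →ₗ.[ℂ] H} (hD : D.IsFormalAdjoint D) {x : H} {c : ℝ}
    (hc : c ≠ 0) (h : (x, ((c : ℂ) * Complex.I) • x) ∈ D.graph) : x = 0 := by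
  have h1 := inner_graph_symm hD h h
  rw [inner_smul_left, inner_smul_right, map_mul, Complex.conj_ofReal, Complex.conj_I] at h1
  have h2 : (2 * (c : ℂ) * Complex.I) * ⟪x, x⟫_ℂ = 0 := by linear_combination -h1
  have hc' : (c : ℂ) ≠ 0 := by exact_mod_cast hc
  simpa [hc', Complex.I_ne_zero] using h2

theorem resolvent_injective {D : H →ₗ.[ℂ] H} {R : H →L[ℂ] H}
    (hR : ∀ x, (R x, x - Complex.I • R x) ∈ D.graph) {x : H}
    (hx : R x = 0) : x = 0 := by
  have h := hR x
  rw [hx, smul_zero, sub_zero] at h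
  exact LinearPMap.graph_fst_eq_zero_snd D h rfl

theorem isClosed_eigenspace {A : H →ₗ.[ℂ] H} (hA : A.IsClosed) (r : ℝ) :
    IsClosed (eigenspace A r : Set H) :=
  IsClosed.preimage (f := fun x : H => (x, (r : ℂ) • x)) (by fun_prop) hA

/-- `R (D + i) w = w` for `w` in the domain of `D`. The graph condition on `R` says only that
`(D + i) R = 1`; that `R` is also a left inverse follows from the symmetry of `D`. -/
theorem resolvent_apply_add {D : H →ₗ.[ℂ] H} {R : H →L[ℂ] H} (hD : D.IsFormalAdjoint D)
    (hR : ∀ x, (R x, x - Complex.I • R x) ∈ D.graph) {w z : H} (h : (w, z) ∈ D.graph) :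
    R (z + Complex.I • w) = w := by
  have h1 := D.graph.sub_mem h (hR (z + Complex.I • w))
  have h2 : w - R (z + Complex.I • w) = 0 := by
    refine eq_zero_of_graph_imaginary hD (c := -1) (by norm_num) ?_
    convert h1 using 1
    simp only [Prod.mk_sub_mk, smul_sub, Complex.ofReal_neg, Complex.ofReal_one, neg_mul, one_mul,
      neg_smul, Prod.mk.injEq, true_and]
    abel
  exact (sub_eq_zero.1 h2).symm

/-- An eigenvector of `R` for `ρ` is one of `D` for `1 / ρ - i`, which is real as `D` is
symmetric. -/
theorem mem_iSup_eigenspace_of_resolvent {D : H →ₗ.[ℂ] H} {R : H →L[ℂ] H}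
    (hD : D.IsFormalAdjoint D)
    (hR : ∀ x, (R x, x - Complex.I • R x) ∈ D.graph) {x : H} {ρ : ℂ} (hx : R x = ρ • x) :
    x ∈ ⨆ r : ℝ, eigenspace D r := by
  rcases eq_or_ne x 0 with rfl | hx0
  · exact Submodule.zero_mem _
  have hρ : ρ ≠ 0 := fun h => hx0 (resolvent_injective hR (by rw [hx, h, zero_smul]))
  have h1 : (x, (ρ⁻¹ - Complex.I) • x) ∈ D.graph := by
    have h2 := D.graph.smul_mem ρ⁻¹ (hR x)
    rw [hx] at h2
    convert h2 using 1
    simp only [Prod.smul_mk, smul_sub, sub_smul, Prod.mk.injEq]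
    constructor
    · rw [smul_smul, inv_mul_cancel₀ hρ, one_smul]
    · congr 1
      rw [smul_smul, smul_smul]
      congr 1
      field_simp
  have h2 := inner_graph_symm hD h1 h1
  rw [inner_smul_left, inner_smul_right] at h2
  have h3 : (starRingEnd ℂ) (ρ⁻¹ - Complex.I) = ρ⁻¹ - Complex.I :=
    mul_right_cancel₀ (inner_self_ne_zero.2 hx0) h2
  rw [← Complex.conj_eq_iff_re.1 h3] at h1
  exact Submodule.mem_iSup_of_mem _ h1

variable [CompleteSpace H]

theorem eigenprojection_apply_eigenvector {A : H →ₗ.[ℂ] H} (hA : A.IsFormalAdjoint A) {x : H}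
    {r : ℝ} (hx : x ∈ eigenspace A r) (s : ℝ) [Decidable (s = r)] :
    eigenprojection A s x = if s = r then x else 0 := by
  have hx' : x ∈ (eigenspace A r).topologicalClosure := Submodule.le_topologicalClosure _ hx
  split_ifs with h
  · subst h
    exact Submodule.starProjection_eq_self_iff.2 hx'
  · refine (Submodule.starProjection_apply_eq_zero_iff _).2 ?_
    exact (Submodule.isOrtho_iff_le.1
      ((orthogonalFamily_eigenspace A hA).isOrtho (Ne.symm h))) hx'

/-- The functional calculus of a symmetric operator with an orthonormal eigenbasis acts on that
basis as expected. Only the values of `f` at the eigenvalues have to be bounded. -/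
theorem funCalc_apply_eigenvector {A : H →ₗ.[ℂ] H} (hA : A.IsFormalAdjoint A) {ι : Type*}
    (b : HilbertBasis ι ℂ H) {r : ι → ℝ} (hb : ∀ i, b i ∈ eigenspace A (r i)) {f : ℝ → ℝ} {C : ℝ}
    (hf : ∀ i, |f (r i)| ≤ C) (i : ι) : funCalc A f (b i) = (f (r i) : ℂ) • b i := by
  classical
  have hzero : ∀ s ∉ Set.range r, eigenprojection A s = 0 := fun s hs => by
    refine ContinuousLinearMap.ext_on
      (Submodule.dense_iff_topologicalClosure_eq_top.2 b.dense_span) ?_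
    rintro _ ⟨j, rfl⟩
    rw [eigenprojection_apply_eigenvector hA (hb j), if_neg fun h => hs ⟨j, h.symm⟩]
    rfl
  obtain ⟨B, hB⟩ := exists_hasSum_eigenprojection A hA
    (fun s => if s ∈ Set.range r then f s else 0) (max C 0) fun s => by
      split_ifs with h
      · obtain ⟨j, rfl⟩ := h
        exact (hf j).trans (le_max_left _ _)
      · simp
  have h : ∃ B : H →L[ℂ] H, ∀ x : H,
      HasSum (fun s : ℝ => (f s : ℂ) • eigenprojection A s x) (B x) :=
    ⟨B, fun x => (hB x).congr_fun fun s => by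
      by_cases hs : s ∈ Set.range r
      · rw [if_pos hs]
      · rw [hzero s hs]; simp⟩
  rw [funCalc, dif_pos h]
  refine (h.choose_spec (b i)).unique ?_
  have h1 : HasSum (fun s : ℝ => (f s : ℂ) • eigenprojection A s (b i))
      ((f (r i) : ℂ) • eigenprojection A (r i) (b i)) := by
    refine hasSum_single _ fun s hs => ?_
    rw [eigenprojection_apply_eigenvector hA (hb i), if_neg hs, smul_zero]
  rwa [eigenprojection_apply_eigenvector hA (hb i), if_pos rfl] at h1

theorem isFormalAdjoint_of_isSelfAdjoint {D : H →ₗ.[ℂ] H} (hD : IsSelfAdjoint D) :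
    D.IsFormalAdjoint D := by
  have h := LinearPMap.adjoint_isFormalAdjoint hD.dense_domain
  rwa [LinearPMap.isSelfAdjoint_def.1 hD] at h

theorem mem_graph_of_isSelfAdjoint {D : H →ₗ.[ℂ] H} (hD : IsSelfAdjoint D) {y y' : H}
    (h : ∀ w z, (w, z) ∈ D.graph → ⟪z, y⟫_ℂ = ⟪w, y'⟫_ℂ) : (y, y') ∈ D.graph := by
  have h1 := LinearPMap.adjoint_graph_eq_graph_adjoint hD.dense_domain
  rw [LinearPMap.isSelfAdjoint_def.1 hD] at h1
  rw [h1, Submodule.mem_adjoint_iff]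
  exact fun a b hab => sub_eq_zero.2 (h a b hab)

section Resolvent

variable {D : H →ₗ.[ℂ] H} {R : H →L[ℂ] H}

theorem adjoint_resolvent_mem_graph (hD : IsSelfAdjoint D)
    (hR : ∀ x, (R x, x - Complex.I • R x) ∈ D.graph) (y : H) :
    (star R y, y + Complex.I • star R y) ∈ D.graph := by
  refine mem_graph_of_isSelfAdjoint hD fun w z hwz => ?_
  have h1 : R z = w - Complex.I • R w := by
    have := resolvent_apply_add (isFormalAdjoint_of_isSelfAdjoint hD) hR hwz
    rw [map_add, map_smul] at this
    exact eq_sub_of_add_eq this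
  rw [ContinuousLinearMap.star_eq_adjoint, ContinuousLinearMap.adjoint_inner_right, h1,
    inner_sub_left, inner_smul_left, inner_add_right, inner_smul_right,
    ContinuousLinearMap.adjoint_inner_right, Complex.conj_I]
  ring

theorem adjoint_resolvent_apply_sub (hD : IsSelfAdjoint D)
    (hR : ∀ x, (R x, x - Complex.I • R x) ∈ D.graph) {w z : H} (h : (w, z) ∈ D.graph) :
    star R (z - Complex.I • w) = w := by
  have h1 := D.graph.sub_mem h (adjoint_resolvent_mem_graph hD hR (z - Complex.I • w))
  have h2 : w - star R (z - Complex.I • w) = 0 := by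
    refine eq_zero_of_graph_imaginary (isFormalAdjoint_of_isSelfAdjoint hD) (c := 1)
      one_ne_zero ?_
    convert h1 using 1
    simp only [Prod.mk_sub_mk, smul_sub, Complex.ofReal_one, one_mul, Prod.mk.injEq, true_and]
    abel
  exact (sub_eq_zero.1 h2).symm

/-- The resolvent identity for `R = (D + i)⁻¹` and `R* = (D - i)⁻¹`; `resolvent_adjoint_eq'` has the
factors in the other order, so that `R` is normal. -/
theorem resolvent_adjoint_eq (hD : IsSelfAdjoint D)
    (hR : ∀ x, (R x, x - Complex.I • R x) ∈ D.graph) (y : H) :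
    star R y = R y + (2 * Complex.I) • R (star R y) := by
  have h := resolvent_apply_add (isFormalAdjoint_of_isSelfAdjoint hD) hR
    (adjoint_resolvent_mem_graph hD hR y)
  conv_lhs => rw [← h]
  rw [add_assoc, ← add_smul, map_add, map_smul, two_mul]

theorem resolvent_adjoint_eq' (hD : IsSelfAdjoint D)
    (hR : ∀ x, (R x, x - Complex.I • R x) ∈ D.graph) (y : H) :
    star R y = R y + (2 * Complex.I) • star R (R y) := by
  have h := adjoint_resolvent_apply_sub hD hR (hR y)
  rw [sub_sub, ← add_smul, ← two_mul, map_sub, map_smul] at h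
  exact sub_eq_iff_eq_add.1 h

theorem resolvent_comm (hD : IsSelfAdjoint D)
    (hR : ∀ x, (R x, x - Complex.I • R x) ∈ D.graph) (y : H) :
    star R (R y) = R (star R y) := by
  have h := (resolvent_adjoint_eq' hD hR y).symm.trans (resolvent_adjoint_eq hD hR y)
  exact smul_right_injective H (show 2 * Complex.I ≠ 0 by simp) (add_left_cancel h)

/-- The eigenspaces of the compact injective operator `R* R` are finite dimensional and together
span a dense subspace. The normal operator `R` maps each of them to itself, and there it differs
from its real part by a scalar, so that they are spanned by eigenvectors of `R`, hence of `D`. -/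
theorem orthogonal_iSup_eigenspace_eq_bot (hD : IsSelfAdjoint D) (hRc : IsCompactOperator R)
    (hR : ∀ x, (R x, x - Complex.I • R x) ∈ D.graph) : (⨆ r : ℝ, eigenspace D r)ᗮ = ⊥ := by
  have hfa := isFormalAdjoint_of_isSelfAdjoint hD
  set K : H →L[ℂ] H := star R * R with hK
  have hKapp : ∀ x, K x = star R (R x) := fun x => rfl
  have hKsym : (K : H →ₗ[ℂ] H).IsSymmetric :=
    ContinuousLinearMap.isSelfAdjoint_iff_isSymmetric.1 (IsSelfAdjoint.star_mul_self R)
  have hKc : IsCompactOperator K := hRc.clm_comp (star R)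
  have hKinj : ∀ x, K x = 0 → x = 0 := fun x hx => by
    refine resolvent_injective hR ?_
    have h1 : ⟪R x, R x⟫_ℂ = 0 := by
      rw [← ContinuousLinearMap.adjoint_inner_right, ← ContinuousLinearMap.star_eq_adjoint,
        ← hKapp, hx, inner_zero_right]
    exact inner_self_eq_zero.1 h1
  have hle : ∀ μ, Module.End.eigenspace (K : H →ₗ[ℂ] H) μ ≤ ⨆ r : ℝ, eigenspace D r := by
    intro μ
    set E := Module.End.eigenspace (K : H →ₗ[ℂ] H) μ with hE
    have hmem : ∀ x, x ∈ E ↔ K x = μ • x := fun x => Module.End.mem_eigenspace_iff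
    rcases eq_or_ne μ 0 with hμ | hμ
    · intro x hx
      rw [hmem, hμ, zero_smul] at hx
      rw [hKinj x hx]
      exact Submodule.zero_mem _
    have hfin : FiniteDimensional ℂ E :=
      ContinuousLinearMap.finite_dimensional_eigenspace hKc μ hμ
    -- `S` is the real part of `R`, by the resolvent identity
    set S : H →L[ℂ] H := R + Complex.I • K with hS
    have hSstar : star S = S := by
      ext y
      have h1 := resolvent_adjoint_eq' hD hR y
      have h2 : star S = star R - Complex.I • K := by
        rw [hS, star_add, star_smul, hK, star_mul, star_star, Complex.star_def, Complex.conj_I,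
          neg_smul, ← sub_eq_add_neg]
      rw [h2, hS]
      simp only [sub_apply, add_apply, smul_apply, hKapp]
      rw [h1, mul_smul, two_smul]
      abel
    have hSsym : (S : H →ₗ[ℂ] H).IsSymmetric :=
      ContinuousLinearMap.isSelfAdjoint_iff_isSymmetric.1 hSstar
    have hSE : ∀ x ∈ E, (S : H →ₗ[ℂ] H) x ∈ E := by
      intro x hx
      rw [hmem] at hx ⊢
      have hRx : K (R x) = μ • R x := by
        rw [hKapp, resolvent_comm hD hR, ← hKapp, hx, map_smul]
      simp only [hS, ContinuousLinearMap.coe_coe, add_apply, smul_apply, map_add, map_smul, hRx, hx,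
        smul_add]
      rw [smul_comm]
    have hsym := hSsym.restrict_invariant hSE
    have htop := Submodule.orthogonal_eq_bot_iff.1 hsym.orthogonalComplement_iSup_eigenspaces_eq_bot
    have hmap : ∀ σ, (Module.End.eigenspace ((S : H →ₗ[ℂ] H).restrict hSE) σ).map E.subtype
        ≤ ⨆ r : ℝ, eigenspace D r := by
      rintro σ _ ⟨⟨x, hxE⟩, hxσ, rfl⟩
      have h1 : S x = σ • x := congrArg Subtype.val (Module.End.mem_eigenspace_iff.1 hxσ)
      refine mem_iSup_eigenspace_of_resolvent hfa hR (ρ := σ - Complex.I * μ) ?_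
      have h2 : R x = S x - Complex.I • K x := by simp [hS]
      change R x = (σ - Complex.I * μ) • x
      rw [h2, h1, (hmem x).1 hxE, sub_smul, mul_smul]
    intro x hx
    have hx' : (⟨x, hx⟩ : E) ∈ ⨆ σ, Module.End.eigenspace ((S : H →ₗ[ℂ] H).restrict hSE) σ := by
      rw [htop]; trivial
    have h3 := Submodule.mem_map_of_mem (f := E.subtype) hx'
    rw [Submodule.map_iSup] at h3
    exact (iSup_le hmap) h3
  rw [eq_bot_iff, ← ContinuousLinearMap.orthogonalComplement_iSup_eigenspaces_eq_bot hKc hKsym]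
  exact Submodule.orthogonal_le (iSup_le hle)

end Resolvent

/-- A self-adjoint operator with compact resolvent has an orthonormal eigenbasis. -/
theorem SpectralTriple.exists_eigenbasis (S : SpectralTriple H) :
    ∃ (w : ∀ r : ℝ, Set (eigenspace S.D r).topologicalClosure)
      (b : HilbertBasis (Σ r, w r) ℂ H) (r : (Σ r, w r) → ℝ), ∀ i, b i ∈ eigenspace S.D (r i) := by
  obtain ⟨R, hRc, hR⟩ := S.compact_resolvent
  have hfa := isFormalAdjoint_of_isSelfAdjoint S.isSelfAdjoint
  have hbot : (⨆ r : ℝ, (eigenspace S.D r).topologicalClosure)ᗮ = ⊥ := by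
    rw [eq_bot_iff, ← orthogonal_iSup_eigenspace_eq_bot S.isSelfAdjoint hRc hR]
    exact Submodule.orthogonal_le (iSup_mono fun r => Submodule.le_topologicalClosure _)
  obtain ⟨w, b, hb⟩ := exists_hilbertBasis_mem (fun r => (eigenspace S.D r).topologicalClosure)
    (orthogonalFamily_eigenspace S.D hfa) hbot
  refine ⟨w, b, fun i => i.1, fun i => ?_⟩
  rw [← (isClosed_eigenspace S.isSelfAdjoint.isClosed i.1).submodule_topologicalClosure_eq]
  exact hb i

end Unbounded

/-! ### The operator trace in an eigenbasis -/

section Trace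

variable {H : Type*} [NormedAddCommGroup H] [InnerProductSpace ℂ H] [CompleteSpace H] {ι : Type*}

/-- The trace of `T A`, for a diagonal operator `A` with summable eigenvalues, can be computed in
the eigenbasis of `A`. -/
theorem opTrace_mul_diagonal (b : HilbertBasis ι ℂ H) {A : H →L[ℂ] H} {α : ι → ℝ}
    (hA : ∀ i, A (b i) = (α i : ℂ) • b i) (hα : Summable fun i => |α i|) (T : H →L[ℂ] H) :
    opTrace (T * A) = ∑' i, (α i : ℂ) * ⟪b i, T (b i)⟫_ℂ := by
  rw [opTrace]
  set e := (exists_hilbertBasis ℂ H).choose_spec.choose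
  -- expand in both bases and interchange the sums
  have h1 : ∀ k, ⟪e k, (T * A) (e k)⟫_ℂ
      = ∑' i, (α i : ℂ) * (⟪b i, e k⟫_ℂ * ⟪e k, T (b i)⟫_ℂ) := fun k => by
    have h2 := b.tsum_inner_mul_inner (star T (e k)) (A (e k))
    have h3 : ⟪e k, (T * A) (e k)⟫_ℂ = ⟪star T (e k), A (e k)⟫_ℂ := by
      rw [ContinuousLinearMap.star_eq_adjoint, ContinuousLinearMap.adjoint_inner_left]; rfl
    rw [h3, ← h2]
    refine tsum_congr fun i => ?_
    rw [inner_diagonal_apply b hA, ContinuousLinearMap.star_eq_adjoint,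
      ContinuousLinearMap.adjoint_inner_left]
    ring
  have h4 : ∀ i, HasSum (fun k => (α i : ℂ) * (⟪b i, e k⟫_ℂ * ⟪e k, T (b i)⟫_ℂ))
      ((α i : ℂ) * ⟪b i, T (b i)⟫_ℂ) := fun i => (e.hasSum_inner_mul_inner _ _).mul_left _
  rw [tsum_congr h1, tsum_congr fun i => (h4 i).tsum_eq.symm]
  have hbd : ∀ i k, ‖(α i : ℂ) * (⟪b i, e k⟫_ℂ * ⟪e k, T (b i)⟫_ℂ)‖
      ≤ |α i| * (‖⟪e k, b i⟫_ℂ‖ ^ 2 + ‖⟪e k, T (b i)⟫_ℂ‖ ^ 2) := fun i k => by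
    rw [norm_mul, norm_mul, Complex.norm_real, Real.norm_eq_abs, norm_inner_symm (b i)]
    gcongr
    nlinarith [sq_nonneg (‖⟪e k, b i⟫_ℂ‖ - ‖⟪e k, T (b i)⟫_ℂ‖), sq_nonneg ‖⟪e k, b i⟫_ℂ‖,
      sq_nonneg ‖⟪e k, T (b i)⟫_ℂ‖]
  have hs : ∀ i, HasSum (fun k => |α i| * (‖⟪e k, b i⟫_ℂ‖ ^ 2 + ‖⟪e k, T (b i)⟫_ℂ‖ ^ 2))
      (|α i| * (‖b i‖ ^ 2 + ‖T (b i)‖ ^ 2)) := fun i =>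
    ((hasSum_norm_inner_sq e _).add (hasSum_norm_inner_sq e _)).mul_left _
  have hsum : Summable (fun p : ι × _ => |α p.1| * (‖⟪e p.2, b p.1⟫_ℂ‖ ^ 2
      + ‖⟪e p.2, T (b p.1)⟫_ℂ‖ ^ 2)) := by
    refine (summable_prod_of_nonneg fun p => by positivity).2 ⟨fun i => (hs i).summable, ?_⟩
    refine Summable.of_nonneg_of_le (fun i => tsum_nonneg fun k => by positivity) (fun i => ?_)
      (hα.mul_right (1 + ‖T‖ ^ 2))
    rw [(hs i).tsum_eq, b.orthonormal.1 i, one_pow]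
    gcongr
    simpa [b.orthonormal.1 i] using T.le_opNorm (b i)
  exact (Summable.of_norm_bounded hsum fun p => hbd p.1 p.2).tsum_comm

end Trace

/-! ### Orthonormal bases of tensor products -/

section TensorBasis

variable {H₁ H₂ : Type*} [NormedAddCommGroup H₁] [InnerProductSpace ℂ H₁]
  [NormedAddCommGroup H₂] [InnerProductSpace ℂ H₂]

theorem inner_htmul (x x' : H₁) (y y' : H₂) :
    ⟪htmul x y, htmul x' y'⟫_ℂ = ⟪x, x'⟫_ℂ * ⟪y, y'⟫_ℂ := by
  rw [htmul, htmul, UniformSpace.Completion.inner_coe, TensorProduct.inner_tmul]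

theorem smul_htmul (c : ℂ) (x : H₁) (y : H₂) : htmul (c • x) y = c • htmul x y := by
  rw [htmul, htmul, ← UniformSpace.Completion.coe_smul, TensorProduct.smul_tmul']

theorem htmul_smul (c : ℂ) (x : H₁) (y : H₂) : htmul x (c • y) = c • htmul x y := by
  rw [htmul, htmul, ← UniformSpace.Completion.coe_smul, TensorProduct.tmul_smul]

theorem opTensor_htmul (T₁ : H₁ →L[ℂ] H₁) (T₂ : H₂ →L[ℂ] H₂) (x : H₁) (y : H₂) :
    opTensor T₁ T₂ (htmul x y) = htmul (T₁ x) (T₂ y) := by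
  rw [opTensor, htmul, ContinuousLinearMap.completion_apply_coe, TensorProduct.mapL_tmul]
  rfl

theorem eq_zero_of_inner_htmul {ι₁ ι₂ : Type*} (b₁ : HilbertBasis ι₁ ℂ H₁)
    (b₂ : HilbertBasis ι₂ ℂ H₂) {x : HTensor H₁ H₂}
    (hx : ∀ i j, ⟪x, htmul (b₁ i) (b₂ j)⟫_ℂ = 0) : x = 0 := by
  have h1 : ∀ i (z : H₂), ⟪x, htmul (b₁ i) z⟫_ℂ = 0 := fun i z => by
    have : ((innerSL ℂ x).comp UniformSpace.Completion.toComplL).comp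
        (TensorProduct.mkL ℂ H₁ H₂ (b₁ i)) = 0 := by
      refine ContinuousLinearMap.ext_on
        (Submodule.dense_iff_topologicalClosure_eq_top.2 b₂.dense_span) ?_
      rintro _ ⟨j, rfl⟩
      exact hx i j
    exact congrArg (fun f => f z) this
  have h2 : ∀ (y : H₁) (z : H₂), ⟪x, htmul y z⟫_ℂ = 0 := fun y z => by
    have : ((innerSL ℂ x).comp UniformSpace.Completion.toComplL).comp
        ((TensorProduct.mkL ℂ H₁ H₂).flip z) = 0 := by
      refine ContinuousLinearMap.ext_on
        (Submodule.dense_iff_topologicalClosure_eq_top.2 b₁.dense_span) ?_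
      rintro _ ⟨i, rfl⟩
      exact h1 i z
    exact congrArg (fun f => f y) this
  have h3 : ∀ z : HTensor H₁ H₂, ⟪x, z⟫_ℂ = 0 := fun z => by
    induction z using UniformSpace.Completion.induction_on with
    | hp => exact isClosed_eq (by fun_prop) continuous_const
    | ih w =>
      induction w using TensorProduct.induction_on with
      | zero => rw [UniformSpace.Completion.coe_zero, inner_zero_right]
      | tmul y z => exact h2 y z
      | add u w hu hw => rw [UniformSpace.Completion.coe_add, inner_add_right, hu, hw, add_zero]
  exact inner_self_eq_zero.1 (h3 x)

/-- The products of the members of two orthonormal bases form an orthonormal basis of the Hilbert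
space tensor product. -/
theorem exists_tensor_basis {ι₁ ι₂ : Type*} (b₁ : HilbertBasis ι₁ ℂ H₁)
    (b₂ : HilbertBasis ι₂ ℂ H₂) :
    ∃ b : HilbertBasis (ι₁ × ι₂) ℂ (HTensor H₁ H₂), ∀ i, b i = htmul (b₁ i.1) (b₂ i.2) := by
  classical
  have ho : Orthonormal ℂ fun i : ι₁ × ι₂ => htmul (b₁ i.1) (b₂ i.2) := by
    rw [orthonormal_iff_ite]
    rintro ⟨i, j⟩ ⟨i', j'⟩
    rw [inner_htmul, orthonormal_iff_ite.1 b₁.orthonormal, orthonormal_iff_ite.1 b₂.orthonormal]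
    by_cases hi : i = i' <;> by_cases hj : j = j' <;> simp [hi, hj]
  have hbot : (Submodule.span ℂ (Set.range fun i : ι₁ × ι₂ => htmul (b₁ i.1) (b₂ i.2)))ᗮ = ⊥ := by
    rw [eq_bot_iff]
    intro x hx
    refine (Submodule.mem_bot ℂ).2 (eq_zero_of_inner_htmul b₁ b₂ fun i j => ?_)
    exact (Submodule.mem_orthogonal' _ _).1 hx _ (Submodule.subset_span ⟨(i, j), rfl⟩)
  exact ⟨HilbertBasis.mkOfOrthogonalEqBot ho hbot, fun i => by
    rw [HilbertBasis.coe_mkOfOrthogonalEqBot]⟩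

end TensorBasis

/-! ### The spectrum of `D₁² ⊗ 1 + 1 ⊗ D₂²` -/

section TensorSum

/-- The closure of a symmetric relation whose domain contains an orthonormal basis is the graph of
a symmetric operator. -/
theorem graph_toLinearPMap_of_symmetric {H : Type*} [NormedAddCommGroup H] [InnerProductSpace ℂ H]
    {g : Set (H × H)} (hg : ∀ p ∈ g, ∀ q ∈ g, ⟪p.2, q.1⟫_ℂ = ⟪p.1, q.2⟫_ℂ) {ι : Type*}
    (b : HilbertBasis ι ℂ H) (hb : ∀ i, ∃ y, (b i, y) ∈ g) :
    let G := (Submodule.span ℂ g).topologicalClosure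
    G.toLinearPMap.graph = G ∧ G.toLinearPMap.IsFormalAdjoint G.toLinearPMap := by
  intro G
  let φ : H × H → (H × H →L[ℂ] ℂ) := fun p =>
    (innerSL ℂ p.2).comp (ContinuousLinearMap.fst ℂ H H)
      - (innerSL ℂ p.1).comp (ContinuousLinearMap.snd ℂ H H)
  have hφ : ∀ p q, φ p q = ⟪p.2, q.1⟫_ℂ - ⟪p.1, q.2⟫_ℂ := fun p q => rfl
  have hG : ∀ p, (∀ q ∈ g, φ p q = 0) → ∀ q ∈ G, φ p q = 0 := fun p hp q hq => by
    have hle : G ≤ LinearMap.ker (φ p : H × H →ₗ[ℂ] ℂ) :=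
      Submodule.topologicalClosure_minimal _ (Submodule.span_le.2 fun q hq => hp q hq)
        (φ p).isClosed_ker
    exact hle hq
  have hconj : ∀ p q, φ p q = 0 → φ q p = 0 := fun p q h => by
    rw [hφ, sub_eq_zero] at h ⊢
    rw [← inner_conj_symm, ← inner_conj_symm q.1, h]
  have hsymm : ∀ p ∈ G, ∀ q ∈ G, ⟪p.2, q.1⟫_ℂ = ⟪p.1, q.2⟫_ℂ := fun p hp q hq =>
    sub_eq_zero.1 (hG p
      (fun r hr => hconj _ _ (hG r (fun s hs => sub_eq_zero.2 (hg r hr s hs)) p hp)) q hq)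
  have hsub : g ⊆ G := fun p hp => Submodule.le_topologicalClosure _ (Submodule.subset_span hp)
  have hgraph : G.toLinearPMap.graph = G := by
    refine Submodule.toLinearPMap_graph_eq _ fun p hp hp1 => ?_
    have h1 : ∀ i, ⟪b i, p.2⟫_ℂ = 0 := fun i => by
      obtain ⟨y, hy⟩ := hb i
      have h2 := hsymm _ (hsub hy) p hp
      rw [hp1, inner_zero_right] at h2
      exact h2.symm
    refine b.repr.injective ?_
    ext i
    rw [b.repr_apply_apply, h1, map_zero]
    rfl
  refine ⟨hgraph, fun x y => ?_⟩
  have hx := G.toLinearPMap.mem_graph x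
  have hy := G.toLinearPMap.mem_graph y
  rw [hgraph] at hx hy
  exact hsymm _ hx _ hy

variable {H₁ H₂ : Type*} [NormedAddCommGroup H₁] [InnerProductSpace ℂ H₁]
  [NormedAddCommGroup H₂] [InnerProductSpace ℂ H₂]

theorem sq_mem_graph {H : Type*} [NormedAddCommGroup H] [InnerProductSpace ℂ H] {D : H →ₗ.[ℂ] H}
    {x : H} {r : ℝ} (hx : x ∈ eigenspace D r) :
    (x, (r : ℂ) • x) ∈ D.graph ∧ ((r : ℂ) • x, ((r : ℂ) * r) • x) ∈ D.graph := by
  have h : (x, (r : ℂ) • x) ∈ D.graph := hx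
  refine ⟨h, ?_⟩
  have := D.graph.smul_mem (r : ℂ) h
  rwa [Prod.smul_mk, smul_smul] at this

/-- Products of eigenvectors of `D₁` and `D₂` are eigenvectors of `D₁² ⊗ 1 + 1 ⊗ D₂²`. -/
theorem sqTensorSum_eigenbasis {D₁ : H₁ →ₗ.[ℂ] H₁} {D₂ : H₂ →ₗ.[ℂ] H₂}
    (hD₁ : D₁.IsFormalAdjoint D₁) (hD₂ : D₂.IsFormalAdjoint D₂) {ι₁ ι₂ : Type*}
    (b₁ : HilbertBasis ι₁ ℂ H₁) (b₂ : HilbertBasis ι₂ ℂ H₂) {r₁ : ι₁ → ℝ} {r₂ : ι₂ → ℝ}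
    (h₁ : ∀ i, b₁ i ∈ eigenspace D₁ (r₁ i)) (h₂ : ∀ j, b₂ j ∈ eigenspace D₂ (r₂ j))
    (b : HilbertBasis (ι₁ × ι₂) ℂ (HTensor H₁ H₂)) (hb : ∀ i, b i = htmul (b₁ i.1) (b₂ i.2)) :
    (sqTensorSum D₁ D₂).IsFormalAdjoint (sqTensorSum D₁ D₂) ∧
      ∀ i, b i ∈ eigenspace (sqTensorSum D₁ D₂) (r₁ i.1 ^ 2 + r₂ i.2 ^ 2) := by
  set g := {q : HTensor H₁ H₂ × HTensor H₁ H₂ | ∃ x₁ y₁ z₁ : H₁, ∃ x₂ y₂ z₂ : H₂,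
      (x₁, y₁) ∈ D₁.graph ∧ (y₁, z₁) ∈ D₁.graph ∧ (x₂, y₂) ∈ D₂.graph ∧ (y₂, z₂) ∈ D₂.graph ∧
      q = (htmul x₁ x₂, htmul z₁ x₂ + htmul x₁ z₂)} with hgdef
  have hmem : ∀ i, (b i, ((r₁ i.1 ^ 2 + r₂ i.2 ^ 2 : ℝ) : ℂ) • b i) ∈ g := fun i => by
    obtain ⟨e1, e2⟩ := sq_mem_graph (h₁ i.1)
    obtain ⟨e3, e4⟩ := sq_mem_graph (h₂ i.2)
    refine ⟨_, _, _, _, _, _, e1, e2, e3, e4, ?_⟩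
    rw [smul_htmul, htmul_smul, ← add_smul, hb]
    push_cast
    rw [sq, sq]
  have hg : ∀ p ∈ g, ∀ q ∈ g, ⟪p.2, q.1⟫_ℂ = ⟪p.1, q.2⟫_ℂ := by
    rintro _ ⟨x₁, y₁, z₁, x₂, y₂, z₂, a1, a2, a3, a4, rfl⟩
      _ ⟨x₁', y₁', z₁', x₂', y₂', z₂', c1, c2, c3, c4, rfl⟩
    simp only [inner_add_left, inner_add_right, inner_htmul]
    rw [inner_graph_symm hD₁ a2 c1, inner_graph_symm hD₁ a1 c2, inner_graph_symm hD₂ a4 c3,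
      inner_graph_symm hD₂ a3 c4]
  obtain ⟨hgraph, hsym⟩ := graph_toLinearPMap_of_symmetric hg b fun i => ⟨_, hmem i⟩
  refine ⟨hsym, fun i => ?_⟩
  change _ ∈ (Submodule.span ℂ g).topologicalClosure.toLinearPMap.graph
  rw [hgraph]
  exact Submodule.le_topologicalClosure _ (Submodule.subset_span (hmem i))

/-- If `(1 + x + y)^(-(p₁ + p₂)/2) > s` with `x, y ≥ 0`, then
`(1 + x)^(-p₁/2) > s^(p₁/(p₁ + p₂))` and `(1 + y)^(-p₂/2) > s^(p₂/(p₁ + p₂))`, so that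
the count is at most the product of two counts. -/
theorem WeakCount.prod {ι₁ ι₂ : Type*} {r₁ : ι₁ → ℝ} {r₂ : ι₂ → ℝ} {p₁ p₂ C₁ C₂ : ℝ}
    (hp₁ : 0 < p₁) (hp₂ : 0 < p₂) (h₁ : WeakCount (fun i => (1 + r₁ i ^ 2) ^ (-p₁ / 2)) C₁)
    (h₂ : WeakCount (fun j => (1 + r₂ j ^ 2) ^ (-p₂ / 2)) C₂) :
    WeakCount (fun i : ι₁ × ι₂ => (1 + (r₁ i.1 ^ 2 + r₂ i.2 ^ 2)) ^ (-(p₁ + p₂) / 2))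
      (C₁ * C₂) := by
  classical
  intro s hs J hJ
  have hp : 0 < p₁ + p₂ := by positivity
  have key : ∀ {x y q : ℝ}, 0 < q → 1 ≤ x → x ≤ y → s < y ^ (-(p₁ + p₂) / 2) →
      s ^ (q / (p₁ + p₂)) < x ^ (-q / 2) := by
    intro x y q hq hx hxy hsy
    have hx0 : 0 < x := by linarith
    have h3 : s < x ^ (-(p₁ + p₂) / 2) :=
      hsy.trans_le (Real.rpow_le_rpow_of_nonpos hx0 hxy (by linarith))
    have h4 := Real.rpow_lt_rpow hs.le h3 (show 0 < q / (p₁ + p₂) by positivity)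
    rw [← Real.rpow_mul hx0.le] at h4
    have h5 : -(p₁ + p₂) / 2 * (q / (p₁ + p₂)) = -q / 2 := by field_simp
    rwa [h5] at h4
  have c1 := h₁ (s ^ (p₁ / (p₁ + p₂))) (by positivity) (J.image Prod.fst) fun i hi => by
    obtain ⟨q, hq, rfl⟩ := Finset.mem_image.1 hi
    exact key hp₁ (by nlinarith [sq_nonneg (r₁ q.1)]) (by nlinarith [sq_nonneg (r₂ q.2)]) (hJ q hq)
  have c2 := h₂ (s ^ (p₂ / (p₁ + p₂))) (by positivity) (J.image Prod.snd) fun i hi => by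
    obtain ⟨q, hq, rfl⟩ := Finset.mem_image.1 hi
    exact key hp₂ (by nlinarith [sq_nonneg (r₂ q.2)]) (by nlinarith [sq_nonneg (r₁ q.1)]) (hJ q hq)
  have hcard : J.card ≤ (J.image Prod.fst).card * (J.image Prod.snd).card := by
    rw [← Finset.card_product]
    exact Finset.card_le_card fun q hq => Finset.mem_product.2
      ⟨Finset.mem_image_of_mem _ hq, Finset.mem_image_of_mem _ hq⟩
  have hs1 : s ^ (p₁ / (p₁ + p₂)) * s ^ (p₂ / (p₁ + p₂)) = s := by
    rw [← Real.rpow_add hs, ← add_div, div_self hp.ne', Real.rpow_one]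
  calc (J.card : ℝ) ≤ (J.image Prod.fst).card * (J.image Prod.snd).card := by exact_mod_cast hcard
    _ ≤ (C₁ / s ^ (p₁ / (p₁ + p₂))) * (C₂ / s ^ (p₂ / (p₁ + p₂))) := by
      have := h₁.nonneg
      gcongr
    _ = C₁ * C₂ / s := by rw [div_mul_div_comm, hs1]

end TensorSum

/-! ### Heat sums of products -/

section HeatProduct

open MeasureTheory

theorem expInv_mul_rpow {p : ℝ} (hp : 0 < p) {x t : ℝ} (hx : 0 < x) (ht : 0 < t) :
    expInv (2 / p) (t * x ^ (-p / 2)) = Real.exp (-(t ^ (-(2 / p)) * x)) := by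
  rw [expInv, Real.mul_rpow ht.le (by positivity), ← Real.rpow_mul hx.le]
  have : -p / 2 * -(2 / p) = 1 := by field_simp
  rw [this, Real.rpow_one]

theorem one_add_sq_rpow_pos (r p : ℝ) : 0 < (1 + r ^ 2) ^ (-p / 2) := by positivity

theorem rpow_neg_half_le_one {x p : ℝ} (hx : 1 ≤ x) (hp : 0 < p) : x ^ (-p / 2) ≤ 1 :=
  Real.rpow_le_one_of_one_le_of_nonpos hx (by linarith)

/-- The heat sum of a product: `exp(-τ (1 + x + y))` is `exp(τ)` times the product of
`exp(-τ (1 + x))` and `exp(-τ (1 + y))`, where `τ = t^(-2/(p₁ + p₂))`. In terms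
of `p₁` and of `p₂`, the same `τ` belongs to the parameters `t^(p₁/(p₁ + p₂))` and
`t^(p₂/(p₁ + p₂))`, whose product is `t`. -/
theorem heatSum_prod {ι₁ ι₂ : Type*} {r₁ : ι₁ → ℝ} {r₂ : ι₂ → ℝ} {p₁ p₂ C₁ C₂ : ℝ}
    (hp₁ : 0 < p₁) (hp₂ : 0 < p₂) (h₁ : WeakCount (fun i => (1 + r₁ i ^ 2) ^ (-p₁ / 2)) C₁)
    (h₂ : WeakCount (fun j => (1 + r₂ j ^ 2) ^ (-p₂ / 2)) C₂) {a₁ : ι₁ → ℂ} {a₂ : ι₂ → ℂ}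
    {M₁ M₂ : ℝ} (hM₁ : 0 ≤ M₁) (hM₂ : 0 ≤ M₂) (ha₁ : ∀ i, ‖a₁ i‖ ≤ M₁) (ha₂ : ∀ i, ‖a₂ i‖ ≤ M₂)
    {t : ℝ} (ht : 0 < t) :
    heatSum (fun i : ι₁ × ι₂ => (1 + (r₁ i.1 ^ 2 + r₂ i.2 ^ 2)) ^ (-(p₁ + p₂) / 2))
        (fun i => a₁ i.1 * a₂ i.2) (2 / (p₁ + p₂)) t
      = (Real.exp (t ^ (-(2 / (p₁ + p₂)))) : ℂ)
        * (heatSum (fun i => (1 + r₁ i ^ 2) ^ (-p₁ / 2)) a₁ (2 / p₁) (t ^ (p₁ / (p₁ + p₂)))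
        * heatSum (fun j => (1 + r₂ j ^ 2) ^ (-p₂ / 2)) a₂ (2 / p₂) (t ^ (p₂ / (p₁ + p₂)))) := by
  have hp : 0 < p₁ + p₂ := by positivity
  set t₁ := t ^ (p₁ / (p₁ + p₂)) with ht₁
  set t₂ := t ^ (p₂ / (p₁ + p₂)) with ht₂
  have ht₁0 : 0 < t₁ := Real.rpow_pos_of_pos ht _
  have ht₂0 : 0 < t₂ := Real.rpow_pos_of_pos ht _
  have hmul : t₁ * t₂ = t := by
    rw [ht₁, ht₂, ← Real.rpow_add ht, ← add_div, div_self hp.ne', Real.rpow_one]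
  have e₁ : t₁ ^ (-(2 / p₁)) = t ^ (-(2 / (p₁ + p₂))) := by
    rw [ht₁, ← Real.rpow_mul ht.le]; congr 1; field_simp
  have e₂ : t₂ ^ (-(2 / p₂)) = t ^ (-(2 / (p₁ + p₂))) := by
    rw [ht₂, ← Real.rpow_mul ht.le]; congr 1; field_simp
  have s₁ := summable_heat h₁ (fun i => one_add_sq_rpow_pos _ _) hM₁ ha₁
    (show 0 < 2 / p₁ by positivity) ht₁0
  have s₂ := summable_heat h₂ (fun i => one_add_sq_rpow_pos _ _) hM₂ ha₂
    (show 0 < 2 / p₂ by positivity) ht₂0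
  have hterm : ∀ i : ι₁ × ι₂, a₁ i.1 * a₂ i.2 * (expInv (2 / (p₁ + p₂))
      (t * (1 + (r₁ i.1 ^ 2 + r₂ i.2 ^ 2)) ^ (-(p₁ + p₂) / 2)) : ℂ)
      = (Real.exp (t ^ (-(2 / (p₁ + p₂)))) : ℂ)
        * ((a₁ i.1 * (expInv (2 / p₁) (t₁ * (1 + r₁ i.1 ^ 2) ^ (-p₁ / 2)) : ℂ))
        * (a₂ i.2 * (expInv (2 / p₂) (t₂ * (1 + r₂ i.2 ^ 2) ^ (-p₂ / 2)) : ℂ))) := fun i => by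
    have h3 : expInv (2 / (p₁ + p₂)) (t * (1 + (r₁ i.1 ^ 2 + r₂ i.2 ^ 2)) ^ (-(p₁ + p₂) / 2))
        = Real.exp (t ^ (-(2 / (p₁ + p₂)))) * (expInv (2 / p₁) (t₁ * (1 + r₁ i.1 ^ 2) ^ (-p₁ / 2))
        * expInv (2 / p₂) (t₂ * (1 + r₂ i.2 ^ 2) ^ (-p₂ / 2))) := by
      rw [expInv_mul_rpow hp (by positivity) ht, expInv_mul_rpow hp₁ (by positivity) ht₁0,
        expInv_mul_rpow hp₂ (by positivity) ht₂0, e₁, e₂, ← Real.exp_add, ← Real.exp_add]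
      congr 1
      ring
    rw [h3]
    push_cast
    ring
  rw [heatSum, heatSum, heatSum, tsum_congr hterm, tsum_mul_left, ← hmul,
    ← tsum_mul_tsum_of_summable_norm s₁.norm s₂.norm]
  push_cast
  rw [mul_inv]
  ring

/-- If one of two functions converges at infinity, then the limiting process is multiplicative on
them, even after they are composed with different powers. -/
theorem LinftyState.eval_prod_of_tendsto {ω : LinftyState} (hω : ω.IsLimitAtInfinity)
    (hP : ω.IsPowerInvariant) {F F₁ F₂ : ℝ → ℂ} {e : ℝ → ℂ} {u₁ u₂ : ℝ} (hu₁ : 0 < u₁)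
    (hu₂ : 0 < u₂) (he : Filter.Tendsto e Filter.atTop (𝓝 1)) (hF : MemLp F ∞ halfLine)
    (hF₁ : MemLp F₁ ∞ halfLine) (hc₂ : ContinuousOn F₂ (Set.Ioi 0)) {K : ℝ}
    (hK : ∀ t, 0 < t → ‖F₂ t‖ ≤ K)
    (hprod : ∀ t, 0 < t → F t = e t * (F₁ (t ^ u₁) * F₂ (t ^ u₂))) {c : ℂ}
    (hlim : Filter.Tendsto F₁ Filter.atTop (𝓝 c)) : ω.eval F = ω.eval F₁ * ω.eval F₂ := by
  have hF₂ : MemLp F₂ ∞ halfLine :=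
    memLp_halfLine (hc₂.aestronglyMeasurable measurableSet_Ioi) hK
  have hy : MemLp (fun t => F₂ (t ^ u₂)) ∞ halfLine := by
    refine memLp_halfLine (ContinuousOn.aestronglyMeasurable ?_ measurableSet_Ioi)
      fun t ht => hK _ (Real.rpow_pos_of_pos ht _)
    exact hc₂.comp (fun t (ht : 0 < t) =>
      (Real.continuousAt_rpow_const t _ (Or.inl ht.ne')).continuousWithinAt)
      fun t ht => Real.rpow_pos_of_pos ht _
  rw [hω.eval_eq_of_tendsto hF₁ hlim, ← hP u₂ hu₂ F₂ hF₂, ← ω.eval_smul c hy]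
  refine hω.eval_congr hF (hy.const_smul c) ?_
  have h1 : Filter.Tendsto (fun t => e t * F₁ (t ^ u₁) - c) Filter.atTop (𝓝 0) := by
    have := (he.mul (hlim.comp (tendsto_rpow_atTop hu₁))).sub_const c
    rwa [one_mul, sub_self] at this
  have h2 : Filter.Tendsto (fun t => ‖e t * F₁ (t ^ u₁) - c‖ * K) Filter.atTop (𝓝 0) := by
    have := h1.norm.mul_const K
    rwa [norm_zero, zero_mul] at this
  refine squeeze_zero_norm' ?_ h2
  filter_upwards [Filter.eventually_gt_atTop 0] with t ht
  have h3 : (F - c • fun t => F₂ (t ^ u₂)) t = (e t * F₁ (t ^ u₁) - c) * F₂ (t ^ u₂) := by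
    simp only [Pi.sub_apply, Pi.smul_apply, smul_eq_mul, hprod t ht]
    ring
  rw [h3, norm_mul]
  exact mul_le_mul_of_nonneg_left (hK _ (Real.rpow_pos_of_pos ht _)) (norm_nonneg _)

end HeatProduct

/-! ### Heat sums of spectral triples -/

section Triples

variable {H : Type*} [NormedAddCommGroup H] [InnerProductSpace ℂ H] [CompleteSpace H]

theorem SpectralTriple.bessel_apply (S : SpectralTriple H) {p : ℝ} (hp : 0 < p) {ι : Type*}
    (b : HilbertBasis ι ℂ H) {r : ι → ℝ} (hb : ∀ i, b i ∈ eigenspace S.D (r i)) (i : ι) :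
    S.bessel p (b i) = (((1 + r i ^ 2) ^ (-p / 2) : ℝ) : ℂ) • b i :=
  funCalc_apply_eigenvector (isFormalAdjoint_of_isSelfAdjoint S.isSelfAdjoint) b hb
    (C := 1) (fun j => by
      rw [abs_of_pos (one_add_sq_rpow_pos _ _)]
      exact rpow_neg_half_le_one (by nlinarith [sq_nonneg (r j)]) hp) i

theorem SpectralTriple.heat_apply (S : SpectralTriple H) (t : ℝ) {ι : Type*}
    (b : HilbertBasis ι ℂ H) {r : ι → ℝ} (hb : ∀ i, b i ∈ eigenspace S.D (r i)) (i : ι) :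
    S.heat t (b i) = ((Real.exp (-(t * r i) ^ 2) : ℝ) : ℂ) • b i :=
  funCalc_apply_eigenvector (isFormalAdjoint_of_isSelfAdjoint S.isSelfAdjoint) b hb
    (C := 1) (fun j => by
      rw [abs_of_pos (Real.exp_pos _), Real.exp_le_one_iff]
      exact neg_nonpos.2 (sq_nonneg _)) i

theorem SpectralTriple.exists_weakCount (S : SpectralTriple H) {p : ℝ} (hp : 0 < p)
    (hS : S.IsSummable p) {ι : Type*} (b : HilbertBasis ι ℂ H) {r : ι → ℝ}
    (hb : ∀ i, b i ∈ eigenspace S.D (r i)) :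
    ∃ C, WeakCount (fun i => (1 + r i ^ 2) ^ (-p / 2)) C := by
  obtain ⟨C, hC⟩ := weakCount_of_memWeakL1 b.orthonormal (S.bessel_apply hp b hb) hS
  refine ⟨C, ?_⟩
  simpa only [Complex.norm_real, Real.norm_of_nonneg (one_add_sq_rpow_pos _ _).le] using hC

/-- Up to the factor `exp(t²)`, which turns `1 + D²` into `D²` in the exponent, the heat trace
`t^p Tr(T exp(-(t D)²))` is the heat sum at `t^(-p)`. -/
theorem SpectralTriple.opTrace_heat (S : SpectralTriple H) {p : ℝ} (hp : 0 < p) {ι : Type*}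
    (b : HilbertBasis ι ℂ H) {r : ι → ℝ} (hb : ∀ i, b i ∈ eigenspace S.D (r i)) {C : ℝ}
    (hC : WeakCount (fun i => (1 + r i ^ 2) ^ (-p / 2)) C) (T : H →L[ℂ] H) {t : ℝ} (ht : 0 < t) :
    ((t ^ p : ℝ) : ℂ) * opTrace (T * S.heat t) = (Real.exp (t ^ 2) : ℂ)
      * heatSum (fun i => (1 + r i ^ 2) ^ (-p / 2)) (fun i => ⟪b i, T (b i)⟫_ℂ) (2 / p)
        (t ^ (-p)) := by
  have hx : 0 < t ^ (-p) := Real.rpow_pos_of_pos ht _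
  have h1 : ∀ i, Real.exp (-(t * r i) ^ 2)
      = Real.exp (t ^ 2) * expInv (2 / p) (t ^ (-p) * (1 + r i ^ 2) ^ (-p / 2)) := fun i => by
    rw [expInv_mul_rpow hp (by positivity) hx, ← Real.rpow_mul ht.le, ← Real.exp_add]
    have : -p * -(2 / p) = (2 : ℕ) := by push_cast; field_simp
    rw [this, Real.rpow_natCast]
    congr 1
    ring
  have h2 : Summable fun i => |Real.exp (-(t * r i) ^ 2)| := by
    have h3 := (summable_heat hC (fun i => one_add_sq_rpow_pos _ _) zero_le_one
      (a := fun _ => 1) (fun _ => by simp) (show 0 < 2 / p by positivity) hx).norm.mul_left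
        (Real.exp (t ^ 2))
    refine h3.congr fun i => ?_
    rw [one_mul, Complex.norm_real, Real.norm_of_nonneg (expInv_pos _ _).le, abs_of_pos
      (Real.exp_pos _), h1]
  have h4 : ∀ i, ((Real.exp (-(t * r i) ^ 2) : ℝ) : ℂ) * ⟪b i, T (b i)⟫_ℂ = (Real.exp (t ^ 2) : ℂ)
      * (⟪b i, T (b i)⟫_ℂ * (expInv (2 / p) (t ^ (-p) * (1 + r i ^ 2) ^ (-p / 2)) : ℂ)) :=
    fun i => by
      rw [h1, Complex.ofReal_mul]
      ring
  rw [opTrace_mul_diagonal b (S.heat_apply t b hb) h2, heatSum, tsum_congr h4, tsum_mul_left,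
    Real.rpow_neg ht.le, Complex.ofReal_inv, inv_inv]
  ring

/-- Theta convergence as `t → 0+` is convergence of the heat sums at infinity. -/
theorem SpectralTriple.ThetaConverges.exists_tendsto {S : SpectralTriple H} {p : ℝ}
    (h : S.ThetaConverges p) (hp : 0 < p) {ι : Type*}
    (b : HilbertBasis ι ℂ H) {r : ι → ℝ} (hb : ∀ i, b i ∈ eigenspace S.D (r i)) {C : ℝ}
    (hC : WeakCount (fun i => (1 + r i ^ 2) ^ (-p / 2)) C) {T : H →L[ℂ] H} (hT : T ∈ S.algebra) :
    ∃ c : ℂ, Filter.Tendsto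
      (heatSum (fun i => (1 + r i ^ 2) ^ (-p / 2)) (fun i => ⟪b i, T (b i)⟫_ℂ) (2 / p))
      Filter.atTop (𝓝 c) := by
  obtain ⟨c, hc⟩ := h T hT
  refine ⟨c, ?_⟩
  have h0 : Filter.Tendsto (fun s : ℝ => s ^ (-(1 / p))) Filter.atTop (𝓝 0) :=
    tendsto_rpow_neg_atTop (by positivity)
  have h1 : Filter.Tendsto (fun s : ℝ => s ^ (-(1 / p))) Filter.atTop (𝓝[>] 0) :=
    tendsto_nhdsWithin_iff.2 ⟨h0, by
      filter_upwards [Filter.eventually_gt_atTop 0] with s hs using Real.rpow_pos_of_pos hs _⟩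
  have h2 : Filter.Tendsto (fun s : ℝ => (Real.exp (-(s ^ (-(1 / p))) ^ 2) : ℂ)) Filter.atTop
      (𝓝 1) := by
    have h3 : Continuous fun x : ℝ => (Real.exp (-x ^ 2) : ℂ) := by fun_prop
    have h4 := (h3.tendsto 0).comp h0
    simpa [Function.comp_def] using h4
  have h5 := h2.mul (hc.comp h1)
  rw [one_mul] at h5
  refine h5.congr' ?_
  filter_upwards [Filter.eventually_gt_atTop 0] with s hs
  have hs' : 0 < s ^ (-(1 / p)) := Real.rpow_pos_of_pos hs _
  have h6 : (s ^ (-(1 / p))) ^ (-p) = s := by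
    rw [← Real.rpow_mul hs.le]
    have : -(1 / p) * -p = 1 := by field_simp
    rw [this, Real.rpow_one]
  rw [Function.comp_apply, S.opTrace_heat hp b hb hC T hs', h6, ← mul_assoc, ← Complex.ofReal_mul,
    ← Real.exp_add, neg_add_cancel, Real.exp_zero, Complex.ofReal_one, one_mul]

end Triples

end

end NCFubini

open NCFubini

theorem theorem1p9 {H₁ H₂ : Type*}
    [NormedAddCommGroup H₁] [InnerProductSpace ℂ H₁] [CompleteSpace H₁]
    [TopologicalSpace.SeparableSpace H₁] (hH₁ : ¬ FiniteDimensional ℂ H₁)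
    [NormedAddCommGroup H₂] [InnerProductSpace ℂ H₂] [CompleteSpace H₂]
    [TopologicalSpace.SeparableSpace H₂] (hH₂ : ¬ FiniteDimensional ℂ H₂)
    (S₁ : NCFubini.SpectralTriple H₁) (S₂ : NCFubini.SpectralTriple H₂)
    (p₁ p₂ : ℝ) (hp₁ : 0 < p₁) (hp₂ : 0 < p₂)
    (hS₁ : S₁.IsSummable p₁) (hS₂ : S₂.IsSummable p₂)
    (htheta : S₁.ThetaConverges p₁ ∨ S₂.ThetaConverges p₂)
    (T₁ : H₁ →L[ℂ] H₁) (hT₁ : T₁ ∈ S₁.algebra) (T₂ : H₂ →L[ℂ] H₂) (hT₂ : T₂ ∈ S₂.algebra)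
    (ω : NCFubini.LinftyState) (hω : ω.IsLimitAtInfinity) (hM : ω.IsMeanInvariant)
    (hP : ω.IsPowerInvariant) :
    (NCFubini.MemWeakL1 (T₁ * S₁.bessel p₁) ∧ NCFubini.MemWeakL1 (T₂ * S₂.bessel p₂) ∧
      NCFubini.MemWeakL1
        (NCFubini.opTensor T₁ T₂ * NCFubini.prodBessel S₁.D S₂.D (p₁ + p₂))) ∧
    (Real.Gamma (1 + (p₁ + p₂) / 2) : ℂ) *
        NCFubini.dixmierTrace ω
          (NCFubini.opTensor T₁ T₂ * NCFubini.prodBessel S₁.D S₂.D (p₁ + p₂)) =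
      ((Real.Gamma (1 + p₁ / 2) : ℂ) * NCFubini.dixmierTrace ω (T₁ * S₁.bessel p₁)) *
        ((Real.Gamma (1 + p₂ / 2) : ℂ) * NCFubini.dixmierTrace ω (T₂ * S₂.bessel p₂)) := by

  have hp : 0 < p₁ + p₂ := by positivity
  obtain ⟨w₁, b₁, r₁, hb₁⟩ := S₁.exists_eigenbasis
  obtain ⟨w₂, b₂, r₂, hb₂⟩ := S₂.exists_eigenbasis
  obtain ⟨C₁, h₁⟩ := S₁.exists_weakCount hp₁ hS₁ b₁ hb₁
  obtain ⟨C₂, h₂⟩ := S₂.exists_weakCount hp₂ hS₂ b₂ hb₂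
  obtain ⟨b, hb⟩ := exists_tensor_basis b₁ b₂
  obtain ⟨hsym, heig⟩ := sqTensorSum_eigenbasis
    (isFormalAdjoint_of_isSelfAdjoint S₁.isSelfAdjoint)
    (isFormalAdjoint_of_isSelfAdjoint S₂.isSelfAdjoint) b₁ b₂ hb₁ hb₂ b hb
  have h := h₁.prod hp₁ hp₂ h₂
  have v1 : ∀ i, (1 + r₁ i ^ 2) ^ (-p₁ / 2) ≤ 1 := fun i =>
    rpow_neg_half_le_one (by nlinarith [sq_nonneg (r₁ i)]) hp₁
  have v2 : ∀ i, (1 + r₂ i ^ 2) ^ (-p₂ / 2) ≤ 1 := fun i =>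
    rpow_neg_half_le_one (by nlinarith [sq_nonneg (r₂ i)]) hp₂
  have v12 : ∀ i : (Σ r, w₁ r) × (Σ r, w₂ r),
      (1 + (r₁ i.1 ^ 2 + r₂ i.2 ^ 2)) ^ (-(p₁ + p₂) / 2) ≤ 1 := fun i =>
    rpow_neg_half_le_one (by nlinarith [sq_nonneg (r₁ i.1), sq_nonneg (r₂ i.2)]) hp
  have v12pos : ∀ i : (Σ r, w₁ r) × (Σ r, w₂ r),
      0 < (1 + (r₁ i.1 ^ 2 + r₂ i.2 ^ 2)) ^ (-(p₁ + p₂) / 2) := fun i => by positivity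
  have hbes : ∀ i, prodBessel S₁.D S₂.D (p₁ + p₂) (b i)
      = (((1 + (r₁ i.1 ^ 2 + r₂ i.2 ^ 2)) ^ (-(p₁ + p₂) / 2) : ℝ) : ℂ) • b i :=
    funCalc_apply_eigenvector hsym b heig (C := 1) fun i => by
      rw [abs_of_pos (v12pos i)]
      exact v12 i
  refine ⟨⟨MemWeakL1.mul_left hS₁ T₁, MemWeakL1.mul_left hS₂ T₂,
    MemWeakL1.mul_left (WeakCount.memWeakL1 b hbes (C := C₁ * C₂) ?_) _⟩, ?_⟩
  · simpa only [Complex.norm_real, Real.norm_of_nonneg (v12pos _).le] using h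
  have q : ∀ {x : ℝ}, 1 / (2 / x) = x / 2 := fun {x} => one_div_div 2 x
  -- evaluate the three Dixmier traces by heat sums, with `q = 2/p`
  have d := dixmierTrace_eq_eval_heatSum b hbes v12pos v12 h (opTensor T₁ T₂)
    (show 0 < 2 / (p₁ + p₂) by positivity) hω hM
  have d₁ := dixmierTrace_eq_eval_heatSum b₁ (S₁.bessel_apply hp₁ b₁ hb₁)
    (fun i => one_add_sq_rpow_pos _ _) v1 h₁ T₁ (show 0 < 2 / p₁ by positivity) hω hM
  have d₂ := dixmierTrace_eq_eval_heatSum b₂ (S₂.bessel_apply hp₂ b₂ hb₂)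
    (fun i => one_add_sq_rpow_pos _ _) v2 h₂ T₂ (show 0 < 2 / p₂ by positivity) hω hM
  rw [q] at d d₁ d₂
  rw [d, d₁, d₂]
  have hdiag : (fun i => ⟪b i, opTensor T₁ T₂ (b i)⟫_ℂ)
      = fun i => ⟪b₁ i.1, T₁ (b₁ i.1)⟫_ℂ * ⟪b₂ i.2, T₂ (b₂ i.2)⟫_ℂ := funext fun i => by
    rw [hb, opTensor_htmul, inner_htmul]
  have ha := norm_inner_apply_le b (opTensor T₁ T₂)
  have ha₁ := norm_inner_apply_le b₁ T₁
  have ha₂ := norm_inner_apply_le b₂ T₂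
  have c := continuousOn_heatSum h v12pos v12 (norm_nonneg _) ha
    (show 0 < 2 / (p₁ + p₂) by positivity)
  have c₁ := continuousOn_heatSum h₁ (fun i => one_add_sq_rpow_pos _ _) v1 (norm_nonneg _) ha₁
    (show 0 < 2 / p₁ by positivity)
  have c₂ := continuousOn_heatSum h₂ (fun i => one_add_sq_rpow_pos _ _) v2 (norm_nonneg _) ha₂
    (show 0 < 2 / p₂ by positivity)
  obtain ⟨K, hK⟩ := exists_norm_heatSum_le h v12pos (norm_nonneg _) ha
    (show 0 < 2 / (p₁ + p₂) by positivity)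
  obtain ⟨K₁, hK₁⟩ := exists_norm_heatSum_le h₁ (fun i => one_add_sq_rpow_pos _ _)
    (norm_nonneg _) ha₁ (show 0 < 2 / p₁ by positivity)
  obtain ⟨K₂, hK₂⟩ := exists_norm_heatSum_le h₂ (fun i => one_add_sq_rpow_pos _ _)
    (norm_nonneg _) ha₂ (show 0 < 2 / p₂ by positivity)
  have m := memLp_halfLine (c.aestronglyMeasurable measurableSet_Ioi) hK
  rw [hdiag] at m ⊢
  have m₁ := memLp_halfLine (c₁.aestronglyMeasurable measurableSet_Ioi) hK₁
  have m₂ := memLp_halfLine (c₂.aestronglyMeasurable measurableSet_Ioi) hK₂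
  have hprod := fun (t : ℝ) (ht : 0 < t) =>
    heatSum_prod hp₁ hp₂ h₁ h₂ (norm_nonneg _) (norm_nonneg _) ha₁ ha₂ ht
  have he : Filter.Tendsto (fun t : ℝ => (Real.exp (t ^ (-(2 / (p₁ + p₂)))) : ℂ)) Filter.atTop
      (𝓝 1) := by
    have e1 : Continuous fun x : ℝ => (Real.exp x : ℂ) := by fun_prop
    have e2 := (e1.tendsto 0).comp
      (tendsto_rpow_neg_atTop (show 0 < 2 / (p₁ + p₂) by positivity))
    simpa [Function.comp_def] using e2
  rcases htheta with ht | ht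
  · obtain ⟨x, hx⟩ := ht.exists_tendsto hp₁ b₁ hb₁ h₁ hT₁
    exact LinftyState.eval_prod_of_tendsto hω hP (by positivity) (by positivity) he m m₁ c₂ hK₂
      hprod hx
  · obtain ⟨x, hx⟩ := ht.exists_tendsto hp₂ b₂ hb₂ h₂ hT₂
    rw [mul_comm (ω.eval (heatSum _ (fun i => ⟪b₁ i, T₁ (b₁ i)⟫_ℂ) _))]
    -- the same argument with the two factors exchanged
    exact LinftyState.eval_prod_of_tendsto hω hP (u₁ := p₂ / (p₁ + p₂)) (u₂ := p₁ / (p₁ + p₂))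
      (by positivity) (by positivity) he m m₂ c₁ hK₁
      (fun t ht => (hprod t ht).trans (congrArg _ (mul_comm _ _))) hx
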